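/- Let $X$ be a projective toric variety over $\mathbb C$ of dimension at least $1$ and let $B$ be a very ample line bundle on $X$, so that $X$ is the toric variety of a full-dimensional very ample lattice polytope $P$. Put $T_{kB}=H^0(X,kB)$, $S_{2B}=T_{2B}^*$ and $N=\dim_{\mathbb C}T_B$. For a point $\ell\in X$ let $\nu_2(\mathfrak b(\ell))\in S_{2B}$ be evaluation at $\ell$ (defined up to scaling). For $f\in S_{2B}$ define: * the catalecticant $\phi_{f,B}:T_B\to T_B^*$, $\phi_{f,B}(g)(h)=f(gh)$, and the antipolar $\Omega(f)(\ell)=\det\phi_{f+\nu_2(\mathfrak b(\ell)),B}-\det\phi_{f,B}$; * the $X$-rank of $f$: the least $s$ such that $f$ is in the linear span of $\nu_2(\mathfrak b(\ell_1)),\dots,\nu_2(\mathfrak b(\ell_s))$ for some $\ell_i\in X$; * a zero-dimensional subscheme $Z\subset X$ is apolar to $f$ (that is, $f\in\langle Z\rangle$) if $f$ vanishes on every section in $T_{2B}$ that vanishes on $Z$; * the forbidden locus $\mathfrak F(f)$: the points $\ell\in X$ that are not in the support of any smooth zero-dimensional subscheme of $X$ that is apolar to $f$ and has length equal to the $X$-rank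 of $f$; * the Ranestad-Schreyer locus $\mathfrak{RS}(f)$: the points $\ell\in X$ that are a non-reduced point of some zero-dimensional subscheme of $X$ that is apolar to $f$ and has length equal to the $X$-rank of $f$. For a general $f\in S_{2B}$ the map $\phi_{f,B}$ is an isomorphism. Let $f\in S_{2B}$ be such that $\phi_{f,B}$ is an isomorphism, and suppose that the $X$-rank of $f$ is $N$. Then: 1. if $Z\subset X$ is a zero-dimensional subscheme of length $N$ apolar to $f$ and $\ell\in Z$, then $Z$ is non-reduced at $\ell$ if and only if $\Omega(f)(\ell)=0$; hence $\mathfrak{RS}(f)$ is the set of the points of $\{\Omega(f)=0\}$ that lie on some zero-dimensional subscheme of length $N$ apolar to $f$; 2. $\mathfrak{RS}(f)\subseteq\{\Omega(f)=0\}\subseteq\mathfrak F(f)$; 3. $\mathfrak F(f)\neq\emptyset$. This applies to $X=\mathbb P^1\times\mathbb P^1$ with $B=(1,d)$ for every $d\ge 1$: here $B$ is very ample, $N=2d+2$, and for a general $f\in S_{2B}$ the map $\phi_{f,B}$ is an isomorphism, the $X$-rank of $f$ is $N$, and $\mathfrak{RS}(f)=\{\Omega(f)=0\}\subseteq\mathfrak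 F(f)\neq\emptyset$. -/

import Mathlib

open scoped Pointwise

noncomputable section

/-! ### Projective varieties presented by a section ring

`R = ⨁ₖ 𝒜 k` is a graded `ℂ`-algebra, to be read as the section ring `⨁ₖ H⁰(X, kB)` of a projective
variety `X = Proj R` with a very ample line bundle `B`, so that `T_B = 𝒜 1` and `T_{2B} = 𝒜 2`. -/

namespace Apolarity

section Graded

variable {R : Type*} [CommRing R] [Algebra ℂ R] (𝒜 : ℕ → Submodule ℂ R)

/-- The space `S_{2B}` of forms: the dual of `T_{2B}`. The hyperplane `H_f` is the kernel of `f`. -/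
abbrev Form : Type _ := Module.Dual ℂ (𝒜 2)

/-- A closed point `ℓ` of `X`, given by homogeneous coordinates: a closed point of the affine cone
`Spec R` at which not every section of `B` vanishes. Two of them give the same point of `X` iff they
differ by the action `χ ↦ tᵏ χ` on `𝒜 k` of some `t ∈ ℂˣ`. All loci below are invariant under this
action, so they are described as sets of homogeneous coordinate vectors. -/
structure Point where
  eval : R →ₐ[ℂ] ℂ
  exists_ne_zero : ∃ g ∈ 𝒜 1, eval g ≠ 0

variable {𝒜}

/-- The vector `ν₂(𝔟(ℓ))` of `S_{2B}`: evaluation at `ℓ` of sections of `2B`. -/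
def Point.square (l : Point 𝒜) : Form 𝒜 := l.eval.toLinearMap ∘ₗ (𝒜 2).subtype

/-- The `X`-rank of `f`, with respect to the embedding by `2B`: the least number of points of `X`
whose images span a linear space containing `f`. -/
def xRank (f : Form 𝒜) : ℕ :=
  sInf {s : ℕ | ∃ p : Fin s → Point 𝒜, f ∈ Submodule.span ℂ (Set.range fun i => (p i).square)}

variable (𝒜) in
/-- A general form has the property `p`: it holds on a nonempty Zariski open subset of `S_{2B}`. The
polynomial functions on `S_{2B}` are the polynomials in the linear functions `f ↦ f(g)`. -/
def ForGeneralForm (p : Form 𝒜 → Prop) : Prop :=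
  ∃ Q : MvPolynomial (𝒜 2) ℂ, (∃ f : Form 𝒜, MvPolynomial.eval (fun g => f g) Q ≠ 0) ∧
    ∀ f : Form 𝒜, MvPolynomial.eval (fun g => f g) Q ≠ 0 → p f

variable [GradedAlgebra 𝒜]

/-- Multiplication `T_B × T_B → T_{2B}`. -/
def mulOne : 𝒜 1 →ₗ[ℂ] 𝒜 1 →ₗ[ℂ] 𝒜 2 :=
  LinearMap.mk₂ ℂ
    (fun g h => ⟨(g : R) * h, SetLike.mul_mem_graded (i := 1) (j := 1) g.2 h.2⟩)
    (fun _ _ _ => Subtype.ext (add_mul _ _ _))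
    (fun _ _ _ => Subtype.ext (Algebra.smul_mul_assoc _ _ _))
    (fun _ _ _ => Subtype.ext (mul_add _ _ _))
    (fun _ _ _ => Subtype.ext (Algebra.mul_smul_comm _ _ _))

/-- The catalecticant `φ_{f,B} : T_B → S_B = T_B^*`, with `φ_{f,B}(g)(h) = f(g h)`. -/
def catalecticant (f : Form 𝒜) : 𝒜 1 →ₗ[ℂ] Module.Dual ℂ (𝒜 1) :=
  mulOne.compr₂ f

/-- The determinant of `φ_{f,B}`, with respect to a fixed basis of `T_B` and its dual basis. -/
def catalecticantDet [Module.Finite ℂ (𝒜 1)] (f : Form 𝒜) : ℂ :=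
  (LinearMap.toMatrix (Module.finBasis ℂ (𝒜 1)) (Module.finBasis ℂ (𝒜 1)).dualBasis
    (catalecticant f)).det

/-- The antipolar `Ω(f)(ℓ) = det φ_{f + ν₂(𝔟(ℓ)), B} - det φ_{f,B}`. -/
def antipolar [Module.Finite ℂ (𝒜 1)] (f : Form 𝒜) (l : Point 𝒜) : ℂ :=
  catalecticantDet (f + l.square) - catalecticantDet f

/-- The locus `{Ω(f) = 0}` in `X`. -/
def antipolarLocus [Module.Finite ℂ (𝒜 1)] (f : Form 𝒜) : Set (Point 𝒜) :=
  {l | antipolar f l = 0}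

variable (𝒜) in
/-- A zero-dimensional closed subscheme `Z` of `X = Proj R` of length `s`: a homogeneous ideal of `R`,
saturated with respect to the irrelevant ideal, whose Hilbert function is eventually equal to `s`.
Its part of degree `k` consists of the sections of `kB` that vanish on `Z`. -/
structure ZeroDimSubscheme (s : ℕ) where
  ideal : HomogeneousIdeal 𝒜
  saturated : ∀ a : R, (∀ b ∈ HomogeneousIdeal.irrelevant 𝒜, b * a ∈ ideal) → a ∈ ideal
  length_eq : ∃ k₀ : ℕ, ∀ k ≥ k₀, Module.finrank ℂ
    (𝒜 k ⧸ (ideal.toIdeal.restrictScalars ℂ).comap (𝒜 k).subtype) = s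

namespace ZeroDimSubscheme

variable {s : ℕ} (Z : ZeroDimSubscheme 𝒜 s)

/-- `Z` is apolar to `f`, that is `I_{Z,2B} ⊆ H_f`; equivalently `f ∈ ⟨Z⟩`. -/
def IsApolar (f : Form 𝒜) : Prop := ∀ g : 𝒜 2, (g : R) ∈ Z.ideal → f g = 0

/-- The support of `Z`. -/
def support : Set (Point 𝒜) := {l | ∀ a ∈ Z.ideal, l.eval a = 0}

/-- `Z` is smooth, that is reduced (as it is zero-dimensional over `ℂ`). -/
def IsSmooth : Prop := Z.ideal.toIdeal.IsRadical

/-- `ℓ` is a non-reduced point of `Z`: it lies in the support, and the local ring of `Z` at `ℓ` has a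
nonzero nilpotent element. Dividing by a section that does not vanish at `ℓ`, such an element is given
by a homogeneous `a`; its germ at `ℓ` is zero iff `h * a ∈ I_Z` for some homogeneous `h` with
`h(ℓ) ≠ 0`. -/
def IsNonreducedAt (l : Point 𝒜) : Prop :=
  l ∈ Z.support ∧ ∃ k : ℕ, ∃ a ∈ 𝒜 k,
    (¬ ∃ j : ℕ, ∃ h ∈ 𝒜 j, l.eval h ≠ 0 ∧ h * a ∈ Z.ideal) ∧
    ∃ m : ℕ, ∃ j : ℕ, ∃ h ∈ 𝒜 j, l.eval h ≠ 0 ∧ h * a ^ m ∈ Z.ideal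

end ZeroDimSubscheme

/-- The forbidden locus `𝔉(f)`: the points of `X` that are not in the support of any smooth
zero-dimensional subscheme `Z` of length `rk_X(f)` with `f ∈ ⟨Z⟩`. -/
def forbiddenLocus (f : Form 𝒜) : Set (Point 𝒜) :=
  {l | ¬ ∃ Z : ZeroDimSubscheme 𝒜 (xRank f), Z.IsSmooth ∧ Z.IsApolar f ∧ l ∈ Z.support}

/-- The Ranestad-Schreyer locus `ℜ𝔖(f)`: the points of `X` that are a non-reduced point of some
zero-dimensional subscheme `Z` of length `rk_X(f)` with `f ∈ ⟨Z⟩`. -/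
def ranestadSchreyerLocus (f : Form 𝒜) : Set (Point 𝒜) :=
  {l | ∃ Z : ZeroDimSubscheme 𝒜 (xRank f), Z.IsApolar f ∧ Z.IsNonreducedAt l}

end Graded

end Apolarity

/-! ### Polarized projective toric varieties -/

/-- A lattice polytope in `ℝⁿ` of dimension `n`, given as the convex hull of finitely many lattice
points. -/
structure LatticePolytope (n : ℕ) where
  points : Finset (Fin n → ℤ)
  interior_nonempty :
    (interior (convexHull ℝ ((fun (v : Fin n → ℤ) (i : Fin n) => (v i : ℝ)) '' points))).Nonempty

namespace LatticePolytope

variable {n : ℕ} (P : LatticePolytope n)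

/-- The polytope as a subset of `ℝⁿ`. -/
def body : Set (Fin n → ℝ) :=
  convexHull ℝ ((fun (v : Fin n → ℤ) (i : Fin n) => (v i : ℝ)) '' P.points)

/-- The set `P ∩ ℤⁿ`. -/
def latticePoints : Set (Fin n → ℤ) := {m | (fun i => (m i : ℝ) : Fin n → ℝ) ∈ P.body}

/-- The lattice polytope `P` is very ample: for each vertex `v`, the semigroup generated by
`P ∩ ℤⁿ - v` is saturated in `ℤⁿ`. -/
def IsVeryAmple : Prop :=
  ∀ v : Fin n → ℤ, (fun i => (v i : ℝ) : Fin n → ℝ) ∈ Set.extremePoints ℝ P.body →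
    ∀ m : Fin n → ℤ, ∀ k : ℕ, 0 < k →
      k • m ∈ AddSubmonoid.closure ((fun u => u - v) '' P.latticePoints) →
      m ∈ AddSubmonoid.closure ((fun u => u - v) '' P.latticePoints)

/-- The semigroup of the pairs `(k, m)` with `m` a lattice point of `k P`. -/
def cone : AddSubmonoid (ℕ × (Fin n → ℤ)) where
  carrier := {c | (fun i => (c.2 i : ℝ)) ∈ (c.1 : ℝ) • P.body}
  zero_mem' := by
    have h : P.body.Nonempty := P.interior_nonempty.mono interior_subset
    show (fun i => (((0 : ℕ × (Fin n → ℤ)).2 i : ℤ) : ℝ)) ∈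
      (((0 : ℕ × (Fin n → ℤ)).1 : ℕ) : ℝ) • P.body
    rw [Prod.fst_zero, Nat.cast_zero, Set.zero_smul_set h]
    ext i
    simp
  add_mem' := by
    intro a b ha hb
    have hc : Convex ℝ P.body := convex_convexHull ℝ _
    show (fun i => (((a + b).2 i : ℤ) : ℝ)) ∈ (((a + b).1 : ℕ) : ℝ) • P.body
    rw [Prod.fst_add, Nat.cast_add, hc.add_smul (Nat.cast_nonneg _) (Nat.cast_nonneg _)]
    refine Set.mem_add.2 ⟨_, ha, _, hb, ?_⟩
    ext i
    simp

/-- The section ring `⨁ₖ H⁰(X_P, k B)` of the projective toric variety `X_P` of `P` with its line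
bundle `B = B_P`: the algebra of the cone over `P`, in which `(k, m)` stands for the section of `k B`
that is the character of the torus with exponent `m`. -/
abbrev SectionRing : Type := AddMonoidAlgebra ℂ P.cone

/-- The degree `(k, m) ↦ k`. -/
def degree : P.cone →+ ℕ := (AddMonoidHom.fst ℕ (Fin n → ℤ)).comp P.cone.subtype

/-- `P.sections k` is the space `T_{kB} = H⁰(X_P, k B)`, with basis the lattice points of `k P`. -/
abbrev sections (k : ℕ) : Submodule ℂ P.SectionRing := AddMonoidAlgebra.gradeBy ℂ P.degree k

theorem exists_bound : ∃ C : ℤ, ∀ x ∈ P.body, ∀ i, |x i| ≤ C := by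
  refine ⟨∑ v ∈ P.points, ∑ i, |v i|, ?_⟩
  have hsub : P.body ⊆ Set.Icc (fun _ => -((∑ v ∈ P.points, ∑ i, |v i| : ℤ) : ℝ))
      (fun _ => ((∑ v ∈ P.points, ∑ i, |v i| : ℤ) : ℝ)) := by
    refine convexHull_min ?_ (convex_Icc _ _)
    rintro _ ⟨v, hv, rfl⟩
    have h : ∀ i, |v i| ≤ ∑ v ∈ P.points, ∑ i, |v i| := fun i =>
      (Finset.single_le_sum (f := fun i => |v i|) (fun _ _ => abs_nonneg _)
        (Finset.mem_univ i)).trans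
      (Finset.single_le_sum (f := fun v : Fin n → ℤ => ∑ i, |v i|)
        (fun _ _ => Finset.sum_nonneg fun _ _ => abs_nonneg _) hv)
    refine ⟨fun i => ?_, fun i => ?_⟩
    · show -((∑ v ∈ P.points, ∑ i, |v i| : ℤ) : ℝ) ≤ (v i : ℝ)
      exact_mod_cast (abs_le.1 (h i)).1
    · show (v i : ℝ) ≤ ((∑ v ∈ P.points, ∑ i, |v i| : ℤ) : ℝ)
      exact_mod_cast (abs_le.1 (h i)).2
  exact fun x hx i => abs_le.2 ⟨(hsub hx).1 i, (hsub hx).2 i⟩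

theorem finite_degree (k : ℕ) : {c : P.cone | P.degree c = k}.Finite := by
  obtain ⟨C, hC⟩ := P.exists_bound
  refine Set.Finite.of_finite_image (f := fun c : P.cone => (c : ℕ × (Fin n → ℤ)))
    (((Set.finite_Icc k k).prod
      (Set.finite_Icc (fun _ : Fin n => -(k * C)) (fun _ => k * C))).subset ?_)
    Subtype.val_injective.injOn
  rintro _ ⟨⟨⟨k', m⟩, hc⟩, hk, rfl⟩
  obtain rfl : k' = k := hk
  obtain ⟨x, hx, hxm⟩ := Set.mem_smul_set.1 (show (fun i => (m i : ℝ)) ∈ (k' : ℝ) • P.body from hc)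
  have h : ∀ i, |m i| ≤ k' * C := by
    intro i
    have h1 : (m i : ℝ) = k' * x i := (congrFun hxm i).symm
    have h2 : |(m i : ℝ)| ≤ k' * C := by
      rw [h1, abs_mul, Nat.abs_cast]
      exact mul_le_mul_of_nonneg_left (hC x hx i) (Nat.cast_nonneg _)
    exact_mod_cast h2
  exact ⟨⟨le_rfl, le_rfl⟩, fun i => (abs_le.1 (h i)).1, fun i => (abs_le.1 (h i)).2⟩

instance (k : ℕ) : Module.Finite ℂ (P.sections k) := by
  have hf : Finite {c : P.cone | P.degree c = k} := P.finite_degree k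
  have := Fintype.ofFinite {c : P.cone | P.degree c = k}
  refine Module.Finite.of_injective
    (LinearMap.pi (fun c : {c : P.cone | P.degree c = k} =>
      ({ toFun := fun a => a.1.coeff c.1
         map_add' := fun _ _ => rfl
         map_smul' := fun _ _ => rfl } : P.sections k →ₗ[ℂ] ℂ))) ?_
  rw [← LinearMap.ker_eq_bot, LinearMap.ker_eq_bot']
  intro a ha
  refine Subtype.ext (AddMonoidAlgebra.ext (Finsupp.ext fun c => ?_))
  by_contra hc
  have hd : P.degree c = k := a.2 c (Finsupp.mem_support_iff.2 hc)
  exact hc (congrFun ha ⟨c, hd⟩)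

/-- The rectangle `[0,1] × [0,d]`. Its toric variety is `ℙ¹ × ℙ¹` with the line bundle `(1,d)`: the
lattice point `(i,j)` of its `k`-th multiple is the bihomogeneous monomial
`x^i y^(k-i) z^j w^(kd-j)` of bidegree `(k,kd)`. -/
def rectangle (d : ℕ) (hd : 1 ≤ d) : LatticePolytope 2 where
  points := {![0, 0], ![1, 0], ![0, (d : ℤ)], ![1, (d : ℤ)]}
  interior_nonempty := by
    have hd0 : (0 : ℝ) < d := by exact_mod_cast hd
    refine ⟨![1 / 2, d / 2], mem_interior.2
      ⟨Set.univ.pi ![Set.Ioo 0 1, Set.Ioo 0 (d : ℝ)], ?_, ?_, ?_⟩⟩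
    · intro x hx
      have h0 : x 0 ∈ Set.Ioo (0 : ℝ) 1 := hx 0 trivial
      have h1 : x 1 ∈ Set.Ioo (0 : ℝ) d := hx 1 trivial
      set K := convexHull ℝ ((fun (v : Fin 2 → ℤ) (i : Fin 2) => (v i : ℝ)) ''
        (({![0, 0], ![1, 0], ![0, (d : ℤ)], ![1, (d : ℤ)]} : Finset (Fin 2 → ℤ)) :
          Set (Fin 2 → ℤ))) with hK
      have hc : Convex ℝ K := convex_convexHull ℝ _
      have hv : ∀ v ∈ ({![0, 0], ![1, 0], ![0, (d : ℤ)], ![1, (d : ℤ)]} : Finset (Fin 2 → ℤ)),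
          (fun i => (v i : ℝ)) ∈ K := fun v hv => subset_convexHull ℝ _ ⟨v, hv, rfl⟩
      have hs : 0 ≤ 1 - x 0 := by linarith [h0.2]
      have ha := hc (hv ![0, 0] (by simp)) (hv ![1, 0] (by simp)) hs h0.1.le (by ring)
      have hb := hc (hv ![0, (d : ℤ)] (by simp)) (hv ![1, (d : ℤ)] (by simp)) hs h0.1.le (by ring)
      have ht : 0 ≤ 1 - x 1 / d := by
        rw [sub_nonneg, div_le_one hd0]
        exact h1.2.le
      have h := hc ha hb ht (div_nonneg h1.1.le hd0.le) (by ring)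
      convert h using 1
      ext i
      fin_cases i
      · simp
        ring
      · simp
        field_simp
        ring
    · refine isOpen_set_pi Set.finite_univ fun i _ => ?_
      fin_cases i
      · exact isOpen_Ioo
      · exact isOpen_Ioo
    · intro i _
      fin_cases i
      · exact ⟨by norm_num, by norm_num⟩
      · exact ⟨by simpa using hd0, by simpa using hd0⟩

end LatticePolytope

end

open Apolarity

/-! ### The antipolar in terms of the section dual to a point. -/

namespace Apolarity

section Graded

variable {R : Type*} [CommRing R] [Algebra ℂ R] {𝒜 : ℕ → Submodule ℂ R} [GradedAlgebra 𝒜]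

/-! General statement. Fix a point ℓ and let g in T_B be the section with f(gh) = h(ℓ) for all h in
T_B; it exists because φ_f is an isomorphism. Adding the square of ℓ changes φ_f by a rank one term,
so the matrix determinant lemma gives Ω(f)(ℓ) = det φ_f · g(ℓ) (`antipolar_eq`).

Let Z be apolar to f, of length N = dim T_B. A section of B vanishing on Z lies in the kernel of
φ_f, so it is zero. Let b be a section of B vanishing nowhere on Z. Counting dimensions, division by
b identifies T_B with the coordinate ring of Z, and all sections of multiples of B on Z reduce to
sections of B. Then f becomes a nondegenerate functional on this ring, and g represents evaluation
at ℓ, so the maximal ideal of ℓ annihilates g. If g(ℓ) ≠ 0, then g is a unit at ℓ and the local ring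
is ℂ; if g(ℓ) = 0, then g is nonzero at ℓ with square zero. This is `isNonreducedAt_iff`, and the
inclusions of loci follow.

As g depends linearly on evaluation at ℓ, the function g(ℓ) is given by a section of 2B. On a toric
variety of positive dimension such a section has a zero, found on a one-parameter family of points
and its limit (`exists_eval_eq_zero`). So {Ω(f) = 0} is nonempty, and with it the forbidden locus.

The case ℙ¹ × ℙ¹, B = (1,d). It must be shown that a general f has rank 2d+2 and that every point
lies on an apolar scheme of that length. The forms of bidegree (1,d+1) apolar to f have dimension at
least 4. For general f, even those through a given point include one that defines a smooth rational
curve F₀y + F₁x = 0, the graph of a map ℙ¹ → ℙ¹ (`exists_irreducible`). Restriction to this curve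
identifies forms of bidegree (1,d) with binary forms of degree 2d+1, and f factors through a
functional μ on binary forms of degree 4d+2 (`exists_functional_restrictTwo`). Forms of degree 2d+2
apolar to μ make up a space of dimension at least 2. One of them is square-free, which gives the
rank (`xRank_eq`); one of them vanishes at the given point, which gives the apolar scheme
(`exists_apolar`). -/

theorem catalecticant_apply (f : Form 𝒜) (g h : 𝒜 1) :
    catalecticant f g h = f (mulOne g h) := rfl

theorem coe_mulOne (g h : 𝒜 1) : ((mulOne g h : 𝒜 2) : R) = g * h := rfl

theorem Point.square_mulOne (l : Point 𝒜) (g h : 𝒜 1) :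
    l.square (mulOne g h) = l.eval g * l.eval h :=
  map_mul l.eval _ _

section Antipolar

variable [Module.Finite ℂ (𝒜 1)]

variable (𝒜) in
/-- The vector of the values at `l` of the basis of `T_B`. -/
noncomputable def Point.basisValues (l : Point 𝒜) :
    Fin (Module.finrank ℂ (𝒜 1)) → ℂ := fun i => l.eval (Module.finBasis ℂ (𝒜 1) i)

/-- The matrix of the catalecticant. -/
noncomputable def catalecticantMatrix (f : Form 𝒜) :
    Matrix (Fin (Module.finrank ℂ (𝒜 1))) (Fin (Module.finrank ℂ (𝒜 1))) ℂ :=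
  LinearMap.toMatrix (Module.finBasis ℂ (𝒜 1)) (Module.finBasis ℂ (𝒜 1)).dualBasis
    (catalecticant f)

theorem catalecticantMatrix_apply (f : Form 𝒜) (i j) :
    catalecticantMatrix f i j =
      f (mulOne (Module.finBasis ℂ (𝒜 1) j) (Module.finBasis ℂ (𝒜 1) i)) := by
  rw [catalecticantMatrix, LinearMap.toMatrix_apply, Module.Basis.dualBasis_repr,
    catalecticant_apply]

theorem catalecticantMatrix_det (f : Form 𝒜) :
    (catalecticantMatrix f).det = catalecticantDet f := rfl

theorem catalecticantDet_ne_zero_iff (f : Form 𝒜) :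
    catalecticantDet f ≠ 0 ↔ Function.Bijective (catalecticant f) := by
  rw [← isUnit_iff_ne_zero, ← catalecticantMatrix_det, catalecticantMatrix]
  constructor
  · intro h
    have := (LinearEquiv.ofIsUnitDet h).bijective
    exact this
  · intro h
    have := LinearEquiv.isUnit_det (LinearEquiv.ofBijective (catalecticant f) h)
      (Module.finBasis ℂ (𝒜 1)) (Module.finBasis ℂ (𝒜 1)).dualBasis
    exact this

/-- Evaluation at a point is multiplicative, so the square of a point contributes a product of a
column and a row; this is the input for the matrix determinant lemma. -/
theorem catalecticantMatrix_add_square (f : Form 𝒜) (l : Point 𝒜) :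
    catalecticantMatrix (f + l.square) = catalecticantMatrix f +
      Matrix.replicateCol Unit (l.basisValues 𝒜) * Matrix.replicateRow Unit (l.basisValues 𝒜) := by
  ext i j
  rw [Matrix.add_apply, catalecticantMatrix_apply, catalecticantMatrix_apply, LinearMap.add_apply,
    Point.square_mulOne]
  simp [Matrix.mul_apply, Point.basisValues, mul_comm]

open Matrix in
theorem catalecticantMatrix_mulVec (f : Form 𝒜) (g : 𝒜 1) (i) :
    (catalecticantMatrix f *ᵥ (Module.finBasis ℂ (𝒜 1)).repr g) i =
      f (mulOne g (Module.finBasis ℂ (𝒜 1) i)) := by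
  have h := LinearMap.congr_arg (f := f ∘ₗ mulOne.flip (Module.finBasis ℂ (𝒜 1) i))
    ((Module.finBasis ℂ (𝒜 1)).sum_repr g)
  rw [map_sum] at h
  refine Eq.trans ?_ h
  simp [Matrix.mulVec, dotProduct, catalecticantMatrix_apply, mul_comm]

open Matrix in
/-- `Ω(f)(ℓ) = det φ_f * g(ℓ)`, where `g` is the preimage of `ℓ` under `φ_f`. -/
theorem antipolar_eq {f : Form 𝒜} (hf : Function.Bijective (catalecticant f)) (l : Point 𝒜)
    (g : 𝒜 1) (hg : ∀ h : 𝒜 1, f (mulOne g h) = l.eval h) :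
    antipolar f l = catalecticantDet f * l.eval g := by
  have hdet : IsUnit (catalecticantMatrix f).det :=
    isUnit_iff_ne_zero.2 ((catalecticantDet_ne_zero_iff f).2 hf)
  have hv : catalecticantMatrix f *ᵥ (Module.finBasis ℂ (𝒜 1)).repr g = l.basisValues 𝒜 := by
    ext i
    rw [catalecticantMatrix_mulVec, hg]
    rfl
  have hc : (catalecticantMatrix f)⁻¹ *ᵥ l.basisValues 𝒜 = (Module.finBasis ℂ (𝒜 1)).repr g := by
    rw [← hv, Matrix.mulVec_mulVec, Matrix.nonsing_inv_mul _ hdet, Matrix.one_mulVec]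
  have hl : l.eval g = ∑ i, l.basisValues 𝒜 i * (Module.finBasis ℂ (𝒜 1)).repr g i := by
    have h := LinearMap.congr_arg (f := l.eval.toLinearMap ∘ₗ (𝒜 1).subtype)
      ((Module.finBasis ℂ (𝒜 1)).sum_repr g)
    rw [map_sum] at h
    refine h.symm.trans ?_
    simp [Point.basisValues, mul_comm]
  -- Matrix determinant lemma: det(M + vvᵀ) = det M · (1 + vᵀM⁻¹v), where M⁻¹v is the coordinate
  -- vector of `g` and vᵀM⁻¹v is its value at `l`.
  rw [antipolar, ← catalecticantMatrix_det, ← catalecticantMatrix_det,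
    catalecticantMatrix_add_square, Matrix.det_add_replicateCol_mul_replicateRow hdet,
    Matrix.det_unique (1 + _), Matrix.add_apply, Matrix.one_apply_eq, Matrix.mul_assoc, hl, ← hc]
  rw [show (catalecticantMatrix f)⁻¹ * replicateCol Unit (l.basisValues 𝒜) =
    replicateCol Unit ((catalecticantMatrix f)⁻¹ *ᵥ l.basisValues 𝒜) by
      rw [Matrix.replicateCol_mulVec]]
  simp [Matrix.mul_apply]
  ring

theorem antipolar_eq_zero_iff {f : Form 𝒜} (hf : Function.Bijective (catalecticant f))
    (l : Point 𝒜) (g : 𝒜 1) (hg : ∀ h : 𝒜 1, f (mulOne g h) = l.eval h) :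
    antipolar f l = 0 ↔ l.eval g = 0 := by
  rw [antipolar_eq hf l g hg, mul_eq_zero, or_iff_right ((catalecticantDet_ne_zero_iff f).2 hf)]

end Antipolar

/-- This `g` is the bridge between the antipolar and the local structure: on an apolar scheme of
length dim T_B through `l` it spans the socle of the local ring at `l`. -/
theorem exists_mulOne_eq_eval {f : Form 𝒜} (hf : Function.Bijective (catalecticant f))
    (l : Point 𝒜) : ∃ g : 𝒜 1, ∀ h : 𝒜 1, f (mulOne g h) = l.eval h := by
  obtain ⟨g, hg⟩ := hf.2 (l.eval.toLinearMap ∘ₗ (𝒜 1).subtype)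
  exact ⟨g, fun h => LinearMap.congr_fun hg h⟩

end Graded

/-! ### Avoiding finitely many subspaces, and nonzerodivisors in a linear system. -/

section Avoidance

variable {k V : Type*} [DivisionRing k] [Infinite k] [AddCommGroup V] [Module k V]

/-- Finitely many proper subspaces can be avoided. -/
theorem exists_forall_notMem_of_ne_top {ι : Type*} {s : Set ι} (hs : s.Finite)
    (p : ι → Submodule k V) (hp : ∀ i ∈ s, p i ≠ ⊤) : ∃ v : V, ∀ i ∈ s, v ∉ p i := by
  by_contra! h
  have : Finite s := hs
  obtain ⟨i, hi⟩ := Subspace.exists_eq_top_of_iUnion_eq_univ (p := fun i : s => p i)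
    (Set.eq_univ_of_forall fun v => by
      obtain ⟨i, hi, hv⟩ := h v
      exact Set.mem_iUnion.2 ⟨⟨i, hi⟩, hv⟩)
  exact hp i i.2 hi

/-- Finitely many subspaces that do not contain the subspace `W` can be avoided within `W`. -/
theorem Submodule.exists_mem_forall_notMem {ι : Type*} {s : Set ι} (hs : s.Finite)
    (W : Submodule k V) (p : ι → Submodule k V) (hp : ∀ i ∈ s, ¬ W ≤ p i) :
    ∃ v ∈ W, ∀ i ∈ s, v ∉ p i := by
  obtain ⟨v, hv⟩ := exists_forall_notMem_of_ne_top hs (fun i => (p i).comap W.subtype)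
    fun i hi h => hp i hi fun x hx => by
      have : (⟨x, hx⟩ : W) ∈ (p i).comap W.subtype := h ▸ Submodule.mem_top
      exact this
  exact ⟨v, v.2, hv⟩

end Avoidance

section NonzeroDivisor

variable {R : Type*} [CommRing R] [Algebra ℂ R] [IsNoetherianRing R]

/-- A linear system without a common annihilator modulo `I` has a member that is a nonzerodivisor
modulo `I`. -/
theorem exists_mem_forall_mul_mem (I : Ideal R) (V : Submodule ℂ R)
    (hV : ∀ a, (∀ b ∈ V, b * a ∈ I) → a ∈ I) : ∃ b ∈ V, ∀ a, b * a ∈ I → a ∈ I := by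
  -- The zero divisors modulo `I` form the union of finitely many associated primes. Each of these
  -- annihilates a nonzero class, so by `hV` none contains all of `V`.
  obtain ⟨b, hb, hb'⟩ := Submodule.exists_mem_forall_notMem
    (associatedPrimes.finite R (R ⧸ I)) V (fun 𝔭 => 𝔭.restrictScalars ℂ) (by
      intro 𝔭 h𝔭 hle
      rw [AssociatedPrimes.mem_iff, isAssociatedPrime_iff] at h𝔭
      obtain ⟨hp, x, rfl⟩ := h𝔭
      obtain ⟨a, rfl⟩ := Ideal.Quotient.mk_surjective x
      have ha : a ∈ I := hV a fun b hb => by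
        have := hle hb
        rw [Submodule.restrictScalars_mem, Submodule.mem_colon_singleton, Submodule.mem_bot] at this
        exact Ideal.Quotient.eq_zero_iff_mem.1 this
      rw [Ideal.Quotient.eq_zero_iff_mem.2 ha] at hp
      exact hp.ne_top (by ext; simp))
  refine ⟨b, hb, fun a ha => ?_⟩
  by_contra hI
  have : b ∈ ⋃ p ∈ associatedPrimes R (R ⧸ I), (p : Set R) := by
    rw [biUnion_associatedPrimes_eq_zero_divisors]
    exact ⟨Ideal.Quotient.mk I a, fun h => hI (Ideal.Quotient.eq_zero_iff_mem.1 h),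
      Ideal.Quotient.eq_zero_iff_mem.2 ha⟩
  obtain ⟨p, hp, hbp⟩ := Set.mem_iUnion₂.1 this
  exact hb' p hp hbp

end NonzeroDivisor

end Apolarity

/-! ### The local structure of apolar subschemes of length dim T_B. -/

namespace Apolarity

section Graded

variable {R : Type*} [CommRing R] [Algebra ℂ R] {𝒜 : ℕ → Submodule ℂ R} [GradedAlgebra 𝒜]

variable (𝒜) in
/-- `B` is generated by its sections up to the irrelevant ideal: sections of high multiples of `B`
are in the ideal generated by the sections of `B`. -/
def IsGeneratedInHighDegree : Prop :=
  ∃ c : ℕ, ∀ k ≥ c, ∀ a ∈ 𝒜 k, a ∈ Ideal.span (𝒜 1 : Set R)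

theorem IsGeneratedInHighDegree.irrelevant_le_radical (h : IsGeneratedInHighDegree 𝒜) :
    (HomogeneousIdeal.irrelevant 𝒜).toIdeal ≤ (Ideal.span (𝒜 1 : Set R)).radical := by
  obtain ⟨c, hc⟩ := h
  rw [HomogeneousIdeal.irrelevant_eq_span, Ideal.span_le]
  refine Set.iUnion_subset fun i => Set.iUnion_subset fun hi x hx => ⟨c, ?_⟩
  refine hc (c • i) ?_ _ (SetLike.pow_mem_graded c hx)
  exact Nat.le_mul_of_pos_right c hi

namespace ZeroDimSubscheme

variable {s : ℕ} (Z : ZeroDimSubscheme 𝒜 s)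

/-- Saturation is defined by the irrelevant ideal. A power of that ideal lies in the ideal generated
by the sections of `B`, so saturation is applied once for each factor of the power. -/
theorem mem_of_forall_mul_mem [IsNoetherianRing R] (h : IsGeneratedInHighDegree 𝒜) {a : R}
    (ha : ∀ b ∈ 𝒜 1, b * a ∈ Z.ideal.toIdeal) : a ∈ Z.ideal.toIdeal := by
  obtain ⟨n, hn⟩ := Ideal.exists_pow_le_of_le_radical_of_fg h.irrelevant_le_radical
    (IsNoetherian.noetherian _)
  have hspan : ∀ x ∈ Ideal.span (𝒜 1 : Set R), x * a ∈ Z.ideal.toIdeal := by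
    intro x hx
    have : Ideal.span (𝒜 1 : Set R) ≤ Z.ideal.toIdeal.colon {a} :=
      Ideal.span_le.2 fun b hb => Submodule.mem_colon_singleton.2 (ha b hb)
    exact Submodule.mem_colon_singleton.1 (this hx)
  have key : ∀ n : ℕ, ∀ a : R, (∀ x ∈ (HomogeneousIdeal.irrelevant 𝒜).toIdeal ^ n,
      x * a ∈ Z.ideal.toIdeal) → a ∈ Z.ideal.toIdeal := by
    intro n
    induction n with
    | zero => intro a h; simpa using h 1 (by simp)
    | succ n ih =>
      intro a h
      refine ih a fun x hx => Z.saturated _ fun b hb => ?_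
      have := h (b * x) (by rw [pow_succ']; exact Ideal.mul_mem_mul hb hx)
      rwa [mul_assoc] at this
  exact key n a fun x hx => hspan x (hn hx)

theorem exists_nonzerodivisor [IsNoetherianRing R] (h : IsGeneratedInHighDegree 𝒜) :
    ∃ b ∈ 𝒜 1, ∀ a, b * a ∈ Z.ideal.toIdeal → a ∈ Z.ideal.toIdeal :=
  exists_mem_forall_mul_mem Z.ideal.toIdeal (𝒜 1) fun _ ha => Z.mem_of_forall_mul_mem h ha

variable {Z} in
-- If `g` vanishes on `Z`, so does every product `g * h`, and `f` kills these; hence `g` is in the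
-- kernel of the catalecticant.
theorem IsApolar.eq_zero_of_mem {f : Form 𝒜} (hZ : Z.IsApolar f)
    (hf : Function.Injective (catalecticant f)) (g : 𝒜 1) (hg : (g : R) ∈ Z.ideal.toIdeal) :
    g = 0 := by
  refine hf (LinearMap.ext fun h => ?_)
  rw [map_zero, LinearMap.zero_apply, catalecticant_apply]
  exact hZ _ (Ideal.mul_mem_right _ Z.ideal.toIdeal hg)

/-- If `Z` imposes independent conditions on `T_B`, then `b`, a section that vanishes nowhere
on `Z`, identifies all sections on `Z` with those of `B`. -/
theorem exists_sub_pow_mul_mem [∀ k, Module.Finite ℂ (𝒜 k)]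
    (hs : Module.finrank ℂ (𝒜 1) = s) (h1 : ∀ g : 𝒜 1, (g : R) ∈ Z.ideal.toIdeal → g = 0)
    {b : R} (hb : b ∈ 𝒜 1) (hb' : ∀ a, b * a ∈ Z.ideal.toIdeal → a ∈ Z.ideal.toIdeal)
    (k : ℕ) {a : R} (ha : a ∈ 𝒜 (k + 1)) :
    ∃ c ∈ 𝒜 1, a - b ^ k * c ∈ Z.ideal.toIdeal := by
  have hpow : ∀ (n : ℕ) (a : R), b ^ n * a ∈ Z.ideal.toIdeal → a ∈ Z.ideal.toIdeal := by
    intro n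
    induction n with
    | zero => intro a h; simpa using h
    | succ n ih =>
      intro a h
      rw [pow_succ, mul_assoc] at h
      exact hb' _ (ih _ h)
  obtain ⟨k₀, hk₀⟩ := Z.length_eq
  have hmem : ∀ (n i : ℕ) (x : R), x ∈ 𝒜 i → b ^ n * x ∈ 𝒜 (n + i) := by
    intro n i x hx
    have := SetLike.mul_mem_graded (SetLike.pow_mem_graded n hb) hx
    simpa using this
  let W := (Z.ideal.toIdeal.restrictScalars ℂ).comap (𝒜 (k₀ + k + 1)).subtype
  let μ : 𝒜 1 →ₗ[ℂ] 𝒜 (k₀ + k + 1) :=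
    LinearMap.codRestrict _ (LinearMap.mulLeft ℂ (b ^ (k₀ + k)) ∘ₗ (𝒜 1).subtype)
      fun c => hmem _ _ _ c.2
  -- Multiplication by b^(k₀ + k) embeds T_B into the sections on `Z` in a degree where the Hilbert
  -- function already equals `s`, so it is onto by dimension. The extra factor b^k₀, needed only to
  -- reach that degree, is cancelled at the end.
  have hinj : Function.Injective (W.mkQ ∘ₗ μ) := by
    rw [← LinearMap.ker_eq_bot, LinearMap.ker_eq_bot']
    intro c hc
    rw [LinearMap.comp_apply, Submodule.mkQ_apply, Submodule.Quotient.mk_eq_zero] at hc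
    exact h1 c (hpow _ _ hc)
  have hsurj := (LinearMap.injective_iff_surjective_of_finrank_eq_finrank
    (hs.trans (hk₀ (k₀ + k + 1) (by omega)).symm)).1 hinj
  obtain ⟨c, hc⟩ := hsurj (W.mkQ ⟨b ^ k₀ * a, by
    have := hmem k₀ (k + 1) a ha
    rwa [← add_assoc] at this⟩)
  refine ⟨c, c.2, hpow k₀ _ ?_⟩
  have hc' := (Submodule.Quotient.eq W).1 hc.symm
  have : b ^ k₀ * a - b ^ (k₀ + k) * c ∈ Z.ideal.toIdeal := hc'
  convert this using 1
  ring

/-- The criterion for `Z` to be non-reduced at `ℓ`. -/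
theorem isNonreducedAt_iff [IsNoetherianRing R] [∀ k, Module.Finite ℂ (𝒜 k)]
    (hgen : IsGeneratedInHighDegree 𝒜) (hs : Module.finrank ℂ (𝒜 1) = s)
    {f : Form 𝒜} (hf : Function.Bijective (catalecticant f)) (hZ : Z.IsApolar f)
    {l : Point 𝒜} (hl : l ∈ Z.support) {g : 𝒜 1}
    (hg : ∀ h : 𝒜 1, f (mulOne g h) = l.eval h) :
    Z.IsNonreducedAt l ↔ l.eval g = 0 := by
  have h1 := fun g => hZ.eq_zero_of_mem hf.1 g
  obtain ⟨b, hb, hb'⟩ := Z.exists_nonzerodivisor hgen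
  have hmain := fun (k : ℕ) {a : R} => Z.exists_sub_pow_mul_mem hs h1 hb hb' k (a := a)
  have hsupp : ∀ a ∈ Z.ideal.toIdeal, l.eval a = 0 := hl
  have hf0 : ∀ g h : 𝒜 1, (g : R) * h ∈ Z.ideal.toIdeal → f (mulOne g h) = 0 :=
    fun g h hgh => hZ _ hgh
  have hpow : ∀ (n : ℕ) (a : R), b ^ n * a ∈ Z.ideal.toIdeal → a ∈ Z.ideal.toIdeal := by
    intro n
    induction n with
    | zero => intro a h; simpa using h
    | succ n ih =>
      intro a h
      rw [pow_succ, mul_assoc] at h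
      exact hb' _ (ih _ h)
  -- If `b` vanished at `l`, then e² = bc on `Z` would force every section `e` of `B` to vanish at
  -- `l`.
  have hlb : l.eval b ≠ 0 := by
    intro h0
    obtain ⟨e, he, hle⟩ := l.exists_ne_zero
    obtain ⟨c, -, hc⟩ := hmain 1 (SetLike.mul_mem_graded he he)
    have := hsupp _ hc
    rw [map_sub, map_mul, map_mul, pow_one, h0, zero_mul, sub_zero, mul_self_eq_zero] at this
    exact hle this
  -- The maximal ideal of `l` kills `g`. Write gh = bn on `Z`, and hm = bm' for a test section m;
  -- then m'(l) = 0. Cancelling b gives nm = gm' on `Z`, so f(nm) = f(gm') = m'(l) = 0 for all m,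
  -- and n = 0.
  have hann1 : ∀ h ∈ 𝒜 1, l.eval h = 0 → (g : R) * h ∈ Z.ideal.toIdeal := by
    intro h hh hlh
    obtain ⟨n, hn, hgn⟩ := hmain 1 (SetLike.mul_mem_graded g.2 hh)
    rw [pow_one] at hgn
    have hn0 : (⟨n, hn⟩ : 𝒜 1) = 0 := by
      refine hf.1 (LinearMap.ext fun m => ?_)
      rw [map_zero, LinearMap.zero_apply, catalecticant_apply]
      obtain ⟨m', hm', hhm⟩ := hmain 1 (SetLike.mul_mem_graded hh m.2)
      rw [pow_one] at hhm
      have hlm' : l.eval m' = 0 := by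
        have := hsupp _ hhm
        rw [map_sub, map_mul, map_mul, hlh, zero_mul, zero_sub, neg_eq_zero, mul_eq_zero,
          or_iff_right hlb] at this
        exact this
      have hnm : n * (m : R) - g * m' ∈ Z.ideal.toIdeal := by
        refine hb' _ ?_
        have e : b * (n * m - g * m') = g * (h * m - b * m') - (g * h - b * n) * m := by ring
        rw [e]
        exact sub_mem (Ideal.mul_mem_left _ _ hhm) (Ideal.mul_mem_right _ _ hgn)
      have h2 := hZ (mulOne ⟨n, hn⟩ m - mulOne g ⟨m', hm'⟩) hnm
      rw [map_sub, hg, hlm', sub_zero] at h2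
      exact h2
    have : n = 0 := congrArg Subtype.val hn0
    rwa [this, mul_zero, sub_zero] at hgn
  have hann : ∀ k, ∀ h ∈ 𝒜 (k + 1), l.eval h = 0 → (g : R) * h ∈ Z.ideal.toIdeal := by
    intro k h hh hlh
    obtain ⟨c, hc, hhc⟩ := hmain k hh
    have hlc : l.eval c = 0 := by
      have := hsupp _ hhc
      rw [map_sub, map_mul, hlh, zero_sub, neg_eq_zero, mul_eq_zero, map_pow,
        or_iff_right (pow_ne_zero _ hlb)] at this
      exact this
    have e : (g : R) * h = g * (h - b ^ k * c) + b ^ k * (g * c) := by ring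
    rw [e]
    exact add_mem (Ideal.mul_mem_left _ _ hhc) (Ideal.mul_mem_left _ _ (hann1 c hc hlc))
  constructor
  · rintro ⟨-, k, a, ha, hna, m, j, h, hh, hlh, hham⟩
    by_contra hlg
    have hla : l.eval a = 0 := by
      have := hsupp _ hham
      rw [map_mul, map_pow, mul_eq_zero, or_iff_right hlh] at this
      exact of_not_not fun h => pow_ne_zero m h this
    -- The germ of `a` is killed by `g`, a unit at `l`. The factor `b` is there because `a` may have
    -- degree 0, while `hann` needs positive degree.
    refine hna ⟨1 + 1, g * b, SetLike.mul_mem_graded g.2 hb, ?_, ?_⟩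
    · rw [map_mul]
      exact mul_ne_zero hlg hlb
    · have := hann k (a * b) (SetLike.mul_mem_graded ha hb) (by rw [map_mul, hla, zero_mul])
      rw [mul_assoc, mul_comm b]
      exact this
  · intro hlg
    -- The nilpotent germ is that of `g`: its square is zero by `hann1`. If its germ were zero, some
    -- section c of `B` with c(l) ≠ 0 would have gc = 0 on `Z`, against f(gc) = c(l).
    refine ⟨hl, 1, g, g.2, ?_, 2, 0, 1, SetLike.one_mem_graded 𝒜, ?_, ?_⟩
    · rintro ⟨j, h, hh, hlh, hhg⟩
      obtain ⟨c, hc, hhc⟩ := hmain j (SetLike.mul_mem_graded hh hb)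
      have hlc : l.eval c ≠ 0 := by
        intro h0
        have := hsupp _ hhc
        rw [map_sub, map_mul, map_mul, h0, mul_zero, sub_zero, mul_eq_zero] at this
        exact this.elim hlh hlb
      have hgc : (g : R) * c ∈ Z.ideal.toIdeal := by
        refine hpow j _ ?_
        have e : b ^ j * ((g : R) * c) = b * (h * g) - g * (h * b - b ^ j * c) := by ring
        rw [e]
        exact sub_mem (Ideal.mul_mem_left _ _ hhg) (Ideal.mul_mem_left _ _ hhc)
      have := hf0 g ⟨c, hc⟩ hgc
      rw [hg] at this
      exact hlc this
    · rw [map_one]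
      exact one_ne_zero
    · have := hann1 g g.2 hlg
      rw [one_mul, pow_two]
      exact this

/-- A smooth subscheme is reduced at every point. -/
theorem IsSmooth.not_isNonreducedAt {Z : ZeroDimSubscheme 𝒜 s} (hZ : Z.IsSmooth) (l : Point 𝒜) :
    ¬ Z.IsNonreducedAt l := by
  rintro ⟨hl, k, a, ha, hna, m, j, h, hh, hlh, hham⟩
  refine hna ⟨j, h, hh, hlh, hZ ⟨m + 1, ?_⟩⟩
  have : (h * a) ^ (m + 1) = h ^ m * a * (h * a ^ m) := by ring
  rw [this]
  exact Ideal.mul_mem_left _ _ hham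

/-- A homomorphism `ψ` to an algebra of dimension `s` for which the sections of `B` map onto the
algebra defines a zero-dimensional subscheme of length `s`. -/
noncomputable def ofAlgHom {A : Type*} [CommRing A] [Algebra ℂ A] (ψ : R →ₐ[ℂ] A)
    (hψ : ∀ y : A, ∃ x ∈ 𝒜 1, ψ x = y) : ZeroDimSubscheme 𝒜 (Module.finrank ℂ A) where
  ideal := (RingHom.ker ψ).homogeneousCore 𝒜
  saturated := by
    intro a ha
    obtain ⟨b, hb, hb1⟩ := hψ 1
    have hba : b * a ∈ (RingHom.ker ψ).homogeneousCore 𝒜 :=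
      ha b (HomogeneousIdeal.mem_irrelevant_of_mem 𝒜 one_pos hb)
    rw [← HomogeneousIdeal.mem_iff,
      ((RingHom.ker ψ).homogeneousCore 𝒜).isHomogeneous.mem_iff]
    intro i
    refine Ideal.mem_homogeneousCore_of_homogeneous_of_mem ⟨i, SetLike.coe_mem _⟩ ?_
    have h1 := ((RingHom.ker ψ).homogeneousCore 𝒜).isHomogeneous (1 + i) hba
    rw [DirectSum.coe_decompose_mul_add_of_left_mem 𝒜 hb] at h1
    have h2 := Ideal.toIdeal_homogeneousCore_le 𝒜 _ h1
    rw [RingHom.mem_ker, map_mul] at h2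
    rw [RingHom.mem_ker]
    erw [hb1, one_mul] at h2
    exact h2
  length_eq := by
    obtain ⟨b, hb, hb1⟩ := hψ 1
    refine ⟨1, fun k hk => ?_⟩
    obtain ⟨j, rfl⟩ := Nat.exists_eq_add_of_le' hk
    have hker : (((RingHom.ker ψ).homogeneousCore 𝒜).toIdeal.restrictScalars ℂ).comap
        (𝒜 (j + 1)).subtype = LinearMap.ker (ψ.toLinearMap ∘ₗ (𝒜 (j + 1)).subtype) := by
      ext a
      constructor
      · exact fun ha => Ideal.toIdeal_homogeneousCore_le 𝒜 _ ha
      · exact fun ha => Ideal.mem_homogeneousCore_of_homogeneous_of_mem ⟨_, a.2⟩ ha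
    rw [hker]
    refine LinearEquiv.finrank_eq (LinearMap.quotKerEquivOfSurjective _ fun y => ?_)
    obtain ⟨x, hx, rfl⟩ := hψ y
    refine ⟨⟨b ^ j * x, ?_⟩, ?_⟩
    · have := SetLike.mul_mem_graded (SetLike.pow_mem_graded j hb) hx
      simpa using this
    · change ψ (b ^ j * x) = ψ x
      rw [map_mul, map_pow, hb1, one_pow, one_mul]

theorem mem_ofAlgHom_ideal {A : Type*} [CommRing A] [Algebra ℂ A] (ψ : R →ₐ[ℂ] A)
    (hψ : ∀ y : A, ∃ x ∈ 𝒜 1, ψ x = y) {a : R} (ha : a ∈ (ofAlgHom ψ hψ).ideal) : ψ a = 0 :=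
  Ideal.toIdeal_homogeneousCore_le 𝒜 (RingHom.ker ψ) ha

end ZeroDimSubscheme

end Graded

end Apolarity

/-! ### General forms, the bound on the rank, and the zeros of the antipolar. -/

namespace Apolarity

section General

variable {R : Type*} [CommRing R] [Algebra ℂ R] {𝒜 : ℕ → Submodule ℂ R}

theorem ForGeneralForm.mono {p q : Form 𝒜 → Prop} (hp : ForGeneralForm 𝒜 p)
    (h : ∀ f, p f → q f) : ForGeneralForm 𝒜 q := by
  obtain ⟨Q, hQ, hQp⟩ := hp
  exact ⟨Q, hQ, fun f hf => h f (hQp f hf)⟩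

open Polynomial in
/-- The restriction of a polynomial function to a line. -/
theorem exists_polynomial_eval_line (Q : MvPolynomial (𝒜 2) ℂ) (f₀ f₁ : Form 𝒜) :
    ∃ P : ℂ[X], ∀ t : ℂ, P.eval t =
      MvPolynomial.eval (fun g => (f₀ + t • (f₁ - f₀)) g) Q := by
  refine ⟨MvPolynomial.aeval (fun g : 𝒜 2 => C (f₀ g) + X * C (f₁ g - f₀ g)) Q, fun t => ?_⟩
  rw [← Polynomial.coe_evalRingHom, MvPolynomial.map_aeval]
  have h : (Polynomial.evalRingHom t).comp (algebraMap ℂ ℂ[X]) = RingHom.id ℂ := by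
    ext x
    simp
  rw [h, MvPolynomial.eval]
  refine congrArg (fun v => MvPolynomial.eval₂Hom (RingHom.id ℂ) v Q) (funext fun g => ?_)
  simp

/-- Nonempty open sets meet: on the line joining the two witnesses both polynomials restrict to
nonzero polynomials in one variable, and their product is nonzero somewhere on it. -/
theorem ForGeneralForm.and {p q : Form 𝒜 → Prop} (hp : ForGeneralForm 𝒜 p)
    (hq : ForGeneralForm 𝒜 q) : ForGeneralForm 𝒜 fun f => p f ∧ q f := by
  obtain ⟨Q₁, ⟨f₁, hf₁⟩, hQ₁⟩ := hp
  obtain ⟨Q₂, ⟨f₂, hf₂⟩, hQ₂⟩ := hq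
  refine ⟨Q₁ * Q₂, ?_, fun f hf => ?_⟩
  · obtain ⟨P₁, hP₁⟩ := exists_polynomial_eval_line Q₁ f₁ f₂
    obtain ⟨P₂, hP₂⟩ := exists_polynomial_eval_line Q₂ f₁ f₂
    have h1 : P₁ ≠ 0 := by
      rintro rfl
      apply hf₁
      simpa using (hP₁ 0).symm
    have h2 : P₂ ≠ 0 := by
      rintro rfl
      apply hf₂
      simpa using (hP₂ 1).symm
    obtain ⟨t, ht⟩ := Polynomial.exists_eval_ne_zero_of_natDegree_lt_card (P₁ * P₂)
      (mul_ne_zero h1 h2) (Cardinal.natCast_lt_aleph0.trans_le (Cardinal.aleph0_le_mk ℂ))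
    refine ⟨f₁ + t • (f₂ - f₁), ?_⟩
    rwa [map_mul, ← hP₁, ← hP₂, ← Polynomial.eval_mul]
  · rw [map_mul] at hf
    exact ⟨hQ₁ f (left_ne_zero_of_mul hf), hQ₂ f (right_ne_zero_of_mul hf)⟩

/-- The nonvanishing of a determinant whose entries are linear functions of the form is a general
property as soon as it holds for one form. -/
theorem forGeneralForm_det_ne_zero {ι : Type*} [Fintype ι] [DecidableEq ι] (v : ι → ι → 𝒜 2)
    (h : ∃ f : Form 𝒜, (Matrix.of fun i j => f (v i j)).det ≠ 0) :
    ForGeneralForm 𝒜 fun f => (Matrix.of fun i j => f (v i j)).det ≠ 0 := by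
  have key : ∀ f : Form 𝒜, MvPolynomial.eval (fun g => f g)
      (Matrix.of fun i j => (MvPolynomial.X (v i j) : MvPolynomial (𝒜 2) ℂ)).det =
      (Matrix.of fun i j => f (v i j)).det := by
    intro f
    rw [RingHom.map_det]
    congr 1
    ext i j
    simp
  refine ⟨(Matrix.of fun i j => (MvPolynomial.X (v i j) : MvPolynomial (𝒜 2) ℂ)).det, ?_, ?_⟩
  · obtain ⟨f, hf⟩ := h
    exact ⟨f, by rwa [key]⟩
  · intro f hf
    rwa [key] at hf

variable [GradedAlgebra 𝒜]

/-- The `X`-rank of a form with nondegenerate catalecticant is at least `dim T_B`. -/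
theorem finrank_le_of_mem_span {f : Form 𝒜} (hf : Function.Bijective (catalecticant f)) {s : ℕ}
    (p : Fin s → Point 𝒜) (hp : f ∈ Submodule.span ℂ (Set.range fun i => (p i).square)) :
    Module.finrank ℂ (𝒜 1) ≤ s := by
  obtain ⟨c, rfl⟩ := (Submodule.mem_span_range_iff_exists_fun ℂ).1 hp
  have hinj : Function.Injective
      (LinearMap.pi fun i => (p i).eval.toLinearMap ∘ₗ (𝒜 1).subtype) := by
    rw [← LinearMap.ker_eq_bot, LinearMap.ker_eq_bot']
    intro g hg
    refine hf.1 (LinearMap.ext fun h => ?_)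
    rw [map_zero, LinearMap.zero_apply, catalecticant_apply, LinearMap.sum_apply]
    refine Finset.sum_eq_zero fun i _ => ?_
    have : (p i).eval g = 0 := congrFun hg i
    rw [LinearMap.smul_apply, Point.square_mulOne, this, zero_mul, smul_zero]
  simpa using LinearMap.finrank_le_finrank_of_injective hinj

theorem xRank_eq_finrank {f : Form 𝒜} (hf : Function.Bijective (catalecticant f))
    (p : Fin (Module.finrank ℂ (𝒜 1)) → Point 𝒜)
    (hp : f ∈ Submodule.span ℂ (Set.range fun i => (p i).square)) :
    xRank f = Module.finrank ℂ (𝒜 1) := by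
  refine le_antisymm (Nat.sInf_le ⟨p, hp⟩) (le_csInf ⟨_, p, hp⟩ ?_)
  rintro s ⟨p', hp'⟩
  exact finrank_le_of_mem_span hf p' hp'

variable [Module.Finite ℂ (𝒜 1)]

/-- If the points of `X` separate the sections of `B`, then some catalecticant is an isomorphism. -/
theorem exists_catalecticant_bijective
    (hsep : ∀ g : 𝒜 1, (∀ l : Point 𝒜, l.eval g = 0) → g = 0) :
    ∃ f : Form 𝒜, Function.Bijective (catalecticant f) := by
  let ev : Point 𝒜 → Module.Dual ℂ (𝒜 1) := fun l => l.eval.toLinearMap ∘ₗ (𝒜 1).subtype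
  have hspan : Submodule.span ℂ (Set.range ev) = ⊤ := by
    refine Submodule.span_eq_top_of_ne_zero fun g hg => ?_
    by_contra! h
    exact hg (hsep g fun l => h _ ⟨l, rfl⟩)
  obtain ⟨b, hb, hbspan, hbind⟩ := exists_linearIndependent ℂ (Set.range ev)
  choose p hp using fun x : b => hb x.2
  have : Finite b := LinearIndependent.finite hbind
  have := Fintype.ofFinite b
  -- The evaluations at these points form a basis of the dual of T_B, so the catalecticant is a sum
  -- of squares of a full set of independent linear forms.
  refine ⟨∑ x : b, (p x).square, ?_⟩
  have happ : ∀ g h : 𝒜 1, catalecticant (∑ x : b, (p x).square) g h =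
      ∑ x : b, (p x).eval g * (p x).eval h := by
    intro g h
    rw [catalecticant_apply, LinearMap.sum_apply]
    exact Finset.sum_congr rfl fun x _ => Point.square_mulOne _ _ _
  have hinj : Function.Injective (catalecticant (∑ x : b, (p x).square)) := by
    rw [← LinearMap.ker_eq_bot, LinearMap.ker_eq_bot']
    intro g hg
    have h0 : ∀ x : b, (p x).eval g = 0 := by
      refine Fintype.linearIndependent_iff.1 hbind (fun x => (p x).eval g) ?_
      ext h
      have := happ g h
      rw [hg, LinearMap.zero_apply] at this
      rw [LinearMap.zero_apply, this, LinearMap.sum_apply]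
      refine Finset.sum_congr rfl fun x _ => ?_
      rw [LinearMap.smul_apply, smul_eq_mul]
      congr 1
      exact (LinearMap.congr_fun (hp x) h).symm
    refine hsep g fun l => ?_
    have hl : ev l ∈ Submodule.span ℂ b := by
      rw [hbspan]
      exact Submodule.subset_span ⟨l, rfl⟩
    have hle : Submodule.span ℂ b ≤ LinearMap.ker (Module.Dual.eval ℂ (𝒜 1) g) := by
      rw [Submodule.span_le]
      intro x hx
      exact (LinearMap.congr_fun (hp ⟨x, hx⟩) g).symm.trans (h0 ⟨x, hx⟩)
    exact hle hl
  exact ⟨hinj, (LinearMap.injective_iff_surjective_of_finrank_eq_finrank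
    Subspace.dual_finrank_eq.symm).1 hinj⟩

theorem forGeneralForm_catalecticant_bijective
    (hsep : ∀ g : 𝒜 1, (∀ l : Point 𝒜, l.eval g = 0) → g = 0) :
    ForGeneralForm 𝒜 fun f => Function.Bijective (catalecticant f) := by
  have hdet : ∀ f : Form 𝒜, (Matrix.of fun i j => f (mulOne (Module.finBasis ℂ (𝒜 1) j)
      (Module.finBasis ℂ (𝒜 1) i))).det = catalecticantDet f := by
    intro f
    rw [← catalecticantMatrix_det]
    congr 1
    ext i j
    rw [catalecticantMatrix_apply, Matrix.of_apply]
  have := forGeneralForm_det_ne_zero (𝒜 := 𝒜)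
    (fun i j => mulOne (Module.finBasis ℂ (𝒜 1) j) (Module.finBasis ℂ (𝒜 1) i)) (by
      obtain ⟨f, hf⟩ := exists_catalecticant_bijective hsep
      exact ⟨f, by rw [hdet]; exact (catalecticantDet_ne_zero_iff f).2 hf⟩)
  refine this.mono fun f hf => ?_
  rw [hdet] at hf
  exact (catalecticantDet_ne_zero_iff f).1 hf

/-- The antipolar is a section of `2B`, up to a nonzero factor. -/
theorem antipolarLocus_nonempty (hzero : ∀ q ∈ 𝒜 2, ∃ l : Point 𝒜, l.eval q = 0) {f : Form 𝒜}
    (hf : Function.Bijective (catalecticant f)) : (antipolarLocus f).Nonempty := by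
  let b := Module.finBasis ℂ (𝒜 1)
  let φ := LinearEquiv.ofBijective (catalecticant f) hf
  -- This section of 2B is Ω(f) / det φ_f: expanding evaluation at `l` in the dual basis gives g = Σ
  -- bᵢ(l) φ⁻¹(bᵢ*), which is then evaluated at `l`.
  obtain ⟨l, hl⟩ := hzero (∑ i, (b i : R) * (φ.symm (b.dualBasis i) : R))
    (Submodule.sum_mem _ fun i _ => SetLike.mul_mem_graded (b i).2 (φ.symm (b.dualBasis i)).2)
  obtain ⟨g, hg⟩ := exists_mulOne_eq_eval hf l
  refine ⟨l, (antipolar_eq_zero_iff hf l g hg).2 ?_⟩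
  have hφ : φ g = ∑ i, l.eval (b i) • b.dualBasis i := by
    refine b.ext fun j => ?_
    have : φ g (b j) = l.eval (b j) := hg (b j)
    rw [this, LinearMap.sum_apply, Finset.sum_eq_single j]
    · simp
    · intro i _ hij
      simp [hij.symm]
    · simp
  have hg' : g = ∑ i, l.eval (b i) • φ.symm (b.dualBasis i) := by
    rw [← φ.symm_apply_apply g, hφ, map_sum]
    simp only [map_smul]
  have h : l.eval g = ∑ i, l.eval (b i) * l.eval (φ.symm (b.dualBasis i)) := by
    conv_lhs => rw [hg']
    simp
  rw [h, ← hl, map_sum]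
  simp only [map_mul]

end General

/-! ### Consequences for the Ranestad-Schreyer and forbidden loci. -/

section Main

variable {R : Type*} [CommRing R] [Algebra ℂ R] [IsNoetherianRing R] {𝒜 : ℕ → Submodule ℂ R}
  [GradedAlgebra 𝒜] [∀ k, Module.Finite ℂ (𝒜 k)]

theorem isNonreducedAt_iff_antipolar_eq_zero (hgen : IsGeneratedInHighDegree 𝒜) {f : Form 𝒜}
    (hf : Function.Bijective (catalecticant f)) {s : ℕ} (hs : Module.finrank ℂ (𝒜 1) = s)
    (Z : ZeroDimSubscheme 𝒜 s) (hZ : Z.IsApolar f) {l : Point 𝒜} (hl : l ∈ Z.support) :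
    Z.IsNonreducedAt l ↔ antipolar f l = 0 := by
  obtain ⟨g, hg⟩ := exists_mulOne_eq_eval hf l
  rw [Z.isNonreducedAt_iff hgen hs hf hZ hl hg, antipolar_eq_zero_iff hf l g hg]

theorem ranestadSchreyerLocus_eq (hgen : IsGeneratedInHighDegree 𝒜) {f : Form 𝒜}
    (hf : Function.Bijective (catalecticant f)) (hr : xRank f = Module.finrank ℂ (𝒜 1)) :
    ranestadSchreyerLocus f = antipolarLocus f ∩
      {l | ∃ Z : ZeroDimSubscheme 𝒜 (Module.finrank ℂ (𝒜 1)), Z.IsApolar f ∧ l ∈ Z.support} := by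
  rw [ranestadSchreyerLocus, hr]
  ext l
  constructor
  · rintro ⟨Z, hZ, hl⟩
    exact ⟨(isNonreducedAt_iff_antipolar_eq_zero hgen hf rfl Z hZ hl.1).1 hl, Z, hZ, hl.1⟩
  · rintro ⟨h0, Z, hZ, hl⟩
    exact ⟨Z, hZ, (isNonreducedAt_iff_antipolar_eq_zero hgen hf rfl Z hZ hl).2 h0⟩

theorem antipolarLocus_subset_forbiddenLocus (hgen : IsGeneratedInHighDegree 𝒜) {f : Form 𝒜}
    (hf : Function.Bijective (catalecticant f)) (hr : xRank f = Module.finrank ℂ (𝒜 1)) :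
    antipolarLocus f ⊆ forbiddenLocus f := by
  rw [forbiddenLocus, hr]
  rintro l h0 ⟨Z, hZs, hZ, hl⟩
  exact hZs.not_isNonreducedAt l ((isNonreducedAt_iff_antipolar_eq_zero hgen hf rfl Z hZ hl).2 h0)

end Main

end Apolarity

/-! ### The cone over a polytope and the finiteness of its section ring. -/

namespace LatticePolytope

variable {n : ℕ} (P : LatticePolytope n)

theorem points_nonempty : P.points.Nonempty := by
  have h : P.body.Nonempty := P.interior_nonempty.mono interior_subset
  have h2 := convexHull_nonempty_iff.1 h
  simpa using h2

theorem mem_cone_iff {c : ℕ × (Fin n → ℤ)} :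
    c ∈ P.cone ↔ (fun i => (c.2 i : ℝ)) ∈ (c.1 : ℝ) • P.body := Iff.rfl

theorem mem_body_iff {x : Fin n → ℝ} : x ∈ P.body ↔ ∃ w : (Fin n → ℤ) → ℝ,
    (∀ v ∈ P.points, 0 ≤ w v) ∧ ∑ v ∈ P.points, w v = 1 ∧
      ∀ i, ∑ v ∈ P.points, w v * v i = x i := by
  classical
  have hinj : Function.Injective (fun (v : Fin n → ℤ) (i : Fin n) => (v i : ℝ)) := by
    intro v v' h
    ext i
    exact Int.cast_injective (congrFun h i)
  rw [body, ← Finset.coe_image, Finset.mem_convexHull']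
  constructor
  · rintro ⟨w, hw0, hw1, hwx⟩
    refine ⟨fun v => w fun i => v i, fun v hv => hw0 _ (Finset.mem_image_of_mem _ hv), ?_, ?_⟩
    · rw [← hw1, Finset.sum_image hinj.injOn]
    · intro i
      rw [← hwx, Finset.sum_image hinj.injOn, Finset.sum_apply]
      rfl
  · rintro ⟨w, hw0, hw1, hwx⟩
    have hw : ∀ v, w (Function.invFun (fun (v : Fin n → ℤ) (i : Fin n) => (v i : ℝ))
        (fun i => (v i : ℝ))) = w v := fun v => by rw [Function.leftInverse_invFun hinj v]
    refine ⟨fun y => w (Function.invFun (fun (v : Fin n → ℤ) (i : Fin n) => (v i : ℝ)) y),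
      ?_, ?_, ?_⟩
    · intro y hy
      obtain ⟨v, hv, rfl⟩ := Finset.mem_image.1 hy
      exact (hw0 v hv).trans_eq (hw v).symm
    · rw [← hw1, Finset.sum_image hinj.injOn]
      exact Finset.sum_congr rfl fun v _ => hw v
    · ext i
      rw [← hwx, Finset.sum_image hinj.injOn, Finset.sum_apply]
      refine Finset.sum_congr rfl fun v _ => ?_
      exact congrArg (· * (v i : ℝ)) (hw v)

/-- The cone over `P` consists of the nonnegative combinations of the given points. -/
theorem mem_cone_iff_exists {k : ℕ} {m : Fin n → ℤ} : (k, m) ∈ P.cone ↔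
    ∃ w : (Fin n → ℤ) → ℝ, (∀ v ∈ P.points, 0 ≤ w v) ∧ ∑ v ∈ P.points, w v = k ∧
      ∀ i, ∑ v ∈ P.points, w v * v i = m i := by
  rw [mem_cone_iff, Set.mem_smul_set]
  constructor
  · rintro ⟨x, hx, hxm⟩
    obtain ⟨w, hw0, hw1, hwx⟩ := P.mem_body_iff.1 hx
    refine ⟨fun v => k * w v, fun v hv => mul_nonneg (Nat.cast_nonneg _) (hw0 v hv), ?_, ?_⟩
    · rw [← Finset.mul_sum, hw1, mul_one]
    · intro i
      have := congrFun hxm i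
      simp only [mul_assoc]
      rw [← Finset.mul_sum, hwx]
      exact this
  · rintro ⟨w, hw0, hw1, hwx⟩
    rcases Nat.eq_zero_or_pos k with rfl | hk
    · obtain ⟨x, hx⟩ := P.interior_nonempty.mono interior_subset
      refine ⟨x, hx, ?_⟩
      have hw := (Finset.sum_eq_zero_iff_of_nonneg hw0).1 (by simpa using hw1)
      ext i
      rw [Nat.cast_zero, zero_smul, Pi.zero_apply, ← hwx i]
      exact (Finset.sum_eq_zero fun v hv => by rw [hw v hv, zero_mul]).symm
    · have hk0 : (k : ℝ) ≠ 0 := by exact_mod_cast hk.ne'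
      refine ⟨fun i => (k : ℝ)⁻¹ * m i, P.mem_body_iff.2 ⟨fun v => (k : ℝ)⁻¹ * w v,
        fun v hv => mul_nonneg (by positivity) (hw0 v hv), ?_, ?_⟩, ?_⟩
      · rw [← Finset.mul_sum, hw1, inv_mul_cancel₀ hk0]
      · intro i
        simp only [mul_assoc]
        rw [← Finset.mul_sum, hwx]
      · ext i
        rw [Pi.smul_apply, smul_eq_mul, mul_inv_cancel_left₀ hk0]

theorem one_mem_cone {v : Fin n → ℤ} (hv : v ∈ P.points) : (1, v) ∈ P.cone := by
  rw [mem_cone_iff, Nat.cast_one, one_smul]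
  exact subset_convexHull ℝ _ ⟨v, hv, rfl⟩

/-- Elements of the cone of high degree are divisible by a given point. -/
theorem exists_eq_add_of_card_le (c : P.cone) (hc : P.points.card ≤ P.degree c) :
    ∃ (v : Fin n → ℤ) (hv : v ∈ P.points) (c' : P.cone), c = c' + ⟨(1, v), P.one_mem_cone hv⟩ := by
  classical
  obtain ⟨⟨k, m⟩, hkm⟩ := c
  replace hc : P.points.card ≤ k := hc
  obtain ⟨w, hw0, hw1, hwm⟩ := P.mem_cone_iff_exists.1 hkm
  -- Pigeonhole: the weights sum to k, which is at least the number of points. A point of weight at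
  -- least 1 can be subtracted inside the cone.
  obtain ⟨v, hv, hwv⟩ : ∃ v ∈ P.points, 1 ≤ w v := by
    by_contra! h
    have := Finset.sum_lt_sum_of_nonempty P.points_nonempty h
    rw [hw1, Finset.sum_const, nsmul_eq_mul, mul_one] at this
    exact absurd hc (by exact_mod_cast not_le.2 this)
  have hk : 1 ≤ k := (Finset.card_pos.2 P.points_nonempty).trans_le hc
  refine ⟨v, hv, ⟨(k - 1, m - v), P.mem_cone_iff_exists.2
    ⟨fun u => w u - if u = v then 1 else 0, ?_, ?_, ?_⟩⟩, ?_⟩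
  · intro u hu
    dsimp only
    split_ifs with h
    · rw [h]
      linarith
    · rw [sub_zero]
      exact hw0 u hu
  · rw [Finset.sum_sub_distrib, hw1, Finset.sum_ite_eq' , if_pos hv, Nat.cast_sub hk, Nat.cast_one]
  · intro i
    simp only [sub_mul, ite_mul, one_mul, zero_mul]
    rw [Finset.sum_sub_distrib, hwm, Finset.sum_ite_eq', if_pos hv]
    simp
  · refine Subtype.ext (Prod.ext ?_ ?_)
    · show k = k - 1 + 1
      omega
    · show m = m - v + v
      simp

theorem isGeneratedInHighDegree : IsGeneratedInHighDegree P.sections := by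
  refine ⟨P.points.card, fun k hk a ha => ?_⟩
  rw [← AddMonoidAlgebra.sum_coeff_single a]
  refine Ideal.sum_mem _ fun c hc => ?_
  have hdeg : P.degree c = k := ha c hc
  obtain ⟨v, hv, c', h⟩ := P.exists_eq_add_of_card_le c (hdeg.symm ▸ hk)
  have hs : (AddMonoidAlgebra.single c (a.coeff c) : P.SectionRing) =
      AddMonoidAlgebra.single c' (a.coeff c) *
        AddMonoidAlgebra.single ⟨(1, v), P.one_mem_cone hv⟩ 1 := by
    rw [AddMonoidAlgebra.single_mul_single, mul_one, ← h]
  rw [hs]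
  exact Ideal.mul_mem_left _ _ (Ideal.subset_span
    (AddMonoidAlgebra.single_mem_gradeBy P.degree ⟨(1, v), P.one_mem_cone hv⟩ (1 : ℂ)))

/-- Gordan's lemma for the cone over `P`. -/
instance : AddMonoid.FG P.cone := by
  have hfin : {c : P.cone | P.degree c ≤ P.points.card}.Finite := by
    refine ((Set.finite_Iic P.points.card).biUnion fun k _ => P.finite_degree k).subset ?_
    intro c hc
    exact Set.mem_biUnion (Set.mem_Iic.2 hc) rfl
  refine ⟨⟨hfin.toFinset, ?_⟩⟩
  rw [Set.Finite.coe_toFinset, eq_top_iff]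
  have key : ∀ k, ∀ c : P.cone, P.degree c = k →
      c ∈ AddSubmonoid.closure {c : P.cone | P.degree c ≤ P.points.card} := by
    intro k
    induction k using Nat.strong_induction_on with
    | _ k ih =>
      intro c hc
      rcases le_total (P.degree c) P.points.card with h | h
      · exact AddSubmonoid.subset_closure h
      · obtain ⟨v, hv, c', rfl⟩ := P.exists_eq_add_of_card_le c h
        have h1 : P.degree (⟨(1, v), P.one_mem_cone hv⟩ : P.cone) = 1 := rfl
        rw [map_add, h1] at hc
        refine add_mem (ih (P.degree c') (by omega) c' rfl) (AddSubmonoid.subset_closure ?_)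
        exact Finset.card_pos.2 P.points_nonempty
  exact fun c _ => key _ c rfl

instance : IsNoetherianRing P.SectionRing :=
  Algebra.FiniteType.isNoetherianRing ℂ P.SectionRing

/-- The point of `X_P` defined by a semigroup homomorphism from the cone over `P` to `(ℂ, *)`. -/
noncomputable def pointOfHom (χ : Multiplicative P.cone →* ℂ)
    (h : ∃ c, P.degree c = 1 ∧ χ (Multiplicative.ofAdd c) ≠ 0) : Point P.sections where
  eval := AddMonoidAlgebra.lift ℂ ℂ P.cone χ
  exists_ne_zero := by
    obtain ⟨c, hc, hχ⟩ := h
    refine ⟨AddMonoidAlgebra.single c 1, ?_, ?_⟩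
    · rw [← hc]
      exact AddMonoidAlgebra.single_mem_gradeBy _ _ _
    · rwa [AddMonoidAlgebra.lift_single, one_smul]

theorem pointOfHom_eval (χ : Multiplicative P.cone →* ℂ) (h) (a : P.SectionRing) :
    (P.pointOfHom χ h).eval a = a.coeff.sum fun c r => r * χ (Multiplicative.ofAdd c) :=
  AddMonoidAlgebra.lift_apply _ _

/-! ### Points of a toric variety, and zeros of sections. -/

section Torus

/-- The character of the torus with exponent `m`. -/
def character (m : Fin n → ℤ) : (Fin n → ℂˣ) →* ℂ where
  toFun t := ((∏ i, t i ^ m i : ℂˣ) : ℂ)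
  map_one' := by simp
  map_mul' t t' := by simp [mul_zpow, Finset.prod_mul_distrib]

theorem character_injective : Function.Injective (character (n := n)) := by
  intro m m' h
  ext i
  have h2 := DFunLike.congr_fun h (Pi.mulSingle i (Units.mk0 2 two_ne_zero))
  have key : ∀ m : Fin n → ℤ,
      character m (Pi.mulSingle i (Units.mk0 2 two_ne_zero)) = (((2 : ℝ) ^ m i : ℝ) : ℂ) := by
    intro m
    show ((∏ j, (Pi.mulSingle i (Units.mk0 (2 : ℂ) two_ne_zero) : Fin n → ℂˣ) j ^ m j : ℂˣ) : ℂ) = _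
    rw [Finset.prod_eq_single i]
    · simp
    · intro j _ hj
      rw [Pi.mulSingle_eq_of_ne hj, one_zpow]
    · simp
  rw [key, key, Complex.ofReal_inj] at h2
  exact zpow_right_injective₀ two_pos (by norm_num) h2

/-- The points of the torus in `X_P`. -/
noncomputable def torusPoint (t : Fin n → ℂˣ) : Point P.sections :=
  P.pointOfHom
    { toFun := fun c => character (Multiplicative.toAdd c).1.2 t
      map_one' := by simp [character]
      map_mul' := fun c c' => by simp [character, zpow_add, Finset.prod_mul_distrib] }
    (by
      obtain ⟨v, hv⟩ := P.points_nonempty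
      exact ⟨⟨(1, v), P.one_mem_cone hv⟩, rfl, Units.ne_zero _⟩)

/-- The points of the torus separate the sections. -/
theorem eq_zero_of_forall_torusPoint {k : ℕ} {a : P.SectionRing} (ha : a ∈ P.sections k)
    (h : ∀ t, (P.torusPoint t).eval a = 0) : a = 0 := by
  -- Dedekind's independence of characters; within one degree, different cone elements have
  -- different characters.
  have hind := (linearIndependent_monoidHom (Fin n → ℂˣ) ℂ).comp
    (fun c : a.coeff.support => character (c : P.cone).1.2) (by
      intro c c' hcc
      refine Subtype.ext (Subtype.ext (Prod.ext ?_ (character_injective hcc)))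
      exact (ha c c.2).trans (ha c' c'.2).symm)
  rw [Fintype.linearIndependent_iff] at hind
  have h0 := hind (fun c => a.coeff c) (by
    ext t
    have := h t
    rw [torusPoint, pointOfHom_eval, Finsupp.sum] at this
    rw [Finset.sum_apply, Pi.zero_apply, ← this]
    exact Finset.sum_coe_sort a.coeff.support fun c => a.coeff c * character c.1.2 t)
  refine AddMonoidAlgebra.ext (Finsupp.ext fun c => ?_)
  by_contra hc
  exact hc (h0 ⟨c, Finsupp.mem_support_iff.2 hc⟩)

end Torus

section Zero

/-- The point with coordinates `t ^ e(c)`. -/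
noncomputable def pointOfExponent (e : P.cone →+ ℕ) (he : ∃ c, P.degree c = 1 ∧ e c = 0) (t : ℂ) :
    Point P.sections :=
  P.pointOfHom
    { toFun := fun c => t ^ e (Multiplicative.toAdd c)
      map_one' := by simp
      map_mul' := fun c c' => by simp [pow_add] }
    (by
      obtain ⟨c, hc, hc'⟩ := he
      exact ⟨c, hc, by simp [hc']⟩)

theorem pointOfExponent_eval (e : P.cone →+ ℕ) (he) (t : ℂ) (a : P.SectionRing) :
    (P.pointOfExponent e he t).eval a = a.coeff.sum fun c r => r * t ^ e c :=
  P.pointOfHom_eval _ _ a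

/-- The points with coordinates t ^ e(c) form an affine line in X, and `e'` with parameter 0
supplies its limit at t = ∞. On the line `a` is a polynomial p in t, and its value at the limit is
the coefficient of t^(kD). A nonconstant p, or p = 0, has a root; a nonzero constant p has no t^(kD)
term, as kD > 0. -/
theorem exists_eval_eq_zero_of_exponents (e e' : P.cone →+ ℕ)
    (he : ∃ c, P.degree c = 1 ∧ e c = 0) (he' : ∃ c, P.degree c = 1 ∧ e' c = 0) {D : ℕ}
    (hD : 0 < D) (hee : ∀ c, e c + e' c = P.degree c * D) {k : ℕ} (hk : 0 < k)
    {a : P.SectionRing} (ha : a ∈ P.sections k) : ∃ l : Point P.sections, l.eval a = 0 := by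
  let p : Polynomial ℂ := a.coeff.sum fun c r => Polynomial.monomial (e c) r
  have hp : ∀ t, p.eval t = (P.pointOfExponent e he t).eval a := by
    intro t
    rw [pointOfExponent_eval, Finsupp.sum]
    refine (Polynomial.eval_finsetSum _ _ _).trans ?_
    simp only [Polynomial.eval_monomial]
  by_cases hdeg : p.degree = 0
  · refine ⟨P.pointOfExponent e' he' 0, ?_⟩
    have hcoeff : p.coeff (k * D) = 0 :=
      Polynomial.coeff_eq_zero_of_degree_lt (by rw [hdeg]; exact_mod_cast Nat.mul_pos hk hD)
    rw [pointOfExponent_eval, Finsupp.sum]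
    refine Eq.trans ?_ ((Polynomial.finsetSum_coeff _ _ _).symm.trans hcoeff)
    refine Finset.sum_congr rfl fun c hc => ?_
    have hc' := hee c
    rw [show P.degree c = k from ha c hc] at hc'
    rw [Polynomial.coeff_monomial]
    by_cases h : e' c = 0
    · rw [h, pow_zero, mul_one, if_pos (by omega)]
    · rw [zero_pow h, mul_zero, if_neg (by omega)]
  · obtain ⟨t, ht⟩ := IsAlgClosed.exists_root p hdeg
    exact ⟨P.pointOfExponent e he t, by rw [← hp]; exact ht⟩

/-- An affine integral function that is nonnegative on `P` is an additive function on the cone. -/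
noncomputable def exponentHom (u : ℤ) (w : (Fin n → ℤ) →+ ℤ)
    (h : ∀ c ∈ P.cone, 0 ≤ c.1 * u + w c.2) : P.cone →+ ℕ where
  toFun c := (c.1.1 * u + w c.1.2).toNat
  map_zero' := by simp
  map_add' c c' := by
    rw [← Int.toNat_add (h _ c.2) (h _ c'.2)]
    congr 1
    simp
    ring

/-- On the cone the value is a nonnegative combination of the values at the given points of `P`. -/
theorem nonneg_of_forall_points (u : ℤ) (i : Fin n) (s : ℤ) (h : ∀ v ∈ P.points, 0 ≤ u + s * v i)
    (c : ℕ × (Fin n → ℤ)) (hc : c ∈ P.cone) : 0 ≤ c.1 * u + s * c.2 i := by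
  obtain ⟨k, m⟩ := c
  obtain ⟨w, hw0, hw1, hwm⟩ := P.mem_cone_iff_exists.1 hc
  have : (0 : ℝ) ≤ k * u + s * m i := by
    rw [← hw1, ← hwm, Finset.sum_mul, Finset.mul_sum, ← Finset.sum_add_distrib]
    refine Finset.sum_nonneg fun v hv => ?_
    have h1 : (0 : ℝ) ≤ u + s * v i := by exact_mod_cast h v hv
    calc (0 : ℝ) ≤ w v * (u + s * v i) := mul_nonneg (hw0 v hv) h1
      _ = _ := by ring
  exact_mod_cast this

/-- A section of a positive multiple of `B` vanishes somewhere, if `X` is not a point. -/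
theorem exists_eval_eq_zero (hn : 0 < n) {k : ℕ} (hk : 0 < k) {a : P.SectionRing}
    (ha : a ∈ P.sections k) : ∃ l : Point P.sections, l.eval a = 0 := by
  let i₀ : Fin n := ⟨0, hn⟩
  obtain ⟨v₁, hv₁, hmin⟩ := P.points.exists_min_image (fun v => v i₀) P.points_nonempty
  obtain ⟨v₂, hv₂, hmax⟩ := P.points.exists_max_image (fun v => v i₀) P.points_nonempty
  -- Otherwise the coordinate is constant on `P`, and the open map that projects to it sends the
  -- nonempty interior to a single point.
  have hlt : v₁ i₀ < v₂ i₀ := by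
    refine lt_of_le_of_ne (hmin v₂ hv₂) fun heq => ?_
    have hconst : ∀ x ∈ P.body, x i₀ = v₁ i₀ := by
      intro x hx
      obtain ⟨w, -, hw1, hwx⟩ := P.mem_body_iff.1 hx
      rw [← hwx, ← one_mul (v₁ i₀ : ℝ), ← hw1, Finset.sum_mul]
      refine Finset.sum_congr rfl fun v hv => ?_
      rw [le_antisymm (hmin v hv) (heq ▸ hmax v hv)]
    have hopen := isOpenMap_eval (X := fun _ : Fin n => ℝ) i₀ _
      (isOpen_interior (s := P.body))
    have : Function.eval i₀ '' interior P.body = {(v₁ i₀ : ℝ)} := by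
      refine (Set.Nonempty.subset_singleton_iff (P.interior_nonempty.image _)).1 ?_
      rintro _ ⟨x, hx, rfl⟩
      exact hconst x (interior_subset hx)
    exact not_isOpen_singleton _ (this ▸ hopen)
  have h₁ := P.nonneg_of_forall_points (-v₁ i₀) i₀ 1 fun v hv => by linarith [hmin v hv]
  have h₂ := P.nonneg_of_forall_points (v₂ i₀) i₀ (-1) fun v hv => by linarith [hmax v hv]
  let w : ℤ → (Fin n → ℤ) →+ ℤ := fun s =>
    (AddMonoidHom.mulLeft s).comp (Pi.evalAddMonoidHom (fun _ => ℤ) i₀)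
  -- The exponents are the lattice distances to the faces where the coordinate is minimal and
  -- maximal; they add up to the degree times the width D.
  refine P.exists_eval_eq_zero_of_exponents (P.exponentHom (-v₁ i₀) (w 1) h₁)
    (P.exponentHom (v₂ i₀) (w (-1)) h₂) ⟨⟨(1, v₁), P.one_mem_cone hv₁⟩, rfl, ?_⟩
    ⟨⟨(1, v₂), P.one_mem_cone hv₂⟩, rfl, ?_⟩ (D := (v₂ i₀ - v₁ i₀).toNat) (by omega) ?_ hk ha
  · show ((1 : ℕ) * (-v₁ i₀) + 1 * v₁ i₀ : ℤ).toNat = 0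
    simp
  · show ((1 : ℕ) * (v₂ i₀) + (-1) * v₂ i₀ : ℤ).toNat = 0
    simp
  · rintro ⟨⟨j, m⟩, hc⟩
    have e₁ : (0 : ℤ) ≤ j * (-v₁ i₀) + 1 * m i₀ := h₁ _ hc
    have e₂ : (0 : ℤ) ≤ j * (v₂ i₀) + (-1) * m i₀ := h₂ _ hc
    show (j * (-v₁ i₀) + 1 * m i₀ : ℤ).toNat + (j * (v₂ i₀) + (-1) * m i₀ : ℤ).toNat =
      j * (v₂ i₀ - v₁ i₀).toNat
    zify
    rw [Int.toNat_of_nonneg e₁, Int.toNat_of_nonneg e₂, Int.toNat_of_nonneg (by omega)]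
    ring

end Zero

/-- The catalecticant of a general form is an isomorphism. -/
theorem forGeneralForm_bijective :
    ForGeneralForm P.sections fun f : Form P.sections => Function.Bijective (catalecticant f) :=
  forGeneralForm_catalecticant_bijective fun g h =>
    Subtype.ext (P.eq_zero_of_forall_torusPoint g.2 fun _ => h _)

end LatticePolytope

/-! ### Values and divisibility of binary forms. -/

namespace BinaryForm

open Polynomial

/-! A binary form of degree `m` is given by a polynomial `p` of degree at most `m`; the form is the
homogenization of `p`. -/

section Eval

variable {A B : Type*} [CommRing A] [Algebra ℂ A] [CommRing B] [Algebra ℂ B]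

/-- The value at `(z, w)` of the form of degree `m` given by `p`. -/
noncomputable def hev (m : ℕ) (z w : A) : ℂ[X] →ₗ[ℂ] A :=
  (MvPolynomial.aeval ![z, w]).toLinearMap ∘ₗ homogenizeLM m

theorem hev_apply (m : ℕ) (z w : A) (p : ℂ[X]) :
    hev m z w p = MvPolynomial.aeval ![z, w] (p.homogenize m) := rfl

theorem hev_mul {m n : ℕ} (z w : A) {p q : ℂ[X]} (hp : p.natDegree ≤ m) (hq : q.natDegree ≤ n) :
    hev (m + n) z w (p * q) = hev m z w p * hev n z w q := by
  rw [hev_apply, homogenize_mul p q hp hq, map_mul]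
  rfl

theorem map_hev (φ : A →ₐ[ℂ] B) (m : ℕ) (z w : A) (p : ℂ[X]) :
    φ (hev m z w p) = hev m (φ z) (φ w) p := by
  rw [hev_apply, hev_apply, ← AlgHom.comp_apply, MvPolynomial.comp_aeval]
  congr 2
  ext i
  fin_cases i <;> rfl

theorem hev_monomial {m j : ℕ} (h : j ≤ m) (z w : A) (r : ℂ) :
    hev m z w (monomial j r) = r • (z ^ j * w ^ (m - j)) := by
  rw [hev_apply, homogenize_monomial h, MvPolynomial.aeval_monomial, Algebra.smul_def]
  congr 1
  rw [Finsupp.prod_fintype _ _ (by simp)]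
  simp

theorem hev_X_pow {m j : ℕ} (h : j ≤ m) (z w : A) :
    hev m z w (X ^ j) = z ^ j * w ^ (m - j) := by
  rw [← monomial_one_right_eq_X_pow, hev_monomial h, one_smul]

theorem hev_one (m : ℕ) (z w : A) : hev m z w 1 = w ^ m := by
  have := hev_X_pow (Nat.zero_le m) z w
  simpa using this

theorem hev_C_mul (m : ℕ) (z w : A) (c : ℂ) (p : ℂ[X]) :
    hev m z w (C c * p) = c • hev m z w p := by
  rw [← smul_eq_C_mul, map_smul]

/-- Linear maps that agree on the monomials of degree at most `m` agree on forms of degree `m`. -/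
theorem ext_of_natDegree_le {V : Type*} [AddCommGroup V] [Module ℂ V] {m : ℕ}
    (φ ψ : ℂ[X] →ₗ[ℂ] V) (h : ∀ j ≤ m, φ (X ^ j) = ψ (X ^ j)) {p : ℂ[X]}
    (hp : p.natDegree ≤ m) : φ p = ψ p := by
  rw [as_sum_range_C_mul_X_pow' p (Nat.lt_succ_of_le hp), map_sum, map_sum]
  refine Finset.sum_congr rfl fun j hj => ?_
  rw [← smul_eq_C_mul, map_smul, map_smul, h j (Nat.lt_succ_iff.1 (Finset.mem_range.1 hj))]

theorem hev_smul_smul {m : ℕ} (c z w : ℂ) {p : ℂ[X]} (hp : p.natDegree ≤ m) :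
    hev m (c * z) (c * w) p = c ^ m * hev m z w p := by
  refine ext_of_natDegree_le (hev m (c * z) (c * w)) (c ^ m • hev m z w) (fun j hj => ?_) hp
  rw [LinearMap.smul_apply, hev_X_pow hj, hev_X_pow hj, smul_eq_mul]
  conv_rhs => rw [← Nat.add_sub_cancel' hj, pow_add]
  rw [Nat.add_sub_cancel_left]
  ring

theorem hev_one_right {m : ℕ} (t : A) {p : ℂ[X]} (hp : p.natDegree ≤ m) :
    hev m t 1 p = aeval t p := by
  refine ext_of_natDegree_le (hev m t 1) (aeval t).toLinearMap (fun j hj => ?_) hp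
  rw [hev_X_pow hj]
  simp

theorem hev_one_zero {m : ℕ} {p : ℂ[X]} (hp : p.natDegree ≤ m) :
    hev m (1 : ℂ) 0 p = p.coeff m := by
  refine ext_of_natDegree_le (hev m (1 : ℂ) 0) (lcoeff ℂ m) (fun j hj => ?_) hp
  rw [hev_X_pow hj, lcoeff_apply, coeff_X_pow, one_pow, one_mul]
  rcases hj.eq_or_lt with rfl | h
  · simp
  · rw [zero_pow (by omega), if_neg (by omega)]

theorem mem_degreeLT_succ {m : ℕ} {p : ℂ[X]} : p ∈ degreeLT ℂ (m + 1) ↔ p.natDegree ≤ m := by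
  rw [degreeLT_succ_eq_degreeLE, mem_degreeLE, natDegree_le_iff_degree_le]

/-- A form that vanishes at `(z, w)` is divisible by the corresponding linear form. -/
theorem exists_eq_mul_of_hev_eq_zero {m : ℕ} {z w : ℂ} (hzw : ¬(z = 0 ∧ w = 0)) {p : ℂ[X]}
    (hp : p ∈ degreeLT ℂ (m + 1)) (h : hev m z w p = 0) :
    ∃ q ∈ degreeLT ℂ m, p = (C w * X - C z) * q := by
  have hp' : p.natDegree ≤ m := mem_degreeLT_succ.1 hp
  by_cases hw : w = 0
  · subst hw
    have hz : z ≠ 0 := fun h => hzw ⟨h, rfl⟩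
    refine ⟨C (-z⁻¹) * p, ?_, ?_⟩
    · have h1 := hev_smul_smul z 1 0 hp'
      rw [mul_one, mul_zero, h, hev_one_zero hp'] at h1
      have h2 : p.coeff m = 0 := by
        rcases mul_eq_zero.1 h1.symm with h3 | h3
        · exact absurd h3 (pow_ne_zero _ hz)
        · exact h3
      rw [← smul_eq_C_mul]
      refine Submodule.smul_mem _ _ (mem_degreeLT.2 ?_)
      refine (degree_lt_iff_coeff_zero _ _).2 fun j hj => ?_
      rcases hj.eq_or_lt with rfl | hlt
      · exact h2
      · exact coeff_eq_zero_of_natDegree_lt (hp'.trans_lt hlt)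
    · rw [C_0, zero_mul, zero_sub, ← mul_assoc, ← C_neg, ← C_mul]
      rw [neg_mul_neg, mul_inv_cancel₀ hz, C_1, one_mul]
  · have h1 := hev_smul_smul w (z / w) 1 hp'
    rw [mul_div_cancel₀ _ hw, mul_one, h, hev_one_right _ hp'] at h1
    have h2 : p.IsRoot (z / w) := by
      rcases mul_eq_zero.1 h1.symm with h3 | h3
      · exact absurd h3 (pow_ne_zero _ hw)
      · simpa using h3
    obtain ⟨q, rfl⟩ := dvd_iff_isRoot.2 h2
    refine ⟨C w⁻¹ * q, ?_, ?_⟩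
    · rw [← smul_eq_C_mul]
      refine Submodule.smul_mem _ _ ?_
      by_cases hq : q = 0
      · rw [hq]
        exact Submodule.zero_mem _
      · rw [natDegree_mul (X_sub_C_ne_zero _) hq, natDegree_X_sub_C] at hp'
        rw [mem_degreeLT, degree_eq_natDegree hq]
        exact_mod_cast (by omega : q.natDegree < m)
    · have : (C w * X - C z : ℂ[X]) = C w * (X - C (z / w)) := by
        rw [mul_sub, ← C_mul, mul_div_cancel₀ _ hw]
      rw [this]
      have h3 : (C w * C w⁻¹ : ℂ[X]) = 1 := by rw [← C_mul, mul_inv_cancel₀ hw, C_1]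
      linear_combination (-(X - C (z / w)) * q) * h3

theorem linear_ne_zero {z w : ℂ} (hzw : ¬(z = 0 ∧ w = 0)) : (C w * X - C z : ℂ[X]) ≠ 0 := by
  intro h
  refine hzw ⟨?_, ?_⟩
  · simpa using congrArg (coeff · 0) h
  · simpa using congrArg (coeff · 1) h

theorem mul_mem_degreeLT {m n : ℕ} {p q : ℂ[X]} (hp : p.natDegree ≤ m) (hq : q ∈ degreeLT ℂ n) :
    p * q ∈ degreeLT ℂ (m + n) := by
  by_cases h : q = 0
  · rw [h, mul_zero]
    exact Submodule.zero_mem _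
  · rw [mem_degreeLT] at hq ⊢
    rw [degree_eq_natDegree h, Nat.cast_lt] at hq
    refine (degree_mul_le _ _).trans_lt ?_
    rw [degree_eq_natDegree h]
    calc p.degree + (q.natDegree : WithBot ℕ) ≤ (m : WithBot ℕ) + q.natDegree :=
          add_le_add_left (natDegree_le_iff_degree_le.1 hp) _
      _ < _ := by exact_mod_cast (by omega : m + q.natDegree < m + n)

/-- A form of degree `m` not vanishing at `(z, w)`. -/
theorem exists_hev_ne_zero (m : ℕ) {z w : ℂ} (hzw : ¬(z = 0 ∧ w = 0)) :
    ∃ e ∈ degreeLT ℂ (m + 1), hev m z w e ≠ 0 := by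
  by_cases hw : w = 0
  · refine ⟨X ^ m, mem_degreeLT_succ.2 (natDegree_X_pow_le m), ?_⟩
    rw [hev_X_pow le_rfl, Nat.sub_self, pow_zero, mul_one]
    exact pow_ne_zero _ fun h => hzw ⟨h, hw⟩
  · refine ⟨1, mem_degreeLT_succ.2 (by simp), ?_⟩
    rw [hev_one]
    exact pow_ne_zero _ hw

/-- Vanishing at a point is one condition, so `e` spans a complement of the multiples of the linear
form. Orthogonality to all forms can thus be tested on `e` and on those multiples. -/
theorem exists_eq_add_mul {m : ℕ} {z w : ℂ} (hzw : ¬(z = 0 ∧ w = 0)) {e p : ℂ[X]}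
    (he : e ∈ degreeLT ℂ (m + 1)) (he0 : hev m z w e ≠ 0) (hp : p ∈ degreeLT ℂ (m + 1)) :
    ∃ c : ℂ, ∃ q ∈ degreeLT ℂ m, p = c • e + (C w * X - C z) * q := by
  obtain ⟨q, hq, h⟩ := exists_eq_mul_of_hev_eq_zero hzw
    (p := p - (hev m z w p / hev m z w e) • e)
    (Submodule.sub_mem _ hp (Submodule.smul_mem _ _ he))
    (by rw [map_sub, map_smul, smul_eq_mul, div_mul_cancel₀ _ he0, sub_self])
  exact ⟨_, q, hq, by rw [← h, add_sub_cancel]⟩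

theorem finrank_degreeLT (n : ℕ) : Module.finrank ℂ (degreeLT ℂ n) = n := by
  rw [(degreeLTEquiv ℂ n).finrank_eq, Module.finrank_fin_fun]

instance (n : ℕ) : Module.Finite ℂ (degreeLT ℂ n) :=
  Module.Finite.equiv (degreeLTEquiv ℂ n).symm

/-- Makes division by `L` linear on all polynomials, so that conditions on a quotient can be imposed
as linear functionals of the product. -/
theorem exists_leftInverse_mul {L : ℂ[X]} (hL : L ≠ 0) :
    ∃ δ : ℂ[X] →ₗ[ℂ] ℂ[X], ∀ p, δ (L * p) = p := by
  obtain ⟨δ, hδ⟩ := LinearMap.exists_leftInverse_of_injective (LinearMap.mulLeft ℂ L)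
    (LinearMap.ker_eq_bot.2 (mul_right_injective₀ hL))
  exact ⟨δ, fun p => LinearMap.congr_fun hδ p⟩

end Eval

section Pencil

/-- For a functional `μ` on forms of degree `m + n`, there is a form of degree `m > n + r` that is
orthogonal to the forms of degree `n` and subject to `r` further linear conditions. -/
theorem exists_orthogonal (μ : ℂ[X] →ₗ[ℂ] ℂ) {m n r : ℕ} (hmn : n + r < m)
    (φ : Fin r → ℂ[X] →ₗ[ℂ] ℂ) :
    ∃ D ∈ degreeLT ℂ m, D ≠ 0 ∧ (∀ q ∈ degreeLT ℂ n, μ (D * q) = 0) ∧ ∀ i, φ i D = 0 := by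
  let T : degreeLT ℂ m →ₗ[ℂ] Module.Dual ℂ (degreeLT ℂ n) × (Fin r → ℂ) :=
    (((LinearMap.mul ℂ ℂ[X]).compr₂ μ).domRestrict₁₂ (degreeLT ℂ m) (degreeLT ℂ n)).prod
      (LinearMap.pi fun i => φ i ∘ₗ (degreeLT ℂ m).subtype)
  have hker : LinearMap.ker T ≠ ⊥ := LinearMap.ker_ne_bot_of_finrank_lt (by
    rw [Module.finrank_prod, Subspace.dual_finrank_eq, finrank_degreeLT, finrank_degreeLT,
      Module.finrank_fin_fun]
    exact hmn)
  obtain ⟨D, hD, hD0⟩ := Submodule.exists_mem_ne_zero_of_ne_bot hker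
  rw [LinearMap.mem_ker, Prod.ext_iff] at hD
  exact ⟨D, D.2, fun h => hD0 (Subtype.ext h),
    fun q hq => LinearMap.congr_fun hD.1 ⟨q, hq⟩, fun i => congrFun hD.2 i⟩

end Pencil

end BinaryForm

/-! ### Apolar forms of bidegree (1, d + 1) and a Bertini argument. -/

namespace BinaryForm

open Polynomial

section Pairing

variable (Λ : Fin 3 → ℂ[X] →ₗ[ℂ] ℂ)

/-- The pairing `(F, h) ↦ Λ(F h)` of forms of bidegree `(1, *)`, where `Λ` is a functional on forms
of bidegree `(2, *)`. A pair `(F₀, F₁)` stands for `F₀ y + F₁ x`. -/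
noncomputable def pairing : ℂ[X] × ℂ[X] →ₗ[ℂ] ℂ[X] × ℂ[X] →ₗ[ℂ] ℂ :=
  LinearMap.mk₂ ℂ
    (fun F h => Λ 0 (F.1 * h.1) + Λ 1 (F.1 * h.2 + F.2 * h.1) + Λ 2 (F.2 * h.2))
    (fun F F' h => by simp only [Prod.fst_add, Prod.snd_add, add_mul, map_add]; ring)
    (fun c F h => by
      simp only [Prod.smul_fst, Prod.smul_snd, smul_mul_assoc, map_add, map_smul, smul_eq_mul]
      ring)
    (fun F h h' => by simp only [Prod.fst_add, Prod.snd_add, mul_add, map_add]; ring)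
    (fun c F h => by
      simp only [Prod.smul_fst, Prod.smul_snd, mul_smul_comm, map_add, map_smul, smul_eq_mul]
      ring)

theorem pairing_apply (F h : ℂ[X] × ℂ[X]) : pairing Λ F h =
    Λ 0 (F.1 * h.1) + Λ 1 (F.1 * h.2 + F.2 * h.1) + Λ 2 (F.2 * h.2) := rfl

theorem pairing_mul_left (L : ℂ[X]) (F h : ℂ[X] × ℂ[X]) :
    pairing Λ (L * F.1, L * F.2) h = pairing Λ F (L * h.1, L * h.2) := by
  simp only [pairing_apply, mul_assoc, mul_left_comm L]

/-- Pairs of polynomials of degree less than `n`. -/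
noncomputable abbrev pairs (n : ℕ) : Submodule ℂ (ℂ[X] × ℂ[X]) :=
  (degreeLT ℂ n).prod (degreeLT ℂ n)

/-- `Λ` is nondegenerate on forms of bidegree `(1, d)`. -/
def Nondegenerate (d : ℕ) : Prop :=
  ∀ h ∈ pairs (d + 1), (∀ k ∈ pairs (d + 1), pairing Λ h k = 0) → h = 0

/-- `X Λ` is nondegenerate on forms of bidegree `(1, d - 1)`. -/
def ShiftNondegenerate (d : ℕ) : Prop :=
  ∀ h ∈ pairs d, (∀ k ∈ pairs d, pairing Λ (X * h.1, X * h.2) k = 0) → h = 0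

/-- The forms of bidegree `(1, d + 1)` that are apolar to `Λ`. -/
noncomputable def apolarPairs (d : ℕ) : Submodule ℂ (ℂ[X] × ℂ[X]) where
  carrier := {F | F ∈ pairs (d + 2) ∧ ∀ h ∈ pairs d, pairing Λ F h = 0}
  zero_mem' := ⟨Submodule.zero_mem _, fun h _ => by simp⟩
  add_mem' := fun ha hb => ⟨Submodule.add_mem _ ha.1 hb.1, fun h hh => by
    rw [map_add, LinearMap.add_apply, ha.2 h hh, hb.2 h hh, add_zero]⟩
  smul_mem' := fun c _ ha => ⟨Submodule.smul_mem _ c ha.1, fun h hh => by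
    rw [map_smul, LinearMap.smul_apply, ha.2 h hh, smul_zero]⟩

/-- There are apolar forms of bidegree `(1, d + 1)` subject to three further conditions. -/
theorem exists_mem_apolarPairs (d : ℕ) (φ : Fin 3 → ℂ[X] × ℂ[X] →ₗ[ℂ] ℂ) :
    ∃ F ∈ apolarPairs Λ d, F ≠ 0 ∧ ∀ i, φ i F = 0 := by
  let ι : ∀ n, degreeLT ℂ n × degreeLT ℂ n →ₗ[ℂ] ℂ[X] × ℂ[X] := fun n =>
    (degreeLT ℂ n).subtype.prodMap (degreeLT ℂ n).subtype
  let T : degreeLT ℂ (d + 2) × degreeLT ℂ (d + 2) →ₗ[ℂ]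
      Module.Dual ℂ (degreeLT ℂ d × degreeLT ℂ d) × (Fin 3 → ℂ) :=
    ((pairing Λ).compl₁₂ (ι (d + 2)) (ι d)).prod (LinearMap.pi fun i => φ i ∘ₗ ι (d + 2))
  have hker : LinearMap.ker T ≠ ⊥ := LinearMap.ker_ne_bot_of_finrank_lt (by
    rw [Module.finrank_prod, Subspace.dual_finrank_eq, Module.finrank_prod, Module.finrank_prod,
      finrank_degreeLT, finrank_degreeLT, Module.finrank_fin_fun]
    omega)
  obtain ⟨F, hF, hF0⟩ := Submodule.exists_mem_ne_zero_of_ne_bot hker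
  rw [LinearMap.mem_ker, Prod.ext_iff] at hF
  refine ⟨ι _ F, ⟨⟨F.1.2, F.2.2⟩, fun h hh => ?_⟩, fun h => hF0 ?_, fun i => congrFun hF.2 i⟩
  · exact LinearMap.congr_fun hF.1 (⟨h.1, hh.1⟩, ⟨h.2, hh.2⟩)
  · exact Prod.ext (Subtype.ext (Prod.ext_iff.1 h).1) (Subtype.ext (Prod.ext_iff.1 h).2)

/-- The pairs of forms of degree `m` that vanish at `(z, w)`. -/
noncomputable def vanishing (m : ℕ) (z w : ℂ) : Submodule ℂ (ℂ[X] × ℂ[X]) :=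
  (LinearMap.ker (hev m z w)).prod (LinearMap.ker (hev m z w))

variable {Λ}

/-- The apolar forms of bidegree `(1, d + 1)` subject to one linear condition do not have a common
fibre. -/
theorem not_le_vanishing {d : ℕ} (hΛ : Nondegenerate Λ d) (φ : ℂ[X] × ℂ[X] →ₗ[ℂ] ℂ) {z w : ℂ}
    (hzw : ¬(z = 0 ∧ w = 0)) :
    ¬ apolarPairs Λ d ⊓ LinearMap.ker φ ≤ vanishing (d + 1) z w := by
  intro hle
  obtain ⟨δ, hδ⟩ := exists_leftInverse_mul (linear_ne_zero hzw)
  obtain ⟨e, he, he0⟩ := exists_hev_ne_zero d hzw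
  -- If all such F were divisible by the linear form L of the fibre, write F = Lq. Apolarity of F
  -- makes q orthogonal to L · `pairs d`, and the two remaining conditions make it orthogonal to
  -- (e,0) and (0,e). Together these span `pairs (d + 1)`, so q = 0.
  obtain ⟨F, hF, hF0, hφ⟩ := exists_mem_apolarPairs Λ d
    ![φ, (pairing Λ).flip (e, 0) ∘ₗ δ.prodMap δ, (pairing Λ).flip (0, e) ∘ₗ δ.prodMap δ]
  obtain ⟨h1, h2⟩ := hle ⟨hF, hφ 0⟩
  obtain ⟨q₁, hq₁, e₁⟩ := exists_eq_mul_of_hev_eq_zero hzw hF.1.1 h1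
  obtain ⟨q₂, hq₂, e₂⟩ := exists_eq_mul_of_hev_eq_zero hzw hF.1.2 h2
  have hδF : δ.prodMap δ F = (q₁, q₂) := by
    rw [LinearMap.prodMap_apply, e₁, e₂, hδ, hδ]
  have hφ1 : pairing Λ (q₁, q₂) (e, 0) = 0 := by
    rw [← hδF]
    exact hφ 1
  have hφ2 : pairing Λ (q₁, q₂) (0, e) = 0 := by
    rw [← hδF]
    exact hφ 2
  have hq : (q₁, q₂) = (0 : ℂ[X] × ℂ[X]) := by
    refine hΛ _ ⟨hq₁, hq₂⟩ fun k hk => ?_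
    obtain ⟨c₁, r₁, hr₁, k₁⟩ := exists_eq_add_mul hzw he he0 hk.1
    obtain ⟨c₂, r₂, hr₂, k₂⟩ := exists_eq_add_mul hzw he he0 hk.2
    have hk' : k = c₁ • (e, 0) + c₂ • (0, e) +
        ((C w * X - C z) * r₁, (C w * X - C z) * r₂) := by
      ext1
      · simp [k₁]
      · simp [k₂]
    rw [hk', map_add, map_add, map_smul, map_smul, hφ1, hφ2, smul_zero, smul_zero, zero_add,
      zero_add, ← pairing_mul_left Λ _ (q₁, q₂) (r₁, r₂), ← e₁, ← e₂]
    exact hF.2 _ ⟨hr₁, hr₂⟩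
  rw [Prod.ext_iff] at hq
  refine hF0 (Prod.ext ?_ ?_)
  · rw [e₁, show q₁ = 0 from hq.1, mul_zero]
    rfl
  · rw [e₂, show q₂ = 0 from hq.2, mul_zero]
    rfl

/-- On a space on which two functionals `u`, `v` are proportional, both vanish if one suitable
functional does. -/
theorem exists_functional {V : Type*} [AddCommGroup V] [Module ℂ V] (W : Submodule ℂ V)
    (u v : V →ₗ[ℂ] ℂ) (h : ∀ F ∈ W, ∀ G ∈ W, u F * v G = v F * u G) :
    ∃ e : V →ₗ[ℂ] ℂ, ∀ F ∈ W, e F = 0 → u F = 0 ∧ v F = 0 := by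
  by_cases hu : ∀ F ∈ W, u F = 0
  · exact ⟨v, fun F hF he => ⟨hu F hF, he⟩⟩
  · push Not at hu
    obtain ⟨H, hH, hu⟩ := hu
    refine ⟨u, fun F hF he => ⟨he, ?_⟩⟩
    have := h F hF H hH
    rw [he, zero_mul] at this
    exact (mul_eq_zero.1 this.symm).resolve_right hu

/-- Not all apolar forms of bidegree `(1, d + 1)` subject to one linear condition are
proportional. -/
theorem exists_det_ne_zero {d : ℕ} (hΛ : ShiftNondegenerate Λ d) (φ : ℂ[X] × ℂ[X] →ₗ[ℂ] ℂ) :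
    ∃ F ∈ apolarPairs Λ d ⊓ LinearMap.ker φ, ∃ G ∈ apolarPairs Λ d ⊓ LinearMap.ker φ,
      F.1 * G.2 - F.2 * G.1 ≠ 0 := by
  by_contra! hdet
  obtain ⟨e₀, he₀⟩ := exists_functional (apolarPairs Λ d ⊓ LinearMap.ker φ)
    (lcoeff ℂ 0 ∘ₗ LinearMap.fst ℂ ℂ[X] ℂ[X]) (lcoeff ℂ 0 ∘ₗ LinearMap.snd ℂ ℂ[X] ℂ[X]) (by
      intro F hF G hG
      have := congrArg (coeff · 0) (sub_eq_zero.1 (hdet F hF G hG))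
      simp only [mul_coeff_zero] at this
      exact this)
  obtain ⟨e₁, he₁⟩ := exists_functional (apolarPairs Λ d ⊓ LinearMap.ker φ)
    (lcoeff ℂ (d + 1) ∘ₗ LinearMap.fst ℂ ℂ[X] ℂ[X])
    (lcoeff ℂ (d + 1) ∘ₗ LinearMap.snd ℂ ℂ[X] ℂ[X]) (by
      intro F hF G hG
      have := congrArg (coeff · (d + 1 + (d + 1))) (sub_eq_zero.1 (hdet F hF G hG))
      simp only [coeff_mul_add_eq_of_natDegree_le (mem_degreeLT_succ.1 hF.1.1.1)
        (mem_degreeLT_succ.1 hG.1.1.2), coeff_mul_add_eq_of_natDegree_le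
        (mem_degreeLT_succ.1 hF.1.1.2) (mem_degreeLT_succ.1 hG.1.1.1)] at this
      exact this)
  -- With all members proportional, one condition suffices to make both components vanish at t = 0,
  -- and one more at t = ∞. Then F = Xq with q in `pairs d`, and apolarity of F contradicts the
  -- nondegeneracy of the shift.
  obtain ⟨F, hF, hF0, hφ⟩ := exists_mem_apolarPairs Λ d ![φ, e₀, e₁]
  have h0 := he₀ F ⟨hF, hφ 0⟩ (hφ 1)
  have h1 := he₁ F ⟨hF, hφ 0⟩ (hφ 2)
  have key : ∀ p ∈ degreeLT ℂ (d + 2), p.coeff 0 = 0 → p.coeff (d + 1) = 0 →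
      ∃ q ∈ degreeLT ℂ d, p = X * q := by
    intro p hp hp0 hp1
    refine ⟨p.divX, mem_degreeLT.2 ((degree_lt_iff_coeff_zero _ _).2 fun j hj => ?_), ?_⟩
    · rw [coeff_divX]
      rcases hj.eq_or_lt with rfl | hlt
      · exact hp1
      · exact coeff_eq_zero_of_natDegree_lt
          ((mem_degreeLT_succ.1 hp).trans_lt (by omega))
    · conv_lhs => rw [← X_mul_divX_add p, hp0, C_0, add_zero]
  obtain ⟨q₁, hq₁, e₁⟩ := key F.1 hF.1.1 h0.1 h1.1
  obtain ⟨q₂, hq₂, e₂⟩ := key F.2 hF.1.2 h0.2 h1.2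
  have hq := hΛ (q₁, q₂) ⟨hq₁, hq₂⟩ (by
    intro k hk
    rw [← e₁, ← e₂]
    exact hF.2 k hk)
  rw [Prod.ext_iff] at hq
  refine hF0 (Prod.ext ?_ ?_)
  · rw [e₁, show q₁ = 0 from hq.1, mul_zero]
    rfl
  · rw [e₂, show q₂ = 0 from hq.2, mul_zero]
    rfl

/-- All but finitely many members of a pencil avoid finitely many subspaces, if none of these
contains both generators. -/
theorem exists_add_smul_notMem {V ι : Type*} [AddCommGroup V] [Module ℂ V] {s : Set ι}
    (hs : s.Finite) (p : ι → Submodule ℂ V) (F G : V) (h : ∀ i ∈ s, ¬(F ∈ p i ∧ G ∈ p i)) :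
    ∃ c : ℂ, ∀ i ∈ s, F + c • G ∉ p i := by
  have hfin : (⋃ i ∈ s, {c : ℂ | F + c • G ∈ p i}).Finite := by
    refine hs.biUnion fun i hi => Set.Subsingleton.finite fun c hc c' hc' => ?_
    by_contra hne
    have hsub : (F + c • G) - (F + c' • G) ∈ p i := Submodule.sub_mem _ hc hc'
    rw [add_sub_add_left_eq_sub, ← sub_smul,
      Submodule.smul_mem_iff _ (sub_ne_zero.2 hne)] at hsub
    refine h i hi ⟨?_, hsub⟩
    have := Submodule.sub_mem _ hc (Submodule.smul_mem _ c hsub)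
    rwa [add_sub_cancel_right] at this
  obtain ⟨c, hc⟩ := hfin.infinite_compl.nonempty
  exact ⟨c, fun i hi hmem => hc (Set.mem_biUnion hi hmem)⟩

/-- The point at infinity and the roots of `p`, as points of the projective line. -/
noncomputable def pointsOf (p : ℂ[X]) : Set (ℂ × ℂ) :=
  insert (1, 0) ((fun t => (t, 1)) '' {t | p.IsRoot t})

theorem finite_pointsOf {p : ℂ[X]} (hp : p ≠ 0) : (pointsOf p).Finite :=
  ((finite_setOfPred_isRoot hp).image _).insert _

theorem ne_zero_of_mem_pointsOf {p : ℂ[X]} {b : ℂ × ℂ} (hb : b ∈ pointsOf p) :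
    ¬(b.1 = 0 ∧ b.2 = 0) := by
  rcases hb with rfl | ⟨t, -, rfl⟩
  · exact fun h => one_ne_zero h.1
  · exact fun h => one_ne_zero h.2

theorem mem_vanishing_one {m : ℕ} {F : ℂ[X] × ℂ[X]} (hF : F ∈ pairs (m + 1)) (t : ℂ) :
    F ∈ vanishing m t 1 ↔ F.1.eval t = 0 ∧ F.2.eval t = 0 := by
  show hev m t 1 F.1 = 0 ∧ hev m t 1 F.2 = 0 ↔ _
  rw [hev_one_right _ (mem_degreeLT_succ.1 hF.1), hev_one_right _ (mem_degreeLT_succ.1 hF.2),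
    coe_aeval_eq_eval]

theorem mem_vanishing_infinity {m : ℕ} {F : ℂ[X] × ℂ[X]} (hF : F ∈ pairs (m + 1)) :
    F ∈ vanishing m 1 0 ↔ F.1.coeff m = 0 ∧ F.2.coeff m = 0 := by
  show hev m 1 0 F.1 = 0 ∧ hev m 1 0 F.2 = 0 ↔ _
  rw [hev_one_zero (mem_degreeLT_succ.1 hF.1), hev_one_zero (mem_degreeLT_succ.1 hF.2)]

/-- Among the apolar forms of bidegree `(1, d + 1)` subject to one linear condition there is one
that defines an irreducible curve. -/
theorem exists_irreducible {d : ℕ} (hΛ : Nondegenerate Λ d) (hΛ' : ShiftNondegenerate Λ d)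
    (φ : ℂ[X] × ℂ[X] →ₗ[ℂ] ℂ) : ∃ F ∈ apolarPairs Λ d, φ F = 0 ∧ IsCoprime F.1 F.2 ∧
      ¬(F.1.coeff (d + 1) = 0 ∧ F.2.coeff (d + 1) = 0) := by
  obtain ⟨F, hF, G', hG', hdet⟩ := exists_det_ne_zero hΛ' φ
  obtain ⟨P, hP, hPF⟩ : ∃ P : ℂ[X], P ≠ 0 ∧ ∀ t, F.1.eval t = 0 ∧ F.2.eval t = 0 → P.IsRoot t := by
    by_cases h : F.1 = 0
    · refine ⟨F.2, fun h2 => hdet (by rw [h, h2, zero_mul, zero_mul, sub_zero]), fun t ht => ht.2⟩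
    · exact ⟨F.1, h, fun t ht => ht.1⟩
  let D : ℂ[X] × ℂ[X] →ₗ[ℂ] ℂ[X] := LinearMap.mulLeft ℂ F.1 ∘ₗ LinearMap.snd ℂ ℂ[X] ℂ[X] -
    LinearMap.mulLeft ℂ F.2 ∘ₗ LinearMap.fst ℂ ℂ[X] ℂ[X]
  have hD : ∀ G, D G = F.1 * G.2 - F.2 * G.1 := fun _ => rfl
  -- `G` is chosen not proportional to `F` and without a common fibre with `F`: fibres contained in
  -- F = 0 lie over roots of `P` or over infinity.
  obtain ⟨G, hG, hGavoid⟩ := Submodule.exists_mem_forall_notMem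
    (s := insert none (some '' pointsOf P)) (((finite_pointsOf hP).image _).insert _)
    (apolarPairs Λ d ⊓ LinearMap.ker φ)
    (fun o : Option (ℂ × ℂ) => o.elim (LinearMap.ker D) fun b => vanishing (d + 1) b.1 b.2) (by
      rintro o (rfl | ⟨b, hb, rfl⟩) hle
      · exact hdet (hle hG')
      · exact not_le_vanishing hΛ φ (ne_zero_of_mem_pointsOf hb) hle)
  have hDG : D G ≠ 0 := hGavoid none (Set.mem_insert _ _)
  have hGv : ∀ b ∈ pointsOf P, G ∉ vanishing (d + 1) b.1 b.2 := fun b hb =>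
    hGavoid (some b) (Set.mem_insert_of_mem _ ⟨b, hb, rfl⟩)
  -- A finite fibre contained in F + cG = 0 lies over a root of the determinant of `F` and `G`,
  -- whatever c is. Each of these finitely many points, and infinity, excludes at most one c.
  obtain ⟨c, hc⟩ := exists_add_smul_notMem (finite_pointsOf hDG)
    (fun b => vanishing (d + 1) b.1 b.2) F G (by
      rintro b (rfl | ⟨t, -, rfl⟩) ⟨h1, h2⟩
      · exact hGv (1, 0) (Set.mem_insert _ _) h2
      · refine hGv (t, 1) (Set.mem_insert_of_mem _ ⟨t, ?_, rfl⟩) h2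
        exact hPF t ((mem_vanishing_one hF.1.1 t).1 h1))
  have hmem : F + c • G ∈ apolarPairs Λ d ⊓ LinearMap.ker φ :=
    Submodule.add_mem _ hF (Submodule.smul_mem _ c hG)
  refine ⟨F + c • G, hmem.1, hmem.2, ?_, fun h => ?_⟩
  · refine (isCoprime_iff_aeval_ne_zero_of_isAlgClosed (k := ℂ) ℂ _ _).2 fun t => ?_
    rw [coe_aeval_eq_eval, ← not_and_or]
    intro ht
    have hroot : (D G).IsRoot t := by
      have : D G = (F + c • G).1 * G.2 - (F + c • G).2 * G.1 := by
        rw [hD, Prod.fst_add, Prod.snd_add, Prod.smul_fst, Prod.smul_snd, smul_eq_C_mul,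
          smul_eq_C_mul]
        ring
      rw [this, IsRoot.def, eval_sub, eval_mul, eval_mul, ht.1, ht.2, zero_mul, zero_mul, sub_zero]
    exact hc (t, 1) (Set.mem_insert_of_mem _ ⟨t, hroot, rfl⟩)
      ((mem_vanishing_one hmem.1.1 t).2 ht)
  · exact hc (1, 0) (Set.mem_insert _ _) ((mem_vanishing_infinity hmem.1.1).2 h)

end Pairing

end BinaryForm

/-! ### Restriction to the rational curve F = 0. -/

namespace BinaryForm

open Polynomial

section Curve

variable {Λ : Fin 3 → ℂ[X] →ₗ[ℂ] ℂ} {d : ℕ} {F : ℂ[X] × ℂ[X]}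

/-- The restriction of forms of bidegree `(1, *)` to the curve `F = 0`, parametrized by
`(x, y) = (F₀, -F₁)`. -/
noncomputable def restrictOne (F : ℂ[X] × ℂ[X]) : ℂ[X] × ℂ[X] →ₗ[ℂ] ℂ[X] :=
  LinearMap.mulLeft ℂ F.1 ∘ₗ LinearMap.snd ℂ ℂ[X] ℂ[X] -
    LinearMap.mulLeft ℂ F.2 ∘ₗ LinearMap.fst ℂ ℂ[X] ℂ[X]

theorem restrictOne_apply (F h : ℂ[X] × ℂ[X]) : restrictOne F h = F.1 * h.2 - F.2 * h.1 := rfl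

/-- The restriction of forms of bidegree `(2, *)` to the curve `F = 0`. -/
noncomputable def restrictTwo (F : ℂ[X] × ℂ[X]) (h : Fin 3 → ℂ[X]) : ℂ[X] :=
  h 0 * F.2 ^ 2 - h 1 * (F.1 * F.2) + h 2 * F.1 ^ 2

theorem restrictOne_mul (F h k : ℂ[X] × ℂ[X]) : restrictOne F h * restrictOne F k =
    restrictTwo F ![h.1 * k.1, h.1 * k.2 + h.2 * k.1, h.2 * k.2] := by
  simp only [restrictOne_apply, restrictTwo, Matrix.cons_val]
  ring

theorem natDegree_eq_of_coeff_ne_zero {m : ℕ} {p : ℂ[X]} (hp : p ∈ degreeLT ℂ (m + 1))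
    (h : p.coeff m ≠ 0) : p.natDegree = m :=
  le_antisymm (mem_degreeLT_succ.1 hp) (le_natDegree_of_ne_zero h)

theorem mem_degreeLT_of_mul {m n : ℕ} {p q : ℂ[X]} (hp : p.natDegree = m) (hp0 : p ≠ 0)
    (h : p * q ∈ degreeLT ℂ (m + n)) : q ∈ degreeLT ℂ n := by
  by_cases hq : q = 0
  · rw [hq]
    exact Submodule.zero_mem _
  · rw [mem_degreeLT, degree_eq_natDegree (mul_ne_zero hp0 hq), natDegree_mul hp0 hq, hp,
      Nat.cast_lt] at h
    rw [mem_degreeLT, degree_eq_natDegree hq, Nat.cast_lt]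
    omega

theorem degreeLT_le {m n : ℕ} (h : m ≤ n) {p : ℂ[X]} (hp : p ∈ degreeLT ℂ m) :
    p ∈ degreeLT ℂ n := degreeLT_mono h hp

/-- Degree bookkeeping for dividing out the curve: one of its two coefficients has full degree d +
1, and this bounds first the cofactor `a`, then `b`. -/
theorem add_mul_mem_of_eq {d : ℕ} {p q a b r : ℂ[X]} (hp : p.natDegree = d + 1) (hp0 : p ≠ 0)
    (hq : q.natDegree ≤ d + 1) (ha : p * a ∈ degreeLT ℂ (2 * d + 1))
    (hr : r ∈ degreeLT ℂ (2 * d + 1)) (h : r = a * q + b * p) :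
    a ∈ degreeLT ℂ d ∧ b ∈ degreeLT ℂ d := by
  have ha' : a ∈ degreeLT ℂ d :=
    mem_degreeLT_of_mul hp hp0 (degreeLT_le (by omega) ha)
  refine ⟨ha', mem_degreeLT_of_mul hp hp0 ?_⟩
  have : p * b = r - q * a := by rw [h]; ring
  rw [this]
  exact Submodule.sub_mem _ (degreeLT_le (by omega) hr) (mul_mem_degreeLT hq ha')

/-- The forms of bidegree `(2, 2d)` that vanish on the irreducible curve `F = 0` are multiples
of `F`. -/
theorem exists_eq_mul_of_restrictTwo_eq_zero (hF : F ∈ pairs (d + 2)) (hcop : IsCoprime F.1 F.2)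
    (hlead : ¬(F.1.coeff (d + 1) = 0 ∧ F.2.coeff (d + 1) = 0)) {h : Fin 3 → ℂ[X]}
    (hh : ∀ i, h i ∈ degreeLT ℂ (2 * d + 1)) (h0 : restrictTwo F h = 0) :
    ∃ k ∈ pairs d, h 0 = F.1 * k.1 ∧ h 1 = F.1 * k.2 + F.2 * k.1 ∧ h 2 = F.2 * k.2 := by
  have hunit : ∀ {p q : ℂ[X]}, p = 0 → IsCoprime p q → q.natDegree = 0 := by
    rintro p q rfl h
    exact natDegree_eq_zero_of_isUnit (isCoprime_zero_left.1 h)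
  have hne1 : F.1 ≠ 0 := by
    intro h
    refine hlead ⟨by rw [h, coeff_zero], ?_⟩
    exact coeff_eq_zero_of_natDegree_lt (by rw [hunit h hcop]; omega)
  have hne2 : F.2 ≠ 0 := by
    intro h
    refine hlead ⟨?_, by rw [h, coeff_zero]⟩
    exact coeff_eq_zero_of_natDegree_lt (by rw [hunit h hcop.symm]; omega)
  rw [restrictTwo] at h0
  obtain ⟨a, ha⟩ : F.1 ∣ h 0 := by
    refine (hcop.pow_right (n := 2)).dvd_of_dvd_mul_right ⟨h 1 * F.2 - h 2 * F.1, ?_⟩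
    linear_combination h0
  obtain ⟨b, hb⟩ : F.2 ∣ h 2 := by
    refine (hcop.symm.pow_right (n := 2)).dvd_of_dvd_mul_right ⟨h 1 * F.1 - h 0 * F.2, ?_⟩
    linear_combination h0
  have hmid : h 1 = F.1 * b + F.2 * a := by
    refine mul_left_cancel₀ (mul_ne_zero hne1 hne2) ?_
    rw [ha, hb] at h0
    linear_combination -h0
  refine ⟨(a, b), ?_, ha, hmid, hb⟩
  have hd1 := mem_degreeLT_succ.1 hF.1
  have hd2 := mem_degreeLT_succ.1 hF.2
  by_cases hc : F.1.coeff (d + 1) = 0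
  · have hc2 := natDegree_eq_of_coeff_ne_zero hF.2 fun h => hlead ⟨hc, h⟩
    have := add_mul_mem_of_eq hc2 hne2 hd1 (a := b) (b := a) (hb ▸ hh 2) (hh 1)
      (by rw [hmid]; ring)
    exact ⟨this.2, this.1⟩
  · have hc1 := natDegree_eq_of_coeff_ne_zero hF.1 hc
    have := add_mul_mem_of_eq hc1 hne1 hd2 (a := a) (b := b) (ha ▸ hh 0) (hh 1)
      (by rw [hmid]; ring)
    exact this

/-- A functional for which the irreducible curve `F = 0` is apolar comes from a functional on
forms on the curve. -/
theorem exists_functional_restrictTwo (hF : F ∈ apolarPairs Λ d) (hcop : IsCoprime F.1 F.2)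
    (hlead : ¬(F.1.coeff (d + 1) = 0 ∧ F.2.coeff (d + 1) = 0)) :
    ∃ μ : ℂ[X] →ₗ[ℂ] ℂ, ∀ h : Fin 3 → ℂ[X], (∀ i, h i ∈ degreeLT ℂ (2 * d + 1)) →
      μ (restrictTwo F h) = Λ 0 (h 0) + Λ 1 (h 1) + Λ 2 (h 2) := by
  let π : Fin 3 → (Fin 3 → degreeLT ℂ (2 * d + 1)) →ₗ[ℂ] ℂ[X] := fun i =>
    (degreeLT ℂ (2 * d + 1)).subtype ∘ₗ LinearMap.proj i
  let Ψ : (Fin 3 → degreeLT ℂ (2 * d + 1)) →ₗ[ℂ] ℂ[X] :=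
    LinearMap.mulRight ℂ (F.2 ^ 2) ∘ₗ π 0 - LinearMap.mulRight ℂ (F.1 * F.2) ∘ₗ π 1 +
      LinearMap.mulRight ℂ (F.1 ^ 2) ∘ₗ π 2
  let Φ : Module.Dual ℂ (Fin 3 → degreeLT ℂ (2 * d + 1)) :=
    Λ 0 ∘ₗ π 0 + Λ 1 ∘ₗ π 1 + Λ 2 ∘ₗ π 2
  -- A functional factors through the restriction map once it kills the kernel. The kernel consists
  -- of multiples of `F`, which are killed because `F` is apolar.
  have hΦ : Φ ∈ LinearMap.range Ψ.dualMap := by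
    rw [LinearMap.range_dualMap_eq_dualAnnihilator_ker, Submodule.mem_dualAnnihilator]
    intro h hh
    obtain ⟨k, hk, e0, e1, e2⟩ := exists_eq_mul_of_restrictTwo_eq_zero hF.1 hcop hlead
      (h := fun i => (h i : ℂ[X])) (fun i => (h i).2) hh
    have := hF.2 k hk
    rw [pairing_apply, ← e0, ← e1, ← e2] at this
    exact this
  obtain ⟨μ, hμ⟩ := hΦ
  exact ⟨μ, fun h hh => LinearMap.congr_fun hμ fun i => ⟨h i, hh i⟩⟩

theorem restrictOne_mem (hF : F ∈ pairs (d + 2)) {h : ℂ[X] × ℂ[X]} (hh : h ∈ pairs (d + 1)) :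
    restrictOne F h ∈ degreeLT ℂ (2 * d + 2) := by
  have e : d + 1 + (d + 1) = 2 * d + 2 := by omega
  rw [← e]
  exact Submodule.sub_mem _ (mul_mem_degreeLT (mem_degreeLT_succ.1 hF.1) hh.2)
    (mul_mem_degreeLT (mem_degreeLT_succ.1 hF.2) hh.1)

/-- The forms of bidegree `(1, d)` do not vanish on the irreducible curve `F = 0`. -/
theorem eq_zero_of_restrictOne_eq_zero (hF : F ∈ pairs (d + 2)) (hcop : IsCoprime F.1 F.2)
    (hlead : ¬(F.1.coeff (d + 1) = 0 ∧ F.2.coeff (d + 1) = 0)) {h : ℂ[X] × ℂ[X]}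
    (hh : h ∈ pairs (d + 1)) (h0 : restrictOne F h = 0) : h = 0 := by
  rw [restrictOne_apply, sub_eq_zero] at h0
  have hsmall : ∀ {p q : ℂ[X]}, p.natDegree = d + 1 → q ∈ degreeLT ℂ (d + 1) → p ∣ q → q = 0 := by
    intro p q hp hq hpq
    by_contra hne
    have h1 := natDegree_le_of_dvd hpq hne
    have h2 := mem_degreeLT_succ.1 hq
    omega
  by_cases hc : F.1.coeff (d + 1) = 0
  · have hc2 := natDegree_eq_of_coeff_ne_zero hF.2 fun h => hlead ⟨hc, h⟩
    have h2 := hsmall hc2 hh.2 (hcop.symm.dvd_of_dvd_mul_left ⟨h.1, h0⟩)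
    rw [h2, mul_zero] at h0
    have hne : F.2 ≠ 0 := by
      rintro h
      exact hlead ⟨hc, by rw [h, coeff_zero]⟩
    exact Prod.ext ((mul_eq_zero.1 h0.symm).resolve_left hne) h2
  · have hc1 := natDegree_eq_of_coeff_ne_zero hF.1 hc
    have h1 := hsmall hc1 hh.1 (hcop.dvd_of_dvd_mul_left ⟨h.2, h0.symm⟩)
    rw [h1, mul_zero] at h0
    have hne : F.1 ≠ 0 := by
      rintro h
      exact hc (by rw [h, coeff_zero])
    exact Prod.ext h1 ((mul_eq_zero.1 h0).resolve_left hne)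

/-- Restriction is injective and both spaces have dimension 2(d + 1) = 2d + 2. -/
theorem exists_restrictOne_eq (hF : F ∈ pairs (d + 2)) (hcop : IsCoprime F.1 F.2)
    (hlead : ¬(F.1.coeff (d + 1) = 0 ∧ F.2.coeff (d + 1) = 0)) {p : ℂ[X]}
    (hp : p ∈ degreeLT ℂ (2 * d + 2)) : ∃ h ∈ pairs (d + 1), restrictOne F h = p := by
  let T : degreeLT ℂ (d + 1) × degreeLT ℂ (d + 1) →ₗ[ℂ] degreeLT ℂ (2 * d + 2) :=
    LinearMap.codRestrict _ (restrictOne F ∘ₗ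
      (degreeLT ℂ (d + 1)).subtype.prodMap (degreeLT ℂ (d + 1)).subtype)
      fun h => restrictOne_mem hF ⟨h.1.2, h.2.2⟩
  have hinj : Function.Injective T := by
    rw [← LinearMap.ker_eq_bot, LinearMap.ker_eq_bot']
    intro h hh
    have := eq_zero_of_restrictOne_eq_zero hF hcop hlead (h := (h.1, h.2)) ⟨h.1.2, h.2.2⟩
      (congrArg Subtype.val hh)
    rw [Prod.ext_iff] at this
    exact Prod.ext (Subtype.ext this.1) (Subtype.ext this.2)
  obtain ⟨h, hh⟩ := (LinearMap.injective_iff_surjective_of_finrank_eq_finrank (by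
    rw [Module.finrank_prod, finrank_degreeLT, finrank_degreeLT]
    omega)).1 hinj ⟨p, hp⟩
  exact ⟨(h.1, h.2), ⟨h.1.2, h.2.2⟩, congrArg Subtype.val hh⟩

/-- The functional on the curve `F = 0` is nondegenerate on forms of degree `2d + 1`. -/
theorem functional_nondegenerate (hΛ : Nondegenerate Λ d) (hF : F ∈ apolarPairs Λ d)
    (hcop : IsCoprime F.1 F.2) (hlead : ¬(F.1.coeff (d + 1) = 0 ∧ F.2.coeff (d + 1) = 0))
    {μ : ℂ[X] →ₗ[ℂ] ℂ} (hμ : ∀ h : Fin 3 → ℂ[X], (∀ i, h i ∈ degreeLT ℂ (2 * d + 1)) →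
      μ (restrictTwo F h) = Λ 0 (h 0) + Λ 1 (h 1) + Λ 2 (h 2)) {p : ℂ[X]}
    (hp : p ∈ degreeLT ℂ (2 * d + 2)) (h0 : ∀ q ∈ degreeLT ℂ (2 * d + 2), μ (p * q) = 0) :
    p = 0 := by
  obtain ⟨h, hh, rfl⟩ := exists_restrictOne_eq hF.1 hcop hlead hp
  rw [hΛ h hh fun k hk => ?_, map_zero]
  have := h0 _ (restrictOne_mem hF.1 hk)
  have hmem : ∀ {a b : ℂ[X]}, a ∈ degreeLT ℂ (d + 1) → b ∈ degreeLT ℂ (d + 1) →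
      a * b ∈ degreeLT ℂ (2 * d + 1) := by
    intro a b ha hb
    have := mul_mem_degreeLT (mem_degreeLT_succ.1 ha) hb
    rwa [← add_assoc, ← two_mul] at this
  rw [restrictOne_mul, hμ _ (by
    intro i
    fin_cases i
    · exact hmem hh.1 hk.1
    · exact Submodule.add_mem _ (hmem hh.1 hk.2) (hmem hh.2 hk.1)
    · exact hmem hh.2 hk.2)] at this
  exact this

end Curve

/-! ### Square-free apolar binary forms. -/

section SquareFree

variable {μ : ℂ[X] →ₗ[ℂ] ℂ} {m : ℕ}

variable (μ m) in
/-- The forms of degree `m + 1` that are apolar to `μ`. -/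
noncomputable def apolarForms : Submodule ℂ ℂ[X] where
  carrier := {D | D ∈ degreeLT ℂ (m + 2) ∧ ∀ q ∈ degreeLT ℂ m, μ (D * q) = 0}
  zero_mem' := ⟨Submodule.zero_mem _, fun h _ => by simp⟩
  add_mem' := fun ha hb => ⟨Submodule.add_mem _ ha.1 hb.1, fun h hh => by
    rw [add_mul, map_add, ha.2 h hh, hb.2 h hh, add_zero]⟩
  smul_mem' := fun c _ ha => ⟨Submodule.smul_mem _ c ha.1, fun h hh => by
    rw [smul_mul_assoc, map_smul, ha.2 h hh, smul_zero]⟩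

/-- The apolar forms have no base points. -/
theorem exists_apolarForms_hev_ne_zero
    (hμ : ∀ p ∈ degreeLT ℂ (m + 1), (∀ q ∈ degreeLT ℂ (m + 1), μ (p * q) = 0) → p = 0) {z w : ℂ}
    (hzw : ¬(z = 0 ∧ w = 0)) : ¬ apolarForms μ m ≤ LinearMap.ker (hev (m + 1) z w) := by
  intro hle
  obtain ⟨δ, hδ⟩ := exists_leftInverse_mul (linear_ne_zero hzw)
  obtain ⟨e, he, he0⟩ := exists_hev_ne_zero m hzw
  -- The apolar forms have dimension at least (m + 2) - m = 2, so a further condition leaves a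
  -- nonzero one. If D = Lp, requiring p orthogonal to `e` makes p orthogonal to everything.
  obtain ⟨D, hD, hD0, hDμ, hφ⟩ := exists_orthogonal μ (m := m + 2) (n := m) (r := 1) (by omega)
    fun _ => μ ∘ₗ LinearMap.mulRight ℂ e ∘ₗ δ
  obtain ⟨p, hp, rfl⟩ := exists_eq_mul_of_hev_eq_zero hzw hD (hle ⟨hD, hDμ⟩)
  have hφ0 : μ (p * e) = 0 := by
    have := hφ 0
    rw [LinearMap.comp_apply, LinearMap.comp_apply, hδ] at this
    exact this
  refine hD0 ?_
  rw [hμ p hp, mul_zero]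
  intro q hq
  obtain ⟨c, r, hr, rfl⟩ := exists_eq_add_mul hzw he he0 hq
  have := hDμ r hr
  rw [mul_add, map_add, mul_smul_comm, map_smul, hφ0, smul_zero, zero_add, ← this]
  congr 1
  ring

theorem hev_infinity_eq_zero_iff {D : ℂ[X]} (hD : D ∈ degreeLT ℂ (m + 2)) :
    D ∈ LinearMap.ker (hev (m + 1) (1 : ℂ) 0) ↔ D.coeff (m + 1) = 0 := by
  rw [LinearMap.mem_ker, hev_one_zero (mem_degreeLT_succ.1 hD)]

theorem hev_one_eq_zero_iff {D : ℂ[X]} (hD : D ∈ degreeLT ℂ (m + 2)) (t : ℂ) :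
    D ∈ LinearMap.ker (hev (m + 1) t 1) ↔ D.eval t = 0 := by
  rw [LinearMap.mem_ker, hev_one_right _ (mem_degreeLT_succ.1 hD), coe_aeval_eq_eval]

/-- A general apolar form has distinct roots. -/
theorem exists_separable
    (hμ : ∀ p ∈ degreeLT ℂ (m + 1), (∀ q ∈ degreeLT ℂ (m + 1), μ (p * q) = 0) → p = 0) :
    ∃ D ∈ apolarForms μ m, D.natDegree = m + 1 ∧ D.Separable := by
  obtain ⟨D₁, hD₁, hD₁0, hD₁μ, -⟩ := exists_orthogonal μ (m := m + 2) (n := m) (r := 0) (by omega)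
    fun _ => 0
  obtain ⟨D₂, hD₂, hD₂v⟩ := Submodule.exists_mem_forall_notMem (finite_pointsOf hD₁0)
    (apolarForms μ m) (fun b => LinearMap.ker (hev (m + 1) b.1 b.2)) fun b hb =>
      exists_apolarForms_hev_ne_zero hμ (ne_zero_of_mem_pointsOf hb)
  have hcoeff : D₂.coeff (m + 1) ≠ 0 := fun h =>
    hD₂v (1, 0) (Set.mem_insert _ _) ((hev_infinity_eq_zero_iff hD₂.1).2 h)
  have hcop' : ∀ t, D₁.eval t = 0 → D₂.eval t ≠ 0 := fun t h1 h2 =>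
    hD₂v (t, 1) (Set.mem_insert_of_mem _ ⟨t, h1, rfl⟩) ((hev_one_eq_zero_iff hD₂.1 t).2 h2)
  have hcop : IsCoprime D₁ D₂ := by
    refine (isCoprime_iff_aeval_ne_zero_of_isAlgClosed (k := ℂ) ℂ _ _).2 fun t => ?_
    rw [coe_aeval_eq_eval, ← not_and_or]
    exact fun h => hcop' t h.1 h.2
  -- `D₂` is prime to `D₁` and has degree m + 1 > 0; coprime polynomials with zero Wronskian would
  -- both be constant.
  have hW : wronskian D₁ D₂ ≠ 0 := by
    intro h
    have h2 := derivative_eq_zero.1 (hcop.wronskian_eq_zero_iff.1 h).2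
    have := le_natDegree_of_ne_zero hcoeff
    omega
  -- A double root of D₁ + cD₂ is a root of the Wronskian, independently of c. Each such root
  -- excludes at most one c; excluding also a zero at infinity fixes the degree.
  obtain ⟨c, hc⟩ := exists_add_smul_notMem (finite_pointsOf hW)
    (fun b => LinearMap.ker (hev (m + 1) b.1 b.2)) D₁ D₂ (by
      rintro b (rfl | ⟨t, -, rfl⟩) ⟨h1, h2⟩
      · exact hcoeff ((hev_infinity_eq_zero_iff hD₂.1).1 h2)
      · exact hcop' t ((hev_one_eq_zero_iff hD₁ t).1 h1) ((hev_one_eq_zero_iff hD₂.1 t).1 h2))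
  have hmem : D₁ + c • D₂ ∈ apolarForms μ m :=
    Submodule.add_mem _ ⟨hD₁, hD₁μ⟩ (Submodule.smul_mem _ c hD₂)
  refine ⟨D₁ + c • D₂, hmem, natDegree_eq_of_coeff_ne_zero hmem.1 fun h =>
    hc (1, 0) (Set.mem_insert _ _) ((hev_infinity_eq_zero_iff hmem.1).2 h), ?_⟩
  refine (isCoprime_iff_aeval_ne_zero_of_isAlgClosed (k := ℂ) ℂ _ _).2 fun t => ?_
  rw [coe_aeval_eq_eval, ← not_and_or]
  rintro ⟨h1, h2⟩
  have hroot : (wronskian D₁ D₂).IsRoot t := by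
    have : wronskian D₁ D₂ = (D₁ + c • D₂) * derivative D₂ - derivative (D₁ + c • D₂) * D₂ := by
      rw [wronskian, derivative_add, derivative_smul, smul_eq_C_mul, smul_eq_C_mul]
      ring
    rw [this, IsRoot.def, eval_sub, eval_mul, eval_mul, h1, h2, zero_mul, zero_mul, sub_zero]
  exact hc (t, 1) (Set.mem_insert_of_mem _ ⟨t, hroot, rfl⟩) ((hev_one_eq_zero_iff hmem.1 t).2 h1)

end SquareFree

section Chart

/-! The chart `t = (1 + s u) / u` around `t = ∞`, in which `u = ∞` is the point `t = s`. -/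

/-- The form `p` of degree `m` in the coordinate `u`. -/
noncomputable def chart (m : ℕ) (s : ℂ) : ℂ[X] →ₗ[ℂ] ℂ[X] := hev m (1 + C s * X) X

theorem natDegree_chart_le (m : ℕ) (s : ℂ) {p : ℂ[X]} (hp : p.natDegree ≤ m) :
    (chart m s p).natDegree ≤ m := by
  rw [as_sum_range_C_mul_X_pow' p (Nat.lt_succ_of_le hp), map_sum]
  refine natDegree_sum_le_of_forall_le _ _ fun j hj => ?_
  have hj' : j ≤ m := Nat.lt_succ_iff.1 (Finset.mem_range.1 hj)
  rw [chart, hev_C_mul, hev_X_pow hj']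
  refine (natDegree_smul_le _ _).trans ((natDegree_mul_le).trans ?_)
  have h1 : ((1 + C s * X : ℂ[X]) ^ j).natDegree ≤ j :=
    (natDegree_pow_le).trans (by
      have : (1 + C s * X : ℂ[X]).natDegree ≤ 1 := by compute_degree
      calc j * _ ≤ j * 1 := Nat.mul_le_mul_left j this
        _ = j := mul_one j)
  have h2 := natDegree_X_pow_le (R := ℂ) (m - j)
  omega

/-- The point t = s is u = ∞, where the value of a form is its top coefficient. Thus a form that
does not vanish at s has full degree in the chart: its whole divisor is affine. -/
theorem coeff_chart (m : ℕ) (s : ℂ) {p : ℂ[X]} (hp : p.natDegree ≤ m) :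
    (chart m s p).coeff m = p.eval s := by
  refine ext_of_natDegree_le (lcoeff ℂ m ∘ₗ chart m s) (Polynomial.leval s) (fun j hj => ?_) hp
  rw [LinearMap.comp_apply, chart, hev_X_pow hj, lcoeff_apply, leval_apply, eval_pow, eval_X]
  have h1 : (1 + C s * X : ℂ[X]).natDegree ≤ 1 := by compute_degree
  have h2 : ((1 + C s * X : ℂ[X]) ^ j).natDegree ≤ j :=
    (natDegree_pow_le_of_le j h1).trans (by omega)
  have h3 := coeff_mul_add_eq_of_natDegree_le h2 (natDegree_X_pow_le (R := ℂ) (m - j))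
  rw [Nat.add_sub_cancel' hj, coeff_X_pow_self, mul_one] at h3
  rw [h3]
  have h4 := coeff_pow_of_natDegree_le (m := j) h1
  rw [mul_one] at h4
  rw [h4]
  simp [coeff_one]

/-- The inverse of the change of charts. -/
theorem hev_chart (m : ℕ) (s : ℂ) {p : ℂ[X]} (hp : p.natDegree ≤ m) :
    hev m 1 (X - C s) (chart m s p) = p := by
  refine ext_of_natDegree_le (hev m 1 (X - C s) ∘ₗ chart m s) LinearMap.id (fun j hj => ?_) hp
  have h1 : (1 + C s * X : ℂ[X]).natDegree ≤ 1 := by compute_degree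
  have hpow : ∀ j, ((1 + C s * X : ℂ[X]) ^ j).natDegree ≤ j ∧
      hev j (1 : ℂ[X]) (X - C s) ((1 + C s * X) ^ j) = X ^ j := by
    intro j
    induction j with
    | zero => exact ⟨by simp, by rw [pow_zero, hev_one, pow_zero, pow_zero]⟩
    | succ j ih =>
      refine ⟨(natDegree_pow_le_of_le (j + 1) h1).trans (by omega), ?_⟩
      rw [pow_succ, hev_mul _ _ ih.1 h1, ih.2, pow_succ, map_add, hev_one, hev_C_mul]
      have := hev_X_pow (le_refl 1) (1 : ℂ[X]) (X - C s)
      rw [pow_one] at this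
      rw [this, pow_one, Nat.sub_self, pow_zero, mul_one, pow_one, smul_eq_C_mul, mul_one,
        sub_add_cancel]
  rw [LinearMap.comp_apply, chart, hev_X_pow hj, LinearMap.id_apply]
  conv_lhs => rw [← Nat.add_sub_cancel' hj, Nat.add_sub_cancel_left]
  rw [hev_mul _ _ (hpow j).1 (natDegree_X_pow_le _), (hpow j).2, hev_X_pow le_rfl]
  simp

theorem natDegree_hev_le (m : ℕ) (s : ℂ) {p : ℂ[X]} (hp : p.natDegree ≤ m) :
    (hev m 1 (X - C s) p).natDegree ≤ m := by
  rw [as_sum_range_C_mul_X_pow' p (Nat.lt_succ_of_le hp), map_sum]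
  refine natDegree_sum_le_of_forall_le _ _ fun j hj => ?_
  rw [hev_C_mul, hev_X_pow (Nat.lt_succ_iff.1 (Finset.mem_range.1 hj)), one_pow, one_mul]
  refine (natDegree_smul_le _ _).trans ?_
  rw [natDegree_pow, natDegree_X_sub_C, mul_one]
  exact Nat.sub_le _ _

/-- Divisibility by a form that does not vanish at `t = s` can be tested in the chart. -/
theorem exists_eq_mul_of_chart_dvd {m n : ℕ} {s : ℂ} {D p : ℂ[X]} (hD : D.natDegree ≤ m)
    (hDs : D.eval s ≠ 0) (hp : p.natDegree ≤ m + n) (h : chart m s D ∣ chart (m + n) s p) :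
    ∃ q : ℂ[X], q.natDegree ≤ n ∧ p = D * q := by
  obtain ⟨r, hr⟩ := h
  have hlead : (chart m s D).coeff m ≠ 0 := by rwa [coeff_chart m s hD]
  have hDdeg :=
    natDegree_eq_of_coeff_ne_zero (mem_degreeLT_succ.2 (natDegree_chart_le m s hD)) hlead
  have hD0 : chart m s D ≠ 0 := by
    intro h
    rw [h, coeff_zero] at hlead
    exact hlead rfl
  have hrdeg : r.natDegree ≤ n := by
    have := natDegree_chart_le (m + n) s hp
    by_cases hr0 : r = 0
    · simp [hr0]
    · rw [hr, natDegree_mul hD0 hr0, hDdeg] at this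
      omega
  refine ⟨hev n 1 (X - C s) r, natDegree_hev_le n s hrdeg, ?_⟩
  rw [← hev_chart (m + n) s hp, hr, hev_mul _ _ hDdeg.le hrdeg, hev_chart m s hD]

end Chart

end BinaryForm

/-! ### The cone over the rectangle. -/

namespace LatticePolytope

namespace rectangle

variable {d : ℕ} {hd : 1 ≤ d}

theorem mem_points_iff {v : Fin 2 → ℤ} : v ∈ (rectangle d hd).points ↔
    (v 0 = 0 ∨ v 0 = 1) ∧ (v 1 = 0 ∨ v 1 = d) := by
  show v ∈ ({![0, 0], ![1, 0], ![0, (d : ℤ)], ![1, (d : ℤ)]} : Finset (Fin 2 → ℤ)) ↔ _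
  have h : ∀ a b : ℤ, v = ![a, b] ↔ v 0 = a ∧ v 1 = b := by
    intro a b
    constructor
    · rintro rfl
      exact ⟨rfl, rfl⟩
    · rintro ⟨rfl, rfl⟩
      ext i
      fin_cases i <;> rfl
  simp only [Finset.mem_insert, Finset.mem_singleton, h]
  tauto

theorem one_mem_cone_of_le {v : Fin 2 → ℤ} (h0 : v 0 = 0 ∨ v 0 = 1) (h1 : 0 ≤ v 1)
    (h2 : v 1 ≤ d) : (1, v) ∈ (rectangle d hd).cone := by
  have hd0 : (0 : ℝ) < d := by exact_mod_cast hd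
  have hv : ∀ b : ℤ, (b = 0 ∨ b = d) →
      (fun i => ((![v 0, b] : Fin 2 → ℤ) i : ℝ)) ∈ (rectangle d hd).body :=
    fun b hb => subset_convexHull ℝ _ ⟨![v 0, b], 
      (mem_points_iff (v := ![v 0, b])).2 ⟨h0, hb⟩, rfl⟩
  rw [mem_cone_iff, Nat.cast_one, one_smul]
  have h1' : (0 : ℝ) ≤ v 1 := by exact_mod_cast h1
  have h2' : (v 1 : ℝ) ≤ d := by exact_mod_cast h2
  have : _ ∈ (rectangle d hd).body := convex_convexHull ℝ _ (hv 0 (Or.inl rfl)) (hv d (Or.inr rfl))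
    (a := 1 - v 1 / d) (b := v 1 / d) (sub_nonneg.2 ((div_le_one hd0).2 h2'))
    (div_nonneg h1' hd0.le) (by ring)
  convert this using 1
  ext i
  fin_cases i
  · simp
    ring
  · simp
    field_simp

theorem mem_cone_iff' {k : ℕ} {m : Fin 2 → ℤ} : (k, m) ∈ (rectangle d hd).cone ↔
    (0 ≤ m 0 ∧ m 0 ≤ k) ∧ 0 ≤ m 1 ∧ m 1 ≤ k * d := by
  constructor
  · intro h
    have hb := fun u i s hP => (rectangle d hd).nonneg_of_forall_points u i s hP _ h
    have h1 := hb 0 0 1 fun v hv => by rcases (mem_points_iff.1 hv).1 with h | h <;> rw [h] <;> simp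
    have h2 := hb 1 0 (-1) fun v hv => by
      rcases (mem_points_iff.1 hv).1 with h | h <;> rw [h] <;> simp
    have h3 := hb 0 1 1 fun v hv => by rcases (mem_points_iff.1 hv).2 with h | h <;> rw [h] <;> simp
    have h4 := hb d 1 (-1) fun v hv => by
      rcases (mem_points_iff.1 hv).2 with h | h <;> rw [h] <;> simp
    refine ⟨⟨?_, ?_⟩, ?_, ?_⟩ <;> linarith
  · induction k generalizing m with
    | zero =>
      rintro ⟨⟨h1, h2⟩, h3, h4⟩
      have : m = 0 := by
        ext i
        fin_cases i
        · exact le_antisymm (by simpa using h2) h1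
        · exact le_antisymm (by simpa using h4) h3
      rw [this]
      exact zero_mem _
    | succ k ih =>
      rintro ⟨⟨h1, h2⟩, h3, h4⟩
      rw [Nat.cast_add_one] at h2 h4
      rw [add_mul, one_mul] at h4
      -- A lattice point of the rectangle is split off greedily, as large as possible in each
      -- coordinate.
      have hsplit : (k + 1, m) =
          ((k, ![m 0 - min (m 0) 1, m 1 - min (m 1) d]) + (1, ![min (m 0) 1, min (m 1) d]) :
            ℕ × (Fin 2 → ℤ)) := by
        refine Prod.ext rfl ?_
        ext i
        fin_cases i <;> simp
      rw [hsplit]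
      refine add_mem (ih ?_) (one_mem_cone_of_le ?_ ?_ ?_)
      · show (0 ≤ m 0 - min (m 0) 1 ∧ m 0 - min (m 0) 1 ≤ k) ∧
          0 ≤ m 1 - min (m 1) d ∧ m 1 - min (m 1) d ≤ k * d
        have : (0 : ℤ) ≤ k * d := by positivity
        refine ⟨⟨?_, ?_⟩, ?_, ?_⟩ <;> omega
      · show min (m 0) 1 = 0 ∨ min (m 0) 1 = 1
        omega
      · show 0 ≤ min (m 1) d
        omega
      · exact min_le_right _ _

/-- The lattice point `(i, j)` of the `k`-th multiple of the rectangle. -/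
def cell (k i j : ℕ) (hi : i ≤ k) (hj : j ≤ k * d) : (rectangle d hd).cone :=
  ⟨(k, ![(i : ℤ), (j : ℤ)]), mem_cone_iff'.2 ⟨⟨by simp, by simpa using hi⟩, by simp,
    by simpa using mod_cast hj⟩⟩

/-- The exponent of `x`. -/
def expX : (rectangle d hd).cone →+ ℕ where
  toFun c := (c.1.2 0).toNat
  map_zero' := rfl
  map_add' c c' := Int.toNat_add (mem_cone_iff'.1 c.2).1.1 (mem_cone_iff'.1 c'.2).1.1

/-- The exponent of `z`. -/
def expZ : (rectangle d hd).cone →+ ℕ where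
  toFun c := (c.1.2 1).toNat
  map_zero' := rfl
  map_add' c c' := Int.toNat_add (mem_cone_iff'.1 c.2).2.1 (mem_cone_iff'.1 c'.2).2.1

theorem coe_expX (c : (rectangle d hd).cone) : (expX c : ℤ) = c.1.2 0 :=
  Int.toNat_of_nonneg (mem_cone_iff'.1 c.2).1.1

theorem coe_expZ (c : (rectangle d hd).cone) : (expZ c : ℤ) = c.1.2 1 :=
  Int.toNat_of_nonneg (mem_cone_iff'.1 c.2).2.1

theorem expX_le (c : (rectangle d hd).cone) : expX c ≤ (rectangle d hd).degree c := by
  have h := (mem_cone_iff'.1 c.2).1.2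
  rw [← coe_expX] at h
  exact_mod_cast h

theorem expZ_le (c : (rectangle d hd).cone) : expZ c ≤ (rectangle d hd).degree c * d := by
  have h := (mem_cone_iff'.1 c.2).2.2
  rw [← coe_expZ] at h
  exact_mod_cast h

theorem expX_cell (k i j : ℕ) (hi : i ≤ k) (hj : j ≤ k * d) :
    expX (cell (hd := hd) k i j hi hj) = i := rfl

theorem expZ_cell (k i j : ℕ) (hi : i ≤ k) (hj : j ≤ k * d) :
    expZ (cell (hd := hd) k i j hi hj) = j := rfl

theorem degree_cell (k i j : ℕ) (hi : i ≤ k) (hj : j ≤ k * d) :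
    (rectangle d hd).degree (cell k i j hi hj) = k := rfl

theorem cone_ext {c c' : (rectangle d hd).cone}
    (h : (rectangle d hd).degree c = (rectangle d hd).degree c') (hX : expX c = expX c')
    (hZ : expZ c = expZ c') : c = c' := by
  refine Subtype.ext (Prod.ext h ?_)
  ext i
  fin_cases i
  · show c.1.2 0 = c'.1.2 0
    rw [← coe_expX, ← coe_expX, hX]
  · show c.1.2 1 = c'.1.2 1
    rw [← coe_expZ, ← coe_expZ, hZ]

/-- The exponent of `y`. -/
def expY : (rectangle d hd).cone →+ ℕ where
  toFun c := (rectangle d hd).degree c - expX c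
  map_zero' := by simp
  map_add' c c' := by
    have h1 := expX_le c
    have h2 := expX_le c'
    simp only [map_add]
    omega

/-- The exponent of `w`. -/
def expW : (rectangle d hd).cone →+ ℕ where
  toFun c := (rectangle d hd).degree c * d - expZ c
  map_zero' := by simp
  map_add' c c' := by
    have h1 := expZ_le c
    have h2 := expZ_le c'
    simp only [map_add, add_mul]
    omega

theorem expX_add_expY (c : (rectangle d hd).cone) :
    expX c + expY c = (rectangle d hd).degree c := Nat.add_sub_cancel' (expX_le c)

theorem expZ_add_expW (c : (rectangle d hd).cone) :
    expZ c + expW c = (rectangle d hd).degree c * d := Nat.add_sub_cancel' (expZ_le c)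

/-- At a corner the semigroup is the quadrant generated by the two unit steps `a`, `b` = ±1 into the
rectangle. A quadrant is given by sign conditions, which pass from k • m to m. -/
theorem isVeryAmple : (rectangle d hd).IsVeryAmple := by
  intro v hv m k hk hkm
  obtain ⟨v', hv', hvv⟩ := extremePoints_convexHull_subset hv
  obtain rfl : v' = v := by
    ext i
    exact Int.cast_injective (congrFun hvv i)
  obtain ⟨hv0, hv1⟩ := mem_points_iff.1 (Finset.mem_coe.1 hv')
  have hlat : ∀ u : Fin 2 → ℤ, u ∈ (rectangle d hd).latticePoints ↔
      (0 ≤ u 0 ∧ u 0 ≤ 1) ∧ 0 ≤ u 1 ∧ u 1 ≤ d := by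
    intro u
    have := mem_cone_iff' (hd := hd) (k := 1) (m := u)
    rw [mem_cone_iff, Nat.cast_one, one_smul, Nat.cast_one, one_mul] at this
    exact this
  obtain ⟨a, ha, hav⟩ : ∃ a : ℤ, (a = 1 ∨ a = -1) ∧ ∀ t : ℤ, 0 ≤ t → t ≤ 1 →
      0 ≤ a * (t - v' 0) := by
    rcases hv0 with h | h
    · exact ⟨1, Or.inl rfl, fun t h0 h1 => by rw [h]; omega⟩
    · exact ⟨-1, Or.inr rfl, fun t h0 h1 => by rw [h]; omega⟩
  obtain ⟨b, hb, hbv⟩ : ∃ b : ℤ, (b = 1 ∨ b = -1) ∧ ∀ t : ℤ, 0 ≤ t → t ≤ d →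
      0 ≤ b * (t - v' 1) := by
    rcases hv1 with h | h
    · exact ⟨1, Or.inl rfl, fun t h0 h1 => by rw [h]; omega⟩
    · exact ⟨-1, Or.inr rfl, fun t h0 h1 => by rw [h]; omega⟩
  have hsign : ∀ u ∈ AddSubmonoid.closure ((fun u => u - v') '' (rectangle d hd).latticePoints),
      0 ≤ a * u 0 ∧ 0 ≤ b * u 1 := by
    intro u hu
    induction hu using AddSubmonoid.closure_induction with
    | mem u hu =>
      obtain ⟨u, hu, rfl⟩ := hu
      obtain ⟨⟨h1, h2⟩, h3, h4⟩ := (hlat u).1 hu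
      exact ⟨hav _ h1 h2, hbv _ h3 h4⟩
    | zero => simp
    | add u u' _ _ h h' =>
      rw [Pi.add_apply, Pi.add_apply, mul_add, mul_add]
      exact ⟨add_nonneg h.1 h'.1, add_nonneg h.2 h'.2⟩
  obtain ⟨h1, h2⟩ := hsign _ hkm
  have hk' : (0 : ℤ) < k := by exact_mod_cast hk
  rw [Pi.smul_apply, nsmul_eq_mul, mul_left_comm] at h1 h2
  have h1' : 0 ≤ a * m 0 := nonneg_of_mul_nonneg_right h1 hk'
  have h2' : 0 ≤ b * m 1 := nonneg_of_mul_nonneg_right h2 hk'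
  have hgen : ∀ u : Fin 2 → ℤ, (0 ≤ u 0 + v' 0 ∧ u 0 + v' 0 ≤ 1) →
      (0 ≤ u 1 + v' 1 ∧ u 1 + v' 1 ≤ d) →
      u ∈ AddSubmonoid.closure ((fun u => u - v') '' (rectangle d hd).latticePoints) :=
    fun u h h' => AddSubmonoid.subset_closure ⟨u + v', (hlat _).2 ⟨h, h'⟩, add_sub_cancel_right _ _⟩
  have hm : m = (a * m 0).toNat • ![a, 0] + (b * m 1).toNat • ![0, b] := by
    have haa : a * a = 1 := by rcases ha with rfl | rfl <;> rfl
    have hbb : b * b = 1 := by rcases hb with rfl | rfl <;> rfl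
    ext i
    fin_cases i
    · show m 0 = (a * m 0).toNat • a + (b * m 1).toNat • (0 : ℤ)
      rw [smul_zero, add_zero, nsmul_eq_mul, Int.toNat_of_nonneg h1']
      linear_combination (-m 0) * haa
    · show m 1 = (a * m 0).toNat • (0 : ℤ) + (b * m 1).toNat • b
      rw [smul_zero, zero_add, nsmul_eq_mul, Int.toNat_of_nonneg h2']
      linear_combination (-m 1) * hbb
  have hd' : (1 : ℤ) ≤ d := by exact_mod_cast hd
  have hav0 := hav 0 le_rfl zero_le_one
  have hav1 := hav 1 zero_le_one le_rfl
  have hbv0 := hbv 0 le_rfl (by omega)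
  have hbvd := hbv d (by omega) le_rfl
  rw [hm]
  have ha' : 0 ≤ a + v' 0 ∧ a + v' 0 ≤ 1 := by
    rcases ha with rfl | rfl <;> rcases hv0 with h | h <;> omega
  have hb' : 0 ≤ b + v' 1 ∧ b + v' 1 ≤ d := by
    rcases hb with rfl | rfl <;> rcases hv1 with h | h <;> omega
  have ha0 : 0 ≤ 0 + v' 0 ∧ 0 + v' 0 ≤ 1 := by rcases hv0 with h | h <;> omega
  have hb0 : 0 ≤ 0 + v' 1 ∧ 0 + v' 1 ≤ d := by rcases hv1 with h | h <;> omega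
  exact add_mem (nsmul_mem (hgen _ ha' hb0) _) (nsmul_mem (hgen _ ha0 hb') _)

end rectangle

end LatticePolytope

/-! ### Sections on ℙ¹ × ℙ¹ as tuples of polynomials. -/

namespace LatticePolytope

theorem single_mem_sections {n : ℕ} (P : LatticePolytope n) {k : ℕ} {c : P.cone}
    (hc : P.degree c = k) (r : ℂ) :
    (AddMonoidAlgebra.single c r : P.SectionRing) ∈ P.sections k := by
  rw [← hc]
  exact AddMonoidAlgebra.single_mem_gradeBy _ _ _

/-- The sections of `k B` are spanned by the characters in `k P`. -/
theorem sections_le {n : ℕ} (P : LatticePolytope n) {k : ℕ} {S : Submodule ℂ P.SectionRing}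
    (h : ∀ c, P.degree c = k → AddMonoidAlgebra.single c 1 ∈ S) : P.sections k ≤ S := by
  intro a ha
  rw [← AddMonoidAlgebra.sum_coeff_single a]
  refine Submodule.sum_mem _ fun c hc => ?_
  rw [← mul_one (a.coeff c), ← smul_eq_mul, ← AddMonoidAlgebra.smul_single]
  exact Submodule.smul_mem _ _ (h c (ha c hc))

theorem ext_sections {n : ℕ} (P : LatticePolytope n) {V : Type*} [AddCommGroup V] [Module ℂ V]
    {k : ℕ} (φ ψ : P.SectionRing →ₗ[ℂ] V)
    (h : ∀ c, P.degree c = k → φ (AddMonoidAlgebra.single c 1) = ψ (AddMonoidAlgebra.single c 1))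
    {a : P.SectionRing} (ha : a ∈ P.sections k) : φ a = ψ a :=
  P.sections_le (S := LinearMap.eqLocus φ ψ) h ha

namespace rectangle

open Polynomial BinaryForm

variable {d : ℕ} {hd : 1 ≤ d} {A B : Type*} [CommRing A] [Algebra ℂ A] [CommRing B] [Algebra ℂ B]

/-- The substitution of `x`, `y`, `z`, `w` into bihomogeneous forms. -/
noncomputable def subst (x y z w : A) : (rectangle d hd).SectionRing →ₐ[ℂ] A :=
  AddMonoidAlgebra.lift ℂ A (rectangle d hd).cone
    { toFun := fun c => x ^ expX c.toAdd * y ^ expY c.toAdd * (z ^ expZ c.toAdd * w ^ expW c.toAdd)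
      map_one' := by simp
      map_mul' := fun c c' => by
        simp only [toAdd_mul, map_add, pow_add]
        ring }

theorem subst_single (x y z w : A) (c : (rectangle d hd).cone) (r : ℂ) :
    subst x y z w (AddMonoidAlgebra.single c r) =
      r • (x ^ expX c * y ^ expY c * (z ^ expZ c * w ^ expW c)) :=
  AddMonoidAlgebra.lift_single _ _ _

/-- The coefficient of `x ^ i` in a bihomogeneous form, dehomogenized. -/
noncomputable def part (i : ℕ) : (rectangle d hd).SectionRing →ₗ[ℂ] ℂ[X] :=
  (lcoeff ℂ[X] i).restrictScalars ℂ ∘ₗ (subst (X : ℂ[X][X]) 1 (C X) 1).toLinearMap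

theorem part_single (i : ℕ) (c : (rectangle d hd).cone) :
    part i (AddMonoidAlgebra.single c 1) = if i = expX c then X ^ expZ c else 0 := by
  show (subst (X : ℂ[X][X]) 1 (C X) 1 (AddMonoidAlgebra.single c 1)).coeff i = _
  rw [subst_single, one_smul, one_pow, one_pow, mul_one, mul_one, ← C_pow, coeff_mul_C, coeff_X_pow,
    ite_mul, one_mul, zero_mul]

theorem part_cell (i k j b : ℕ) (hj : j ≤ k) (hb : b ≤ k * d) :
    part i (AddMonoidAlgebra.single (cell (hd := hd) k j b hj hb) 1) = if i = j then X ^ b else 0 :=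
  part_single _ _

theorem part_mul (i : ℕ) (a b : (rectangle d hd).SectionRing) :
    part i (a * b) = ∑ j ∈ Finset.HasAntidiagonal.antidiagonal i, part j.1 a * part j.2 b := by
  show (subst (X : ℂ[X][X]) 1 (C X) 1 (a * b)).coeff i = _
  rw [map_mul, coeff_mul]
  rfl

theorem part_mem {k : ℕ} {a : (rectangle d hd).SectionRing} (ha : a ∈ (rectangle d hd).sections k)
    (i : ℕ) : part i a ∈ degreeLT ℂ (k * d + 1) := by
  refine (rectangle d hd).sections_le (S := (degreeLT ℂ (k * d + 1)).comap (part i))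
    (fun c hc => ?_) ha
  rw [Submodule.mem_comap, part_single]
  split_ifs with h
  · exact mem_degreeLT_succ.2 ((natDegree_X_pow_le _).trans (hc ▸ expZ_le c))
  · exact zero_mem _

theorem part_eq_zero {k i : ℕ} (hi : k < i) {a : (rectangle d hd).SectionRing}
    (ha : a ∈ (rectangle d hd).sections k) : part i a = 0 := by
  refine (rectangle d hd).ext_sections (part i) 0 (fun c hc => ?_) ha
  have := expX_le c
  rw [part_single, if_neg (by omega), LinearMap.zero_apply]

theorem subst_eq_sum (x y z w : A) {k : ℕ} {a : (rectangle d hd).SectionRing}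
    (ha : a ∈ (rectangle d hd).sections k) : subst x y z w a =
      ∑ i ∈ Finset.range (k + 1), x ^ i * y ^ (k - i) * hev (k * d) z w (part i a) := by
  have := (rectangle d hd).ext_sections (subst x y z w).toLinearMap
    (∑ i ∈ Finset.range (k + 1), LinearMap.mulLeft ℂ (x ^ i * y ^ (k - i)) ∘ₗ
      hev (k * d) z w ∘ₗ part i) (fun c hc => ?_) ha
  · simpa [mul_assoc] using this
  · have h1 := expX_le c
    have h2 := expZ_le c
    rw [LinearMap.sum_apply, Finset.sum_eq_single (expX c)]
    · simp only [LinearMap.comp_apply, part_single, if_true, LinearMap.mulLeft_apply,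
        AlgHom.toLinearMap_apply, subst_single, one_smul]
      rw [hev_X_pow (hc ▸ h2), ← hc]
      rfl
    · intro i _ hi
      rw [LinearMap.comp_apply, LinearMap.comp_apply, part_single, if_neg hi, map_zero, map_zero]
    · intro h
      exact absurd (Finset.mem_range.2 (by omega)) h

theorem map_subst (φ : A →ₐ[ℂ] B) (x y z w : A) (a : (rectangle d hd).SectionRing) :
    φ (subst x y z w a) = subst (φ x) (φ y) (φ z) (φ w) a := by
  have : φ.comp (subst x y z w) = subst (hd := hd) (φ x) (φ y) (φ z) (φ w) := by
    refine AddMonoidAlgebra.algHom_ext (fun c => ?_) (Subsingleton.elim _ _)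
    rw [AlgHom.comp_apply, subst_single, subst_single]
    simp
  exact DFunLike.congr_fun this a

theorem eq_zero_of_part {k : ℕ} {a : (rectangle d hd).SectionRing}
    (ha : a ∈ (rectangle d hd).sections k) (h : ∀ i ≤ k, part i a = 0) : a = 0 := by
  refine AddMonoidAlgebra.ext (Finsupp.ext fun c => ?_)
  by_contra hc
  have hck : (rectangle d hd).degree c = k := ha c (Finsupp.mem_support_iff.2 hc)
  have key := (rectangle d hd).ext_sections (lcoeff ℂ (expZ c) ∘ₗ part (expX c))
    (Finsupp.lapply c ∘ₗ (AddMonoidAlgebra.coeffLinearEquiv ℂ).toLinearMap) (fun c' hc' => ?_) ha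
  · rw [LinearMap.comp_apply, h _ (hck ▸ expX_le c), map_zero] at key
    exact hc key.symm
  · show (part (expX c) (AddMonoidAlgebra.single c' 1)).coeff (expZ c) =
      (AddMonoidAlgebra.single c' (1 : ℂ)).coeff c
    rw [part_single, AddMonoidAlgebra.coeff_single, Finsupp.single_apply]
    by_cases hcc : c' = c
    · rw [hcc, if_pos rfl, if_pos rfl, coeff_X_pow, if_pos rfl]
    · rw [if_neg hcc]
      split_ifs with hX
      · rw [coeff_X_pow, if_neg]
        exact fun hZ => hcc (cone_ext (hc'.trans hck.symm) hX.symm hZ.symm)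
      · rw [coeff_zero]

/-- With `eq_zero_of_part`, this identifies the sections of kB with (k + 1)-tuples of polynomials of
degree at most kd. -/
theorem exists_part_eq {k : ℕ} {h : ℕ → ℂ[X]} (hh : ∀ i, h i ∈ degreeLT ℂ (k * d + 1)) :
    ∃ a ∈ (rectangle d hd).sections k, ∀ i ≤ k, part i a = h i := by
  classical
  have key : ∀ j ≤ k, ∀ p ∈ degreeLT ℂ (k * d + 1), ∃ a ∈ (rectangle d hd).sections k,
      ∀ i, part i a = if i = j then p else 0 := by
    intro j hj p hp
    have hp' := mem_degreeLT_succ.1 hp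
    refine ⟨∑ b ∈ (Finset.range (k * d + 1)).attach, p.coeff b • AddMonoidAlgebra.single
      (cell k j b.1 hj (Nat.lt_succ_iff.1 (Finset.mem_range.1 b.2))) 1,
      Submodule.sum_mem _ fun b _ => Submodule.smul_mem _ _
        ((rectangle d hd).single_mem_sections (degree_cell ..) 1), fun i => ?_⟩
    simp only [map_sum, map_smul, part_cell]
    split_ifs
    · rw [Finset.sum_attach (Finset.range (k * d + 1)) fun b => p.coeff b • (X : ℂ[X]) ^ b]
      conv_rhs => rw [p.as_sum_range' (k * d + 1) (Nat.lt_succ_of_le hp')]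
      exact Finset.sum_congr rfl fun b _ => by rw [← C_mul_X_pow_eq_monomial, smul_eq_C_mul]
    · simp
  choose! a ha hpart using fun j (hj : j ≤ k) => key j hj (h j) (hh j)
  refine ⟨∑ j ∈ Finset.range (k + 1), a j, Submodule.sum_mem _ fun j hj =>
    ha j (Nat.lt_succ_iff.1 (Finset.mem_range.1 hj)), fun i hi => ?_⟩
  rw [map_sum,
    Finset.sum_congr rfl fun j hj => hpart j (Nat.lt_succ_iff.1 (Finset.mem_range.1 hj)) i,
    Finset.sum_ite_eq, if_pos (Finset.mem_range.2 (by omega))]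

variable (hd) in
/-- The two parts of a form of bidegree `(1, d)`. -/
noncomputable def partsOne : (rectangle d hd).sections 1 →ₗ[ℂ] ℂ[X] × ℂ[X] :=
  ((part 0).prod (part 1)) ∘ₗ ((rectangle d hd).sections 1).subtype

theorem partsOne_apply (g : (rectangle d hd).sections 1) :
    partsOne hd g = (part 0 (g : (rectangle d hd).SectionRing),
      part 1 (g : (rectangle d hd).SectionRing)) := rfl

theorem partsOne_mem (g : (rectangle d hd).sections 1) : partsOne hd g ∈ pairs (d + 1) := by
  have := part_mem g.2
  rw [one_mul] at this
  exact ⟨this 0, this 1⟩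

theorem partsOne_injective : Function.Injective (partsOne hd) := by
  rw [← LinearMap.ker_eq_bot, LinearMap.ker_eq_bot']
  intro g hg
  refine Subtype.ext (eq_zero_of_part g.2 fun i hi => ?_)
  interval_cases i
  · exact congrArg Prod.fst hg
  · exact congrArg Prod.snd hg

theorem exists_partsOne_eq {h : ℂ[X] × ℂ[X]} (hh : h ∈ pairs (d + 1)) :
    ∃ g, partsOne hd g = h := by
  obtain ⟨a, ha, hpart⟩ := exists_part_eq (hd := hd) (k := 1)
    (h := fun i => if i = 0 then h.1 else h.2) fun i => by
      rw [one_mul]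
      split_ifs
      exacts [hh.1, hh.2]
  exact ⟨⟨a, ha⟩, Prod.ext (hpart 0 zero_le_one) (hpart 1 le_rfl)⟩

theorem finrank_sections_one : Module.finrank ℂ ((rectangle d hd).sections 1) = 2 * d + 2 := by
  let T : (rectangle d hd).sections 1 →ₗ[ℂ] degreeLT ℂ (d + 1) × degreeLT ℂ (d + 1) :=
    ((LinearMap.fst ℂ ℂ[X] ℂ[X] ∘ₗ partsOne hd).codRestrict _ fun g => (partsOne_mem g).1).prod
      ((LinearMap.snd ℂ ℂ[X] ℂ[X] ∘ₗ partsOne hd).codRestrict _ fun g => (partsOne_mem g).2)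
  have hT : ∀ g, (((T g).1 : ℂ[X]), ((T g).2 : ℂ[X])) = partsOne hd g := fun g => rfl
  have hbij : Function.Bijective T := by
    constructor
    · intro g g' h
      refine partsOne_injective ?_
      rw [← hT, ← hT, h]
    · rintro ⟨p, q⟩
      obtain ⟨g, hg⟩ := exists_partsOne_eq (hd := hd) (h := (p, q)) ⟨p.2, q.2⟩
      rw [← hT] at hg
      exact ⟨g, Prod.ext (Subtype.ext (congrArg Prod.fst hg)) (Subtype.ext (congrArg Prod.snd hg))⟩
  rw [(LinearEquiv.ofBijective T hbij).finrank_eq, Module.finrank_prod, finrank_degreeLT]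
  omega

end rectangle

end LatticePolytope

/-! ### Functionals representing a form, and their nondegeneracy. -/

namespace LatticePolytope

namespace rectangle

open Polynomial BinaryForm

variable {d : ℕ} {hd : 1 ≤ d}

/-- The functional `f` on forms of bidegree `(2, 2d)` is given by `Λ`. -/
def Represents (Λ : Fin 3 → ℂ[X] →ₗ[ℂ] ℂ) (f : Form (rectangle d hd).sections) : Prop :=
  ∀ g : (rectangle d hd).sections 2, f g = Λ 0 (part 0 (g : (rectangle d hd).SectionRing)) +
    Λ 1 (part 1 (g : (rectangle d hd).SectionRing)) +
    Λ 2 (part 2 (g : (rectangle d hd).SectionRing))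

/-- `f` is extended from the triples of parts to all triples of polynomials; only the values on
polynomials of degree at most 2d are determined by `f`. -/
theorem exists_represents (f : Form (rectangle d hd).sections) : ∃ Λ, Represents Λ f := by
  let T : (rectangle d hd).sections 2 →ₗ[ℂ] Fin 3 → ℂ[X] :=
    (LinearMap.pi fun i : Fin 3 => part i) ∘ₗ ((rectangle d hd).sections 2).subtype
  have hT : LinearMap.ker T = ⊥ := by
    rw [LinearMap.ker_eq_bot']
    intro g hg
    refine Subtype.ext (eq_zero_of_part g.2 fun i hi => ?_)
    exact congrFun hg ⟨i, by omega⟩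
  obtain ⟨S, hS⟩ := LinearMap.exists_leftInverse_of_injective T hT
  refine ⟨fun i => f ∘ₗ S ∘ₗ LinearMap.single ℂ (fun _ => ℂ[X]) i, fun g => ?_⟩
  have h1 : T g = ∑ i, Pi.single i (T g i) := (Finset.univ_sum_single (T g)).symm
  have h2 : f g = f (S (T g)) := by rw [← LinearMap.comp_apply S, hS, LinearMap.id_apply]
  rw [h2, h1, map_sum, map_sum, Fin.sum_univ_three]
  rfl

variable {Λ : Fin 3 → ℂ[X] →ₗ[ℂ] ℂ} {f : Form (rectangle d hd).sections}

theorem part_mulOne (g g' : (rectangle d hd).sections 1) :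
    part 0 (mulOne g g' : (rectangle d hd).SectionRing) =
        (partsOne hd g).1 * (partsOne hd g').1 ∧
      part 1 (mulOne g g' : (rectangle d hd).SectionRing) =
        (partsOne hd g).1 * (partsOne hd g').2 + (partsOne hd g).2 * (partsOne hd g').1 ∧
      part 2 (mulOne g g' : (rectangle d hd).SectionRing) =
        (partsOne hd g).2 * (partsOne hd g').2 := by
  rw [coe_mulOne, part_mul, part_mul, part_mul]
  refine ⟨?_, ?_, ?_⟩
  · simp [partsOne_apply]
  · simp [partsOne_apply, Finset.Nat.antidiagonal_succ]
  · simp [partsOne_apply, Finset.Nat.antidiagonal_succ, part_eq_zero one_lt_two g.2,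
      part_eq_zero one_lt_two g'.2]

theorem Represents.catalecticant_apply (h : Represents Λ f) (g g' : (rectangle d hd).sections 1) :
    catalecticant f g g' = pairing Λ (partsOne hd g) (partsOne hd g') := by
  obtain ⟨h0, h1, h2⟩ := part_mulOne g g'
  rw [Apolarity.catalecticant_apply, h, h0, h1, h2, pairing_apply]

theorem Represents.nondegenerate (h : Represents Λ f) (hf : Function.Bijective (catalecticant f)) :
    Nondegenerate Λ d := by
  intro p hp h0
  obtain ⟨g, rfl⟩ := exists_partsOne_eq (hd := hd) hp
  have : g = 0 := hf.1 (LinearMap.ext fun g' => by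
    rw [h.catalecticant_apply, h0 _ (partsOne_mem g'), map_zero, LinearMap.zero_apply])
  rw [this, map_zero]

variable (hd) in
/-- The product of `z w` with two monomials of bidegree `(1, d - 1)`. -/
noncomputable def shiftEntry (a b : Fin 2 × Fin d) : (rectangle d hd).sections 2 :=
  ⟨AddMonoidAlgebra.single (cell 2 (a.1 + b.1) (a.2 + b.2 + 1) (by omega) (by omega)) 1,
    (rectangle d hd).single_mem_sections (degree_cell ..) 1⟩

theorem part_shiftEntry (i : ℕ) (a b : Fin 2 × Fin d) :
    part i (shiftEntry hd a b : (rectangle d hd).SectionRing) =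
      if i = a.1 + b.1 then X ^ (a.2 + b.2 + 1 : ℕ) else 0 := part_cell ..

noncomputable def pairMonomial (a : Fin 2 × Fin d) : ℂ[X] × ℂ[X] :=
  if a.1 = 0 then (X ^ (a.2 : ℕ), 0) else (0, X ^ (a.2 : ℕ))

theorem pairMonomial_mem (a : Fin 2 × Fin d) : pairMonomial a ∈ pairs d := by
  have : (X ^ (a.2 : ℕ) : ℂ[X]) ∈ degreeLT ℂ d := by
    rw [mem_degreeLT, degree_X_pow]
    exact_mod_cast a.2.2
  rw [pairMonomial]
  split_ifs
  · exact ⟨this, zero_mem _⟩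
  · exact ⟨zero_mem _, this⟩

theorem Represents.apply_shiftEntry (h : Represents Λ f) (a b : Fin 2 × Fin d) :
    f (shiftEntry hd a b) =
      pairing Λ (X * (pairMonomial a).1, X * (pairMonomial a).2) (pairMonomial b) := by
  obtain ⟨i, j⟩ := a
  obtain ⟨i', j'⟩ := b
  have hX : (X * X ^ (j : ℕ) * X ^ (j' : ℕ) : ℂ[X]) = X ^ (j + j' + 1 : ℕ) := by ring
  rw [h, pairing_apply, part_shiftEntry, part_shiftEntry, part_shiftEntry]
  fin_cases i <;> fin_cases i' <;> simp [pairMonomial, hX]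

theorem eq_sum_pairMonomial {h : ℂ[X] × ℂ[X]} (hh : h ∈ pairs d) :
    h = ∑ a : Fin 2 × Fin d, (if a.1 = 0 then h.1 else h.2).coeff a.2 • pairMonomial a := by
  have key : ∀ p ∈ degreeLT ℂ d, p = ∑ j : Fin d, p.coeff j • X ^ (j : ℕ) := by
    intro p hp
    rw [Fin.sum_univ_eq_sum_range fun j => p.coeff j • (X : ℂ[X]) ^ j]
    by_cases hp0 : p = 0
    · simp [hp0]
    · conv_lhs => rw [p.as_sum_range' d ((natDegree_lt_iff_degree_lt hp0).2 (mem_degreeLT.1 hp))]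
      exact Finset.sum_congr rfl fun b _ => by rw [← C_mul_X_pow_eq_monomial, smul_eq_C_mul]
  rw [Fintype.sum_prod_type, Fin.sum_univ_two]
  refine Prod.ext ?_ ?_
  · simpa [pairMonomial, Prod.fst_sum] using key _ hh.1
  · simpa [pairMonomial, Prod.snd_sum] using key _ hh.2

theorem Represents.shiftNondegenerate (h : Represents Λ f)
    (hdet : (Matrix.of fun a b => f (shiftEntry hd a b)).det ≠ 0) : ShiftNondegenerate Λ d := by
  intro p hp h0
  let φ : ℂ[X] × ℂ[X] →ₗ[ℂ] ℂ[X] × ℂ[X] := (LinearMap.mulLeft ℂ X).prodMap (LinearMap.mulLeft ℂ X)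
  have hc : (fun a : Fin 2 × Fin d => (if a.1 = 0 then p.1 else p.2).coeff a.2) = 0 := by
    refine Matrix.eq_zero_of_vecMul_eq_zero hdet (funext fun b => ?_)
    have h1 : pairing Λ (φ p) (pairMonomial b) = 0 := h0 _ (pairMonomial_mem b)
    rw [eq_sum_pairMonomial hp, map_sum, map_sum, LinearMap.sum_apply] at h1
    rw [Pi.zero_apply, Matrix.vecMul, dotProduct, ← h1]
    refine Finset.sum_congr rfl fun a _ => ?_
    rw [map_smul, map_smul, LinearMap.smul_apply, smul_eq_mul]
    exact congrArg _ (h.apply_shiftEntry a b)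
  rw [eq_sum_pairMonomial hp]
  exact Finset.sum_eq_zero fun a _ => by rw [congrFun hc a, Pi.zero_apply, zero_smul]

theorem exists_det_shiftEntry_ne_zero : ∃ f : Form (rectangle d hd).sections,
    (Matrix.of fun a b => f (shiftEntry hd a b)).det ≠ 0 := by
  -- With this form, the entry at (i,j), (i',j') is 1 if i = i' and j + j' + 1 = d, and 0 otherwise:
  -- the permutation matrix of the reversal of j.
  refine ⟨(lcoeff ℂ d ∘ₗ part 0 + lcoeff ℂ d ∘ₗ part 2) ∘ₗ
    ((rectangle d hd).sections 2).subtype, ?_⟩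
  have : (Matrix.of fun a b => ((lcoeff ℂ d ∘ₗ part 0 + lcoeff ℂ d ∘ₗ part 2) ∘ₗ
      ((rectangle d hd).sections 2).subtype) (shiftEntry hd a b)) =
      (1 : Matrix (Fin 2 × Fin d) (Fin 2 × Fin d) ℂ).submatrix
        (Equiv.prodCongr (Equiv.refl (Fin 2)) Fin.revPerm) id := by
    ext a b
    obtain ⟨i, j⟩ := a
    obtain ⟨i', j'⟩ := b
    have hj : d = j + j' + 1 ↔ j.rev = j' := by
      rw [Fin.ext_iff, Fin.val_rev]
      omega
    show (part 0 (shiftEntry hd (i, j) (i', j') : (rectangle d hd).SectionRing)).coeff d +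
      (part 2 (shiftEntry hd (i, j) (i', j') : (rectangle d hd).SectionRing)).coeff d =
        (1 : Matrix (Fin 2 × Fin d) (Fin 2 × Fin d) ℂ) (i, j.rev) (i', j')
    rw [part_shiftEntry, part_shiftEntry, Matrix.one_apply]
    fin_cases i <;> fin_cases i' <;> simp [coeff_X_pow, hj]
  rw [this, Matrix.det_permute, Matrix.det_one, mul_one]
  exact_mod_cast Units.ne_zero _

/-- For a general `f`, every representing functional has a nondegenerate shift. -/
theorem forGeneralForm_shiftNondegenerate : ForGeneralForm (rectangle d hd).sections
    fun f => ∀ Λ, Represents Λ f → ShiftNondegenerate Λ d :=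
  (forGeneralForm_det_ne_zero (shiftEntry hd) exists_det_shiftEntry_ne_zero).mono
    fun _ hf _ h => h.shiftNondegenerate hf

end rectangle

end LatticePolytope

/-! ### Bihomogeneous coordinates of points. -/

namespace LatticePolytope

namespace rectangle

open Polynomial BinaryForm

variable {d : ℕ} {hd : 1 ≤ d}

/-- Affine coordinates at a corner `v` with neighbours `h` and `t`: `hrel` says, without
subtraction, that `c` is reached from deg(c) • v by steps h - v and t - v. Since `l` does not vanish
at `v`, the steps can be evaluated as quotients. -/
theorem exists_eval_single_eq (l : Point (rectangle d hd).sections) {v h t : (rectangle d hd).cone}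
    (f₀ f₁ : (rectangle d hd).cone →+ ℕ)
    (hrel : ∀ c, c + (f₀ c + f₁ c) • v = f₀ c • h + f₁ c • t + (rectangle d hd).degree c • v)
    (hv : l.eval (AddMonoidAlgebra.single v 1) ≠ 0) :
    ∃ s x z : ℂ, ∀ c, l.eval (AddMonoidAlgebra.single c 1) =
      s ^ (rectangle d hd).degree c * (x ^ f₀ c * z ^ f₁ c) := by
  refine ⟨l.eval (AddMonoidAlgebra.single v 1),
    l.eval (AddMonoidAlgebra.single h 1) / l.eval (AddMonoidAlgebra.single v 1),
    l.eval (AddMonoidAlgebra.single t 1) / l.eval (AddMonoidAlgebra.single v 1), fun c => ?_⟩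
  have key := congrArg (fun c => l.eval (AddMonoidAlgebra.of ℂ (rectangle d hd).cone
    (Multiplicative.ofAdd c))) (hrel c)
  simp only [ofAdd_add, ofAdd_nsmul, map_mul, map_pow] at key
  change l.eval (AddMonoidAlgebra.single c 1) *
    l.eval (AddMonoidAlgebra.single v 1) ^ (f₀ c + f₁ c) =
    l.eval (AddMonoidAlgebra.single h 1) ^ f₀ c * l.eval (AddMonoidAlgebra.single t 1) ^ f₁ c *
      l.eval (AddMonoidAlgebra.single v 1) ^ (rectangle d hd).degree c at key
  rw [eq_comm, div_pow, div_pow, div_mul_div_comm, ← pow_add, ← mul_div_assoc,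
    div_eq_iff (pow_ne_zero _ hv), key]
  ring

theorem exists_corner_ne_zero (l : Point (rectangle d hd).sections) :
    ∃ (i : ℕ) (hi : i ≤ 1), l.eval (AddMonoidAlgebra.single (cell 1 i 0 hi (by omega)) 1) ≠ 0 ∨
      l.eval (AddMonoidAlgebra.single (cell 1 i d hi (by omega)) 1) ≠ 0 := by
  obtain ⟨g, hg, hg0⟩ := l.exists_ne_zero
  obtain ⟨c, hc, hc0⟩ : ∃ c, (rectangle d hd).degree c = 1 ∧
      l.eval (AddMonoidAlgebra.single c 1) ≠ 0 := by
    by_contra! h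
    exact hg0 ((rectangle d hd).sections_le (S := LinearMap.ker l.eval.toLinearMap) h hg)
  have hX : expX c ≤ 1 := hc ▸ expX_le c
  have hZ : expZ c ≤ d := by
    have := expZ_le c
    rwa [hc, one_mul] at this
  refine ⟨expX c, hX, ?_⟩
  by_contra! h
  -- A lattice point on a vertical side is a weighted mean of the two ends, so a point of X at which
  -- both ends vanish makes `c` vanish as well.
  have hrel : d • c = (d - expZ c) • cell 1 (expX c) 0 hX (by omega) +
      expZ c • cell 1 (expX c) d hX (by omega) := by
    refine cone_ext ?_ ?_ ?_
    · simp only [map_add, map_nsmul, degree_cell, hc, smul_eq_mul, mul_one]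
      omega
    · simp only [map_add, map_nsmul, expX_cell, smul_eq_mul]
      rw [← add_mul, Nat.sub_add_cancel hZ]
    · simp only [map_add, map_nsmul, expZ_cell, smul_eq_mul]
      rw [mul_zero, zero_add, mul_comm]
  have key := congrArg (fun c => l.eval (AddMonoidAlgebra.of ℂ (rectangle d hd).cone
    (Multiplicative.ofAdd c))) hrel
  simp only [ofAdd_add, ofAdd_nsmul, map_mul, map_pow] at key
  change l.eval (AddMonoidAlgebra.single c 1) ^ d =
    l.eval (AddMonoidAlgebra.single (cell 1 (expX c) 0 hX (by omega)) 1) ^ (d - expZ c) *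
    l.eval (AddMonoidAlgebra.single (cell 1 (expX c) d hX (by omega)) 1) ^ expZ c at key
  rw [h.1, h.2, ← pow_add, Nat.sub_add_cancel hZ, zero_pow (by omega)] at key
  exact pow_ne_zero _ hc0 key

/-- Every point has bihomogeneous coordinates. -/
theorem exists_coordinates (l : Point (rectangle d hd).sections) :
    ∃ s x y z w : ℂ, ¬(x = 0 ∧ y = 0) ∧ ¬(z = 0 ∧ w = 0) ∧
      ∀ k, ∀ a ∈ (rectangle d hd).sections k, l.eval a = s ^ k * subst x y z w a := by
  suffices h : ∃ s x y z w : ℂ, ¬(x = 0 ∧ y = 0) ∧ ¬(z = 0 ∧ w = 0) ∧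
      ∀ c, l.eval (AddMonoidAlgebra.single c 1) = s ^ (rectangle d hd).degree c *
        (x ^ expX c * y ^ expY c * (z ^ expZ c * w ^ expW c)) by
    obtain ⟨s, x, y, z, w, hxy, hzw, h⟩ := h
    refine ⟨s, x, y, z, w, hxy, hzw, fun k a ha => ?_⟩
    refine (rectangle d hd).ext_sections l.eval.toLinearMap
      (s ^ k • (subst x y z w).toLinearMap) (fun c hc => ?_) ha
    rw [LinearMap.smul_apply, AlgHom.toLinearMap_apply, AlgHom.toLinearMap_apply, subst_single,
      one_smul, h, hc, smul_eq_mul]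
  obtain ⟨i, hi, h⟩ := exists_corner_ne_zero l
  have hX := fun c : (rectangle d hd).cone => expX_add_expY c
  have hZ := fun c : (rectangle d hd).cone => expZ_add_expW c
  obtain ⟨e, rfl⟩ := Nat.exists_eq_add_of_le' hd
  have hi' : i = 0 ∨ i = 1 := by omega
  rcases hi' with rfl | rfl <;> rcases h with hv | hv
  · obtain ⟨s, x, z, key⟩ := exists_eval_single_eq l (h := cell 1 1 0 le_rfl (by omega))
      (t := cell 1 0 1 zero_le_one (by omega)) expX expZ (fun c => by
        refine cone_ext ?_ ?_ ?_ <;>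
          simp only [map_add, map_nsmul, degree_cell, expX_cell, expZ_cell, smul_eq_mul] <;>
          ring1) hv
    exact ⟨s, x, 1, z, 1, by simp, by simp,
      fun c => by rw [key, one_pow, one_pow, mul_one, mul_one]⟩
  · obtain ⟨s, x, z, key⟩ := exists_eval_single_eq l (h := cell 1 1 (e + 1) le_rfl (by omega))
      (t := cell 1 0 e zero_le_one (by omega)) expX expW (fun c => by
        have h2 := hZ c
        refine cone_ext ?_ ?_ ?_ <;>
          simp only [map_add, map_nsmul, degree_cell, expX_cell, expZ_cell, smul_eq_mul] <;>
          first | ring1 | linear_combination h2) hv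
    exact ⟨s, x, 1, 1, z, by simp, by simp,
      fun c => by rw [key, one_pow, one_pow, mul_one, one_mul]⟩
  · obtain ⟨s, x, z, key⟩ := exists_eval_single_eq l (h := cell 1 0 0 zero_le_one (by omega))
      (t := cell 1 1 1 le_rfl (by omega)) expY expZ (fun c => by
        have h1 := hX c
        refine cone_ext ?_ ?_ ?_ <;>
          simp only [map_add, map_nsmul, degree_cell, expX_cell, expZ_cell, smul_eq_mul] <;>
          first | ring1 | linear_combination h1) hv
    exact ⟨s, 1, x, z, 1, by simp, by simp,
      fun c => by rw [key, one_pow, one_pow, mul_one, one_mul]⟩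
  · obtain ⟨s, x, z, key⟩ := exists_eval_single_eq l (h := cell 1 0 (e + 1) zero_le_one (by omega))
      (t := cell 1 1 e le_rfl (by omega)) expY expW (fun c => by
        have h1 := hX c
        have h2 := hZ c
        refine cone_ext ?_ ?_ ?_ <;>
          simp only [map_add, map_nsmul, degree_cell, expX_cell, expZ_cell, smul_eq_mul] <;>
          first | ring1 | linear_combination h1 | linear_combination h2) hv
    exact ⟨s, 1, x, 1, z, by simp, by simp,
      fun c => by rw [key, one_pow, one_pow, one_mul, one_mul]⟩

/-- The point with given bihomogeneous coordinates. -/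
noncomputable def pointOfCoordinates (x y z w : ℂ) (hxy : ¬(x = 0 ∧ y = 0))
    (hzw : ¬(z = 0 ∧ w = 0)) : Point (rectangle d hd).sections where
  eval := subst x y z w
  exists_ne_zero := by
    obtain ⟨i, hi, h⟩ : ∃ i, i ≤ 1 ∧ x ^ i * y ^ (1 - i) ≠ 0 := by
      by_cases hx : x = 0
      · exact ⟨0, zero_le_one, by simpa using fun h => hxy ⟨hx, h⟩⟩
      · exact ⟨1, le_rfl, by simpa using hx⟩
    obtain ⟨j, hj, h'⟩ : ∃ j, j ≤ 1 * d ∧ z ^ j * w ^ (1 * d - j) ≠ 0 := by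
      by_cases hz : z = 0
      · exact ⟨0, zero_le, by simpa using fun h => absurd ⟨hz, h⟩ hzw⟩
      · exact ⟨1 * d, le_rfl, by simpa using fun h => absurd h hz⟩
    refine ⟨AddMonoidAlgebra.single (cell 1 i j hi hj) 1,
      (rectangle d hd).single_mem_sections (degree_cell ..) 1, ?_⟩
    rw [subst_single, one_smul]
    exact mul_ne_zero h h'

end rectangle

end LatticePolytope

/-! ### The rank of a general form on ℙ¹ × ℙ¹. -/

namespace LatticePolytope

namespace rectangle

open Polynomial BinaryForm

variable {d : ℕ} {hd : 1 ≤ d} {A : Type*} [CommRing A] [Algebra ℂ A] {F : ℂ[X] × ℂ[X]}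

theorem subst_smul (α β x y z w : A) {k : ℕ} {a : (rectangle d hd).SectionRing}
    (ha : a ∈ (rectangle d hd).sections k) :
    subst (α * x) (α * y) (β * z) (β * w) a = α ^ k * β ^ (k * d) * subst x y z w a := by
  refine (rectangle d hd).ext_sections (subst (α * x) (α * y) (β * z) (β * w)).toLinearMap
    (LinearMap.mulLeft ℂ (α ^ k * β ^ (k * d)) ∘ₗ (subst x y z w).toLinearMap) (fun c hc => ?_) ha
  simp only [LinearMap.comp_apply, AlgHom.toLinearMap_apply, subst_single, one_smul,
    LinearMap.mulLeft_apply]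
  rw [← hc, ← expZ_add_expW, ← expX_add_expY]
  ring

/-- The restriction of a form of bidegree `(1, d)` to the curve `(x, y) = (F₀, -F₁)`. -/
theorem subst_eq_hev_restrictOne (hF : F ∈ pairs (d + 2)) (z w : A)
    (g : (rectangle d hd).sections 1) :
    subst (hev (d + 1) z w F.1) (-hev (d + 1) z w F.2) z w (g : (rectangle d hd).SectionRing) =
      hev (2 * d + 1) z w (restrictOne F (partsOne hd g)) := by
  have h1 := mem_degreeLT_succ.1 hF.1
  have h2 := mem_degreeLT_succ.1 hF.2
  have h3 := mem_degreeLT_succ.1 (partsOne_mem g).1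
  have h4 := mem_degreeLT_succ.1 (partsOne_mem g).2
  have e : 2 * d + 1 = d + 1 + d := by omega
  rw [subst_eq_sum _ _ _ _ g.2, restrictOne_apply, map_sub, e, hev_mul z w h1 h4,
    hev_mul z w h2 h3, one_mul, Finset.sum_range_succ, Finset.sum_range_one, partsOne_apply]
  ring

variable (hd) in
/-- The three parts of a form of bidegree `(2, 2d)`. -/
noncomputable def partsTwo (g : (rectangle d hd).sections 2) (i : Fin 3) : ℂ[X] :=
  part i (g : (rectangle d hd).SectionRing)

theorem partsTwo_mem (g : (rectangle d hd).sections 2) (i : Fin 3) :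
    partsTwo hd g i ∈ degreeLT ℂ (2 * d + 1) := part_mem g.2 i

/-- The restriction of a form of bidegree `(2, 2d)` to the curve `(x, y) = (F₀, -F₁)`. -/
theorem subst_eq_hev_restrictTwo (hF : F ∈ pairs (d + 2)) (z w : A)
    (g : (rectangle d hd).sections 2) :
    subst (hev (d + 1) z w F.1) (-hev (d + 1) z w F.2) z w (g : (rectangle d hd).SectionRing) =
      hev (4 * d + 2) z w (restrictTwo F (partsTwo hd g)) := by
  have h1 := mem_degreeLT_succ.1 hF.1
  have h2 := mem_degreeLT_succ.1 hF.2
  have h := fun i => mem_degreeLT_succ.1 (partsTwo_mem g i)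
  have key : ∀ {p q r : ℂ[X]}, p.natDegree ≤ d + 1 → q.natDegree ≤ d + 1 → r.natDegree ≤ 2 * d →
      hev (4 * d + 2) z w (r * (p * q)) =
        hev (2 * d) z w r * (hev (d + 1) z w p * hev (d + 1) z w q) := by
    intro p q r hp hq hr
    have e : 4 * d + 2 = 2 * d + (d + 1 + (d + 1)) := by omega
    rw [e, hev_mul z w hr (natDegree_mul_le_of_le hp hq), hev_mul z w hp hq]
  rw [subst_eq_sum _ _ _ _ g.2, restrictTwo, map_add, map_sub, sq, sq, key h2 h2 (h 0),
    key h1 h2 (h 1), key h1 h1 (h 2), Finset.sum_range_succ, Finset.sum_range_succ,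
    Finset.sum_range_one]
  simp only [partsTwo]
  show _ = hev (2 * d) z w (part 0 (g : (rectangle d hd).SectionRing)) * _ -
    hev (2 * d) z w (part 1 (g : (rectangle d hd).SectionRing)) * _ +
    hev (2 * d) z w (part 2 (g : (rectangle d hd).SectionRing)) * _
  ring

theorem natDegree_restrictTwo_le (hF : F ∈ pairs (d + 2)) (g : (rectangle d hd).sections 2) :
    (restrictTwo F (partsTwo hd g)).natDegree ≤ 4 * d + 2 := by
  have h1 := mem_degreeLT_succ.1 hF.1
  have h2 := mem_degreeLT_succ.1 hF.2
  have h := fun i => mem_degreeLT_succ.1 (partsTwo_mem g i)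
  have key : ∀ {p q r : ℂ[X]}, p.natDegree ≤ d + 1 → q.natDegree ≤ d + 1 → r.natDegree ≤ 2 * d →
      (r * (p * q)).natDegree ≤ 4 * d + 2 := fun hp hq hr =>
    (natDegree_mul_le_of_le hr (natDegree_mul_le_of_le hp hq)).trans (by omega)
  rw [restrictTwo, sq, sq]
  exact natDegree_add_le_of_degree_le (natDegree_sub_le_of_le (key h2 h2 (h 0))
    (key h1 h2 (h 1)) |>.trans (max_self _).le) (key h1 h1 (h 2))

variable {Λ : Fin 3 → ℂ[X] →ₗ[ℂ] ℂ} {f : Form (rectangle d hd).sections}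

theorem xRank_eq (h : Represents Λ f) (hf : Function.Bijective (catalecticant f))
    (hΛ' : ShiftNondegenerate Λ d) :
    xRank f = Module.finrank ℂ ((rectangle d hd).sections 1) := by
  have hΛ := h.nondegenerate hf
  -- Any irreducible apolar curve will do here, so the extra linear condition is 0.
  obtain ⟨F, hF, -, hcop, hlead⟩ := exists_irreducible hΛ hΛ' 0
  obtain ⟨μ, hμ⟩ := exists_functional_restrictTwo hF hcop hlead
  obtain ⟨D, hD, hdeg, hsep⟩ := exists_separable (μ := μ) (m := 2 * d + 1)
    fun p hp => functional_nondegenerate hΛ hF hcop hlead hμ hp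
  have hD0 : D ≠ 0 := hsep.ne_zero
  have hcard : D.roots.toFinset.card = Module.finrank ℂ ((rectangle d hd).sections 1) := by
    rw [Multiset.toFinset_card_of_nodup (nodup_roots hsep), finrank_sections_one,
      (IsAlgClosed.splits D).natDegree_eq_card_roots.symm, hdeg]
  let e := Finset.equivFinOfCardEq hcard
  have hne : ∀ t : ℂ, ¬(F.1.eval t = 0 ∧ -F.2.eval t = 0) := by
    rintro t ⟨h1, h2⟩
    obtain ⟨a, b, hab⟩ := hcop
    have := congrArg (eval t) hab
    rw [eval_add, eval_mul, eval_mul, h1, neg_eq_zero.1 h2, eval_one] at this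
    simp at this
  let p : Fin (Module.finrank ℂ ((rectangle d hd).sections 1)) → Point (rectangle d hd).sections :=
    fun i => pointOfCoordinates (F.1.eval (e.symm i : ℂ)) (-F.2.eval (e.symm i : ℂ))
      (e.symm i : ℂ) 1 (hne _) (by simp)
  -- By duality it suffices that `f` kills each `g` vanishing at the points over the roots of `D`.
  -- Such a `g` restricts to a multiple Dq with deg q ≤ 2d, and μ(Dq) = 0.
  refine xRank_eq_finrank hf p (mem_span_of_iInf_ker_le_ker fun g hg => ?_)
  have hroot : ∀ t ∈ D.roots, (restrictTwo F (partsTwo hd g)).IsRoot t := by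
    intro t ht
    have h1 : (p (e ⟨t, Multiset.mem_toFinset.2 ht⟩)).square g = 0 :=
      (Submodule.mem_iInf _).1 hg _
    have h2 : (p (e ⟨t, Multiset.mem_toFinset.2 ht⟩)).square g =
        subst (F.1.eval t) (-F.2.eval t) t 1 (g : (rectangle d hd).SectionRing) := by
      show subst _ _ _ _ _ = _
      rw [Equiv.symm_apply_apply]
      rfl
    have h3 := subst_eq_hev_restrictTwo hF.1 t 1 g
    rw [hev_one_right t (mem_degreeLT_succ.1 hF.1.1), hev_one_right t (mem_degreeLT_succ.1 hF.1.2),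
      hev_one_right t (natDegree_restrictTwo_le hF.1 g), coe_aeval_eq_eval, ← h2, h1] at h3
    exact h3.symm
  have hdvd : D ∣ restrictTwo F (partsTwo hd g) := by
    by_cases h0 : restrictTwo F (partsTwo hd g) = 0
    · rw [h0]
      exact dvd_zero _
    · refine ((IsAlgClosed.splits D).dvd_iff_roots_le_roots hD0 h0).2 ?_
      exact (Multiset.le_iff_subset (nodup_roots hsep)).2 fun t ht => (mem_roots h0).2 (hroot t ht)
  obtain ⟨q, hq⟩ := hdvd
  have hq' : q ∈ degreeLT ℂ (2 * d + 1) := by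
    refine mem_degreeLT_of_mul hdeg hD0 ?_
    rw [← hq, show 2 * d + 1 + 1 + (2 * d + 1) = 4 * d + 2 + 1 by ring]
    exact mem_degreeLT_succ.2 (natDegree_restrictTwo_le hF.1 g)
  have := hμ _ (partsTwo_mem g)
  rw [hq, hD.2 q hq'] at this
  rw [LinearMap.mem_ker, h g]
  exact this.symm

end rectangle

end LatticePolytope

/-! ### An apolar scheme of length 2d + 2 through every point. -/

namespace LatticePolytope

namespace rectangle

open Polynomial BinaryForm

variable {d : ℕ} {hd : 1 ≤ d} {F : ℂ[X] × ℂ[X]}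

/-- Coprimality excludes common zeros at finite points, and the condition on leading coefficients
excludes infinity; hence (F₀, -F₁) is a morphism from ℙ¹. -/
theorem not_hev_eq_zero (hF : F ∈ pairs (d + 2)) (hcop : IsCoprime F.1 F.2)
    (hlead : ¬(F.1.coeff (d + 1) = 0 ∧ F.2.coeff (d + 1) = 0)) {z w : ℂ} (hzw : ¬(z = 0 ∧ w = 0)) :
    ¬(hev (d + 1) z w F.1 = 0 ∧ hev (d + 1) z w F.2 = 0) := by
  have h1 := mem_degreeLT_succ.1 hF.1
  have h2 := mem_degreeLT_succ.1 hF.2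
  by_cases hw : w = 0
  · have hz : z ≠ 0 := fun hz => hzw ⟨hz, hw⟩
    have key : ∀ {p : ℂ[X]}, p.natDegree ≤ d + 1 → hev (d + 1) z w p = 0 → p.coeff (d + 1) = 0 := by
      intro p hp h0
      have := hev_smul_smul z 1 0 hp
      rw [mul_one, mul_zero, ← hw, h0, hw, hev_one_zero hp] at this
      exact (mul_eq_zero.1 this.symm).resolve_left (pow_ne_zero _ hz)
    exact fun h => hlead ⟨key h1 h.1, key h2 h.2⟩
  · have key : ∀ {p : ℂ[X]}, p.natDegree ≤ d + 1 → hev (d + 1) z w p = 0 →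
        p.eval (z / w) = 0 := by
      intro p hp h0
      have := hev_smul_smul w (z / w) 1 hp
      rw [mul_one, mul_div_cancel₀ _ hw, h0, hev_one_right _ hp, coe_aeval_eq_eval] at this
      exact (mul_eq_zero.1 this.symm).resolve_left (pow_ne_zero _ hw)
    rintro ⟨ha, hb⟩
    obtain ⟨a, b, hab⟩ := hcop
    have := congrArg (eval (z / w)) hab
    rw [eval_add, eval_mul, eval_mul, key h1 ha, key h2 hb, eval_one, mul_zero, mul_zero,
      add_zero] at this
    exact zero_ne_one this

theorem chart_eq_zero {m : ℕ} {s : ℂ} {p : ℂ[X]} (hp : p.natDegree ≤ m) (h : chart m s p = 0) :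
    p = 0 := by
  rw [← hev_chart m s hp, h, map_zero]

theorem eval_chart (m : ℕ) (s u : ℂ) (p : ℂ[X]) :
    (chart m s p).eval u = hev m (1 + s * u) u p := by
  have := map_hev (aeval u : ℂ[X] →ₐ[ℂ] ℂ) m (1 + C s * X) X p
  simp only [map_add, map_one, map_mul, aeval_X, aeval_C, Algebra.algebraMap_self_apply] at this
  exact this

/-- The forms of bidegree `(1, d)` are determined by their restriction to a divisor of degree
`2d + 2` on the curve `(x, y) = (F₀, -F₁)`, and every function on it arises in this way. -/
theorem exists_section_eq (hF : F ∈ pairs (d + 2)) (hcop : IsCoprime F.1 F.2)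
    (hlead : ¬(F.1.coeff (d + 1) = 0 ∧ F.2.coeff (d + 1) = 0)) (s : ℂ) {E : ℂ[X]}
    (hE : E.natDegree = 2 * d + 2) (y : ℂ[X] ⧸ Ideal.span {E}) :
    ∃ g ∈ (rectangle d hd).sections 1, (Ideal.Quotient.mkₐ ℂ (Ideal.span {E})).comp
      (subst (chart (d + 1) s F.1) (-chart (d + 1) s F.2) (1 + C s * X) X) g = y := by
  have hE0 : E ≠ 0 := by
    rintro rfl
    simp at hE
  let T : (rectangle d hd).sections 1 →ₗ[ℂ] ℂ[X] ⧸ Ideal.span {E} :=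
    ((Ideal.Quotient.mkₐ ℂ (Ideal.span {E})).comp (subst (chart (d + 1) s F.1)
      (-chart (d + 1) s F.2) (1 + C s * X) X)).toLinearMap ∘ₗ ((rectangle d hd).sections 1).subtype
  have hT : Function.Injective T := by
    rw [← LinearMap.ker_eq_bot, LinearMap.ker_eq_bot']
    intro g hg
    have h1 : E ∣ subst (chart (d + 1) s F.1) (-chart (d + 1) s F.2) (1 + C s * X) X
        (g : (rectangle d hd).SectionRing) :=
      Ideal.mem_span_singleton.1 (Ideal.Quotient.eq_zero_iff_mem.1 hg)
    have h2 := mem_degreeLT_succ.1 (restrictOne_mem hF (partsOne_mem g))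
    rw [chart, subst_eq_hev_restrictOne hF] at h1
    have h3 := eq_zero_of_dvd_of_natDegree_lt h1
      ((natDegree_chart_le (2 * d + 1) s h2).trans_lt (by omega))
    have h4 := eq_zero_of_restrictOne_eq_zero hF hcop hlead (partsOne_mem g) (chart_eq_zero h2 h3)
    exact partsOne_injective (h4.trans (map_zero _).symm)
  have hfin : Module.Finite ℂ (ℂ[X] ⧸ Ideal.span {E}) :=
    Module.finite_of_finrank_pos (by rw [finrank_quotient_span_eq_natDegree, hE]; omega)
  obtain ⟨g, hg⟩ := (LinearMap.injective_iff_surjective_of_finrank_eq_finrank (f := T) (by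
    rw [finrank_sections_one, finrank_quotient_span_eq_natDegree, hE])).1 hT y
  exact ⟨g, g.2, hg⟩

variable {Λ : Fin 3 → ℂ[X] →ₗ[ℂ] ℂ} {f : Form (rectangle d hd).sections}

/-- Every point lies on a subscheme of length `2d + 2` that is apolar to `f`. -/
theorem exists_apolar (h : Represents Λ f) (hf : Function.Bijective (catalecticant f))
    (hΛ' : ShiftNondegenerate Λ d) (l : Point (rectangle d hd).sections) :
    ∃ Z : ZeroDimSubscheme (rectangle d hd).sections (2 * d + 2), Z.IsApolar f ∧ l ∈ Z.support := by
  obtain ⟨s, x, y, z, w, hxy, hzw, hl⟩ := exists_coordinates l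
  -- The linear condition on F is that the curve F = 0 passes through `l`.
  obtain ⟨F, hF, hφ, hcop, hlead⟩ := exists_irreducible (h.nondegenerate hf) hΛ'
    (y • hev (d + 1) z w ∘ₗ LinearMap.fst ℂ ℂ[X] ℂ[X] +
      x • hev (d + 1) z w ∘ₗ LinearMap.snd ℂ ℂ[X] ℂ[X])
  replace hφ : y * hev (d + 1) z w F.1 + x * hev (d + 1) z w F.2 = 0 := hφ
  obtain ⟨κ, hκ, hκ1, hκ2⟩ : ∃ κ : ℂ, κ ≠ 0 ∧ hev (d + 1) z w F.1 = κ * x ∧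
      -hev (d + 1) z w F.2 = κ * y := by
    have hab := not_hev_eq_zero hF.1 hcop hlead hzw
    by_cases hx : x = 0
    · have hy : y ≠ 0 := fun hy => hxy ⟨hx, hy⟩
      rw [hx, zero_mul, add_zero] at hφ
      have ha := (mul_eq_zero.1 hφ).resolve_left hy
      exact ⟨-hev (d + 1) z w F.2 / y, div_ne_zero (neg_ne_zero.2 fun hb => hab ⟨ha, hb⟩) hy,
        by rw [ha, hx, mul_zero], (div_mul_cancel₀ _ hy).symm⟩
    · refine ⟨hev (d + 1) z w F.1 / x, div_ne_zero (fun ha => hab ⟨ha, ?_⟩) hx,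
        (div_mul_cancel₀ _ hx).symm, ?_⟩
      · rw [ha, mul_zero, zero_add] at hφ
        exact (mul_eq_zero.1 hφ).resolve_left hx
      · field_simp
        linear_combination -hφ
  obtain ⟨μ, hμ⟩ := exists_functional_restrictTwo hF hcop hlead
  -- D has degree at most 2d + 2 and is orthogonal to forms of degree 2d. This leaves dimension at
  -- least 2, so D can also be made to vanish at the parameter (z, w) of `l`.
  obtain ⟨D, hD, hD0, hDμ, hDl⟩ := exists_orthogonal μ (m := 2 * d + 3) (n := 2 * d + 1) (r := 1)
    (by omega) fun _ => hev (2 * d + 2) z w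
  replace hDl := hDl 0
  replace hD := mem_degreeLT_succ.1 hD
  -- The chart is centred so that D does not vanish at its point at infinity; the divisor of D is
  -- then Spec of ℂ[u] modulo one polynomial of degree 2d + 2.
  obtain ⟨t, ht⟩ : ∃ t, D.eval t ≠ 0 := by
    by_contra! h0
    exact hD0 (Polynomial.funext fun t => by rw [h0, eval_zero])
  have hE : (chart (2 * d + 2) t D).natDegree = 2 * d + 2 :=
    natDegree_eq_of_coeff_ne_zero (mem_degreeLT_succ.2 (natDegree_chart_le _ t hD))
      (by rwa [coeff_chart _ t hD])
  have hc : z - t * w ≠ 0 := by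
    intro hc
    obtain rfl : z = w * t := by linear_combination hc
    have hw : w ≠ 0 := fun hw => hzw ⟨by rw [hw, zero_mul], hw⟩
    have := hev_smul_smul w t 1 hD
    rw [mul_one, hDl, hev_one_right t hD, coe_aeval_eq_eval] at this
    exact mul_ne_zero (pow_ne_zero _ hw) ht this.symm
  -- In the chart, `l` has coordinate u = w / c, and (z, w) = c · (1 + tu, u).
  set c := z - t * w with hc_def
  have hz : c * (1 + t * (w / c)) = z := by
    field_simp
    rw [hc_def]
    ring
  have hw : c * (w / c) = w := mul_div_cancel₀ _ hc
  let ψ := (Ideal.Quotient.mkₐ ℂ (Ideal.span {chart (2 * d + 2) t D})).comp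
      (subst (hd := hd) (chart (d + 1) t F.1) (-chart (d + 1) t F.2) (1 + C t * X) X)
  have hψ : ∀ a, ψ a = 0 → chart (2 * d + 2) t D ∣
      subst (chart (d + 1) t F.1) (-chart (d + 1) t F.2) (1 + C t * X) X a := fun a ha =>
    Ideal.mem_span_singleton.1 (Ideal.Quotient.eq_zero_iff_mem.1 ha)
  suffices hZ : ∃ Z : ZeroDimSubscheme (rectangle d hd).sections
      (Module.finrank ℂ (ℂ[X] ⧸ Ideal.span {chart (2 * d + 2) t D})),
      Z.IsApolar f ∧ l ∈ Z.support by
    rwa [finrank_quotient_span_eq_natDegree, hE] at hZ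
  have hfin : Module.Finite ℂ (ℂ[X] ⧸ Ideal.span {chart (2 * d + 2) t D}) :=
    Module.finite_of_finrank_pos (by rw [finrank_quotient_span_eq_natDegree, hE]; omega)
  refine ⟨ZeroDimSubscheme.ofAlgHom ψ (exists_section_eq hF.1 hcop hlead t hE), ?_, ?_⟩
  · intro g hg
    have h1 := hψ _ (ZeroDimSubscheme.mem_ofAlgHom_ideal _ _ hg)
    rw [chart, chart, subst_eq_hev_restrictTwo hF.1] at h1
    have e : 4 * d + 2 = 2 * d + 2 + 2 * d := by ring
    have h2 := natDegree_restrictTwo_le hF.1 g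
    rw [e] at h1 h2
    obtain ⟨q, hq, hqD⟩ := exists_eq_mul_of_chart_dvd hD ht h2 h1
    have h3 := hμ _ (partsTwo_mem g)
    rw [hqD, hDμ q (mem_degreeLT_succ.2 hq)] at h3
    rw [h g]
    exact h3.symm
  · have key : ∀ k, ∀ a ∈ (rectangle d hd).sections k, ψ a = 0 → l.eval a = 0 := by
      intro k a ha hψa
      obtain ⟨r, hr⟩ := hψ a hψa
      have h1 := map_subst (aeval (w / c) : ℂ[X] →ₐ[ℂ] ℂ) (chart (d + 1) t F.1)
        (-chart (d + 1) t F.2) (1 + C t * X) X a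
      simp only [hr, map_neg, map_add, map_one, map_mul, aeval_X, aeval_C,
        Algebra.algebraMap_self_apply, coe_aeval_eq_eval, eval_chart] at h1
      have hscale : ∀ {m : ℕ} {p : ℂ[X]}, p.natDegree ≤ m →
          hev m z w p = c ^ m * hev m (1 + t * (w / c)) (w / c) p := by
        intro m p hp
        rw [← hev_smul_smul c _ _ hp, hz, hw]
      have h2 : hev (2 * d + 2) (1 + t * (w / c)) (w / c) D = 0 := by
        have := hscale hD
        rw [hDl] at this
        exact (mul_eq_zero.1 this.symm).resolve_left (pow_ne_zero _ hc)
      rw [h2, zero_mul] at h1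
      -- The vanishing at u = w / c is carried to (x, y, z, w) by rescaling: c turns chart
      -- coordinates into (z, w), its power c^(d+1) turns the values of F into those at (z, w), and
      -- `κ` turns these into (x, y).
      have h3 := subst_smul (c ^ (d + 1)) c (hev (d + 1) (1 + t * (w / c)) (w / c) F.1)
        (-hev (d + 1) (1 + t * (w / c)) (w / c) F.2) (1 + t * (w / c)) (w / c) ha
      rw [← h1, mul_zero, mul_neg, ← hscale (mem_degreeLT_succ.1 hF.1.1),
        ← hscale (mem_degreeLT_succ.1 hF.1.2), hz, hw, hκ1, hκ2] at h3
      have h4 := subst_smul κ 1 x y z w ha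
      rw [one_mul, one_mul, h3, one_pow, mul_one] at h4
      rw [hl k a ha, (mul_eq_zero.1 h4.symm).resolve_left (pow_ne_zero _ hκ), mul_zero]
    intro a ha
    rw [← DirectSum.sum_support_decompose (rectangle d hd).sections a, map_sum]
    exact Finset.sum_eq_zero fun k _ => key k _ (SetLike.coe_mem _)
      (ZeroDimSubscheme.mem_ofAlgHom_ideal _ _
        ((ZeroDimSubscheme.ofAlgHom ψ _).ideal.isHomogeneous k ha))

end rectangle

end LatticePolytope

theorem mainTheorem2 :
    (∀ (n : ℕ) (P : LatticePolytope n), 0 < n → P.IsVeryAmple →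
      ForGeneralForm P.sections
        (fun f : Form P.sections => Function.Bijective (catalecticant f)) ∧
      ∀ f : Form P.sections, Function.Bijective (catalecticant f) →
        xRank f = Module.finrank ℂ (P.sections 1) →
        (∀ Z : ZeroDimSubscheme P.sections (Module.finrank ℂ (P.sections 1)), Z.IsApolar f →
          ∀ l ∈ Z.support, Z.IsNonreducedAt l ↔ antipolar f l = 0) ∧
        ranestadSchreyerLocus f = antipolarLocus f ∩
          {l | ∃ Z : ZeroDimSubscheme P.sections (Module.finrank ℂ (P.sections 1)),
            Z.IsApolar f ∧ l ∈ Z.support} ∧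
        antipolarLocus f ⊆ forbiddenLocus f ∧
        (forbiddenLocus f).Nonempty) ∧
    (∀ (d : ℕ) (hd : 1 ≤ d),
      (LatticePolytope.rectangle d hd).IsVeryAmple ∧
      Module.finrank ℂ ((LatticePolytope.rectangle d hd).sections 1) = 2 * d + 2 ∧
      ForGeneralForm (LatticePolytope.rectangle d hd).sections
        (fun f : Form (LatticePolytope.rectangle d hd).sections =>
          Function.Bijective (catalecticant f) ∧
          xRank f = Module.finrank ℂ ((LatticePolytope.rectangle d hd).sections 1) ∧
          ranestadSchreyerLocus f = antipolarLocus f ∧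
          antipolarLocus f ⊆ forbiddenLocus f ∧
          (forbiddenLocus f).Nonempty)) := by
  constructor
  · intro n P hn _
    have hgen := P.isGeneratedInHighDegree
    refine ⟨P.forGeneralForm_bijective, fun f hf hr => ?_⟩
    have hsub := antipolarLocus_subset_forbiddenLocus hgen hf hr
    exact ⟨fun Z hZ l hl => isNonreducedAt_iff_antipolar_eq_zero hgen hf rfl Z hZ hl,
      ranestadSchreyerLocus_eq hgen hf hr, hsub, (antipolarLocus_nonempty
        (fun q hq => P.exists_eval_eq_zero hn two_pos hq) hf).mono hsub⟩
  · intro d hd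
    have hgen := (LatticePolytope.rectangle d hd).isGeneratedInHighDegree
    refine ⟨LatticePolytope.rectangle.isVeryAmple, LatticePolytope.rectangle.finrank_sections_one,
      ((LatticePolytope.rectangle d hd).forGeneralForm_bijective.and
        LatticePolytope.rectangle.forGeneralForm_shiftNondegenerate).mono ?_⟩
    rintro f ⟨hf, hshift⟩
    obtain ⟨Λ, hΛ⟩ := LatticePolytope.rectangle.exists_represents f
    have hr := LatticePolytope.rectangle.xRank_eq hΛ hf (hshift Λ hΛ)
    have hsub := antipolarLocus_subset_forbiddenLocus hgen hf hr
    refine ⟨hf, hr, ?_, hsub, (antipolarLocus_nonempty (fun q hq =>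
      (LatticePolytope.rectangle d hd).exists_eval_eq_zero two_pos two_pos hq) hf).mono hsub⟩
    rw [ranestadSchreyerLocus_eq hgen hf hr, LatticePolytope.rectangle.finrank_sections_one]
    -- Every point of X lies on an apolar scheme of length 2d + 2, so the second set in the
    -- intersection is everything.
    exact Set.inter_eq_left.2 fun l _ =>
      LatticePolytope.rectangle.exists_apolar hΛ hf (hshift Λ hΛ) l
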